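/- For $u\in(0,1)$ put $$v_1=\frac{1+u}{1+u+u^2},\quad v_2=1,\quad v_3=\frac{u(1+u)}{1+u+u^2},\quad v_4=\frac{u}{1+u+u^2},$$ and for a function $N$ on $(0,\infty)$ write $N_{i,k}=N(\omega v_i/v_k)$ and $$\overline{\mathcal C}(N)(\omega)=\int_0^1\frac{\big(\prod_{i=1}^4v_i\big)^{-\beta-\frac12}}{1+u+u^2}\sum_{j,k=1}^4(-1)^{j+k}\,v_j^{2\beta+\frac32}\,v_k^{2\beta-\frac12}\prod_{i\ne j}N_{i,k}\;du .$$ Let $\beta\in(-1,1)$, let $p_0$ be a positive integer with $p_0>\max\big(\frac1{4(1-\beta)},\frac1{4(1+\beta)}\big)$, and let $X$ be the space of $N\in L^\infty(0,\infty)$ whose weak derivative satisfies $DN:=\omega N'\in L^{2p_0}(0,\infty)\cap L^\infty(0,\infty)$, with norm $\|N\|_X=\|N\|_{L^\infty}+\|DN\|_{L^{2p_0}}+\|DN\|_{L^\infty}$; elements of $X$ are identified with their continuous representatives. For $T>0$ and $N_0\in X$ consider the Cauchy problem $\partial_tN=\overline{\mathcal C}(N)$, $N(0)=N_0$. A function $N\in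 L^\infty(0,T;X)$ (jointly measurable in $(t,\omega)$, with $N(t)\in X$ for a.e. $t$ and $\|N(t)\|_X$ essentially bounded) is a *mild solution* on $[0,T]$ if for every $\omega>0$ the integrand defining $\overline{\mathcal C}(N(t))(\omega)$ is integrable in $(t,u)\in(0,T)\times(0,1)$ and $$N(t,\omega)=N_0(\omega)+\int_0^t\overline{\mathcal C}(N(s))(\omega)\,ds\qquad\text{for all }t\in[0,T].$$ It is a *strong solution* on $[0,T]$ if $N(0,\omega)=N_0(\omega)$ for every $\omega>0$, $\partial_tN$ is bounded (that is, $N$ is Lipschitz in $t\in[0,T]$ uniformly in $\omega$), and for every $\omega>0$ the derivative $\partial_tN(t,\omega)$ exists and equals $\overline{\mathcal C}(N(t))(\omega)$ for a.e. $t\in(0,T)$. **Theorem.** Let $N_0\in X$ with $\inf_{\omega>0}N_0(\omega)>0$. Then there is $T=T(N_0,p_0,\beta)>0$ and a function $N\in L^\infty(0,T;X)$ that is both a strong and a mild solution of the Cauchy problem on $[0,T]$. It is unique: for every $0<T'\le T$, every mild solution and every strong solution in $L^\infty(0,T';X)$ on $[0,T']$ with the same initial data coincides with $N$ on $[0,T']\times(0,\infty)$.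 Moreover $\inf_{t\in[0,T],\,\omega>0}N(t,\omega)>0$, and $N$ is continuous on $[0,T]\times(0,\infty)$ and differentiable at almost every point of $(0,T)\times(0,\infty)$. -/

import Mathlib

open MeasureTheory Set
open scoped ENNReal NNReal

namespace MMT

/-- The functions `v₁, v₂, v₃, v₄` of `u` that parameterize the non-trivial resonances
(the indices `1, 2, 3, 4` are `0, 1, 2, 3 : Fin 4`). -/
noncomputable def v (i : Fin 4) (u : ℝ) : ℝ :=
  ![(1 + u) / (1 + u + u ^ 2), 1, u * (1 + u) / (1 + u + u ^ 2), u / (1 + u + u ^ 2)] i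

/-- The integrand (in `u`) of the collision operator at the point `ω`. With
`N_{i,k} = N (ω v_i / v_k)`, the quotient `(∏ i, N_{i,k}) / N_{j,k}` is the product over `i ≠ j`,
which also makes sense where `N_{j,k} = 0`. Counting indices from `0` does not change the
sign `(-1)^(j+k)`. -/
noncomputable def collisionIntegrand (β : ℝ) (N : ℝ → ℝ) (ω u : ℝ) : ℝ :=
  (∏ i, v i u) ^ (-β - 1 / 2) / (1 + u + u ^ 2) *
    ∑ j : Fin 4, ∑ k : Fin 4,
      (-1) ^ ((j : ℕ) + (k : ℕ)) * v j u ^ (2 * β + 3 / 2) * v k u ^ (2 * β - 1 / 2) *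
        ∏ i ∈ Finset.univ.erase j, N (ω * v i u / v k u)

/-- The collision operator `C̄(N)(ω)`. -/
noncomputable def collision (β : ℝ) (N : ℝ → ℝ) (ω : ℝ) : ℝ :=
  ∫ u in Ioo (0 : ℝ) 1, collisionIntegrand β N ω u

/-- Lebesgue measure on the half-line `(0, ∞)`. -/
noncomputable def halfLine : Measure ℝ := volume.restrict (Ioi 0)

/-- `G = D N`, that is, `G(ω) = ω N'(ω)` on `(0, ∞)`, where `N'` is the weak derivative of `N`. -/
def IsWeakD (N G : ℝ → ℝ) : Prop :=
  LocallyIntegrableOn N (Ioi 0) ∧ LocallyIntegrableOn G (Ioi 0) ∧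
    ∀ φ : ℝ → ℝ, ContDiff ℝ (⊤ : ℕ∞) φ → HasCompactSupport φ → tsupport φ ⊆ Ioi 0 →
      ∫ ω in Ioi (0 : ℝ), N ω * deriv φ ω = -∫ ω in Ioi (0 : ℝ), G ω / ω * φ ω

/-- The norm `‖N‖_{L^∞} + ‖DN‖_{L^{2p₀}} + ‖DN‖_{L^∞}` on `(0, ∞)`. The weak derivative is unique
almost everywhere, so that the infimum is over a single value; it is `∞` if there is
no weak derivative. -/
noncomputable def normX (p₀ : ℕ) (N : ℝ → ℝ) : ℝ≥0∞ :=
  eLpNorm N ∞ halfLine +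
    ⨅ (G : ℝ → ℝ) (_ : IsWeakD N G),
      (eLpNorm G (2 * (p₀ : ℝ≥0∞)) halfLine + eLpNorm G ∞ halfLine)

/-- Membership in `X`. An element of `X` is locally Lipschitz on `(0, ∞)` after a modification on
a null set; it is represented by its continuous representative, so that its
values at points make sense. -/
def MemX (p₀ : ℕ) (N : ℝ → ℝ) : Prop :=
  ContinuousOn N (Ioi 0) ∧ normX p₀ N < ∞

/-- `N ∈ L^∞(0, T; X)`, for `N t ω` a function of `t ∈ (0, T)` and `ω ∈ (0, ∞)`. -/
def MemLinftyX (p₀ : ℕ) (T : ℝ) (N : ℝ → ℝ → ℝ) : Prop :=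
  AEStronglyMeasurable (fun z : ℝ × ℝ => N z.1 z.2) (volume.restrict (Ioo 0 T ×ˢ Ioi 0)) ∧
    ∃ C : ℝ≥0, ∀ᵐ t ∂(volume.restrict (Ioo 0 T)), MemX p₀ (N t) ∧ normX p₀ (N t) ≤ C

/-- Mild solutions in `L^∞(0, T; X)` of `∂ₜ N = C̄(N)`, `N(0) = N₀`: the time-integrated equation
holds for every `t ∈ [0, T]` and every `ω > 0`, with absolutely convergent integrals. -/
structure IsMildSolution (β : ℝ) (p₀ : ℕ) (T : ℝ) (N₀ : ℝ → ℝ) (N : ℝ → ℝ → ℝ) : Prop where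
  mem : MemLinftyX p₀ T N
  integrable : ∀ ω : ℝ, 0 < ω →
    IntegrableOn (fun z : ℝ × ℝ => collisionIntegrand β (N z.1) ω z.2) (Ioo 0 T ×ˢ Ioo 0 1)
  eqn : ∀ ω : ℝ, 0 < ω → ∀ t ∈ Icc 0 T, N t ω = N₀ ω + ∫ s in (0 : ℝ)..t, collision β (N s) ω

/-- Strong solutions in `L^∞(0, T; X)` of `∂ₜ N = C̄(N)`, `N(0) = N₀`: the time derivative is
bounded (equivalently, `N` is Lipschitz in `t`, uniformly in `ω`), and the equation holds for every
`ω > 0` at almost every time. -/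
structure IsStrongSolution (β : ℝ) (p₀ : ℕ) (T : ℝ) (N₀ : ℝ → ℝ) (N : ℝ → ℝ → ℝ) : Prop where
  mem : MemLinftyX p₀ T N
  init : ∀ ω : ℝ, 0 < ω → N 0 ω = N₀ ω
  lipschitz : ∃ L : ℝ≥0, ∀ ω : ℝ, 0 < ω → LipschitzOnWith L (fun t => N t ω) (Icc 0 T)
  eqn : ∀ ω : ℝ, 0 < ω → ∀ᵐ t ∂(volume.restrict (Ioo 0 T)),
    HasDerivAt (fun s => N s ω) (collision β (N t) ω) t

end MMT

/-!
The collision integrand is singular at `u = 0`, like `u^(-2β-1)` and `u^(-3/2)`, but it is a sum of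
brackets in which two values of `N` at nearby points nearly cancel (`core`). For a function that is
bounded and Lipschitz in `log ω` (`GoodFn`) the integrand is therefore `O(u^s)` with some `s > -1`,
and the collision operator is bounded. A difference of two such functions is only small in the
supremum norm, however, and in its collision integral the singular weights remain. They are
harmless for two reasons: the worst terms have a sign, and the others cancel upon integration in `u`.

Let `W = N - M`. Up to a remainder bounded by `u^s` times values of `|W|`, the difference of the two
integrands is
* a diffusive part `∑ᵢ Rᵢ (W(ω vᵢ / v_k) - W(ω))`, the generator of a jump process whose rates
  `Rᵢ` (`jumpRate`) are products of two values of `N` and hence nonnegative as long as `N` is;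
* a cross part, with the weight `u^(-3/2)` in front of differences `H(u) - H(φ(u))`, where `φ` is the
  identity up to third order. After the substitution `φ` the difference falls on the weight,
  and the cross part is of the size of the remainder as well (`NearId.abs_integral_le`).

So an explicit Euler step for the operator with a cutoff `reg ε` near `u = 0`, and with a step `τ` so
small that the jump probabilities do not exceed `1`, maps `W` to an average of `W` of total mass
`1 + O(τ)`. This gives its stability in the supremum norm (`step_sup_le`), with a constant independent
of `ε`. In `L^p` one uses Jensen's inequality: the jump process is symmetric up to the kernel
`u^s` (`exists_jumpRate_symm`), so that the gain and loss terms cancel after integration over `ω`,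
and for `p = 2 p₀` the powers `u^r`, `r = 1/p`, left over in the remainder make up for the Jacobians of
the dilations (`step_energy_le`). It is here that the bound `p₀ > 1 / (4 (1 - β))` is used: it says that
`1 - 2β - r > -1`.

The operator commutes with dilations of `ω`. Applied to `W(ω) = N(aω) - N(ω)`, the two estimates
propagate the Lipschitz constant in `log ω` and the `L^{2p₀}` norms of dilation differences, along
with upper and lower bounds for `N`, over a time that does not depend on `ε` and `τ`
(`euler_bounds`, `euler_energy_le`). Applied to two approximate solutions, `step_sup_le` shows that the
Euler schemes form a Cauchy sequence as `ε, τ → 0` (`ApproxSol.abs_sub_le`, `exists_limit`) and that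
solutions are unique (`IntegralSol.unique`); a competing solution need not be nonnegative, since only
one of the two functions enters the jump rates.

Membership in `X` is equivalent to these bounds: a continuous function with a weak derivative is its
integral (`IsWeakD.sub_eq_integral`), which bounds dilation differences by the norm of `X`, and
conversely Fatou's lemma applies to difference quotients (`GoodFn.normX_le`). Finally the solution is
Lipschitz in `(t, ω)` on every set `ω ≥ δ`, so that Rademacher's theorem applies.
-/

namespace MMT

/-! ### The weights of the collision integrand -/

/-- The factor `κ(u) = 1 / (1 + u + u²)`, so that `v₁ = (1 + u) κ`, `v₃ = u v₁`, `v₄ = u κ`. -/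
noncomputable def kap (u : ℝ) : ℝ := 1 / (1 + u + u ^ 2)

/-- The part of the prefactor `(∏ vᵢ)^(-β-1/2) / (1 + u + u²)` that stays regular at `u = 0`; the
singular part is `u^(-2β-1)`. -/
noncomputable def mu (β u : ℝ) : ℝ := v 0 u ^ (-2 * β - 1) * kap u ^ (1 / 2 - β)

lemma v_zero (u : ℝ) : v 0 u = (1 + u) * kap u := by simp [v, kap, div_eq_mul_inv]
lemma v_one (u : ℝ) : v 1 u = 1 := by simp [v]
lemma v_two (u : ℝ) : v 2 u = u * v 0 u := by simp [v, mul_div_assoc]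
lemma v_three (u : ℝ) : v 3 u = u * kap u := by simp [v, kap, div_eq_mul_inv]

lemma kap_pos {u : ℝ} (hu : u ∈ Ioo (0 : ℝ) 1) : 0 < kap u := by
  have := hu.1; unfold kap; positivity

lemma kap_mem {u : ℝ} (hu : u ∈ Ioo (0 : ℝ) 1) : kap u ∈ Icc (1 / 3 : ℝ) 1 := by
  obtain ⟨h0, h1⟩ := hu
  unfold kap
  constructor
  · apply one_div_le_one_div_of_le <;> nlinarith
  · rw [div_le_one (by positivity)]; nlinarith

lemma kap_mul {u : ℝ} (hu : u ∈ Ioo (0 : ℝ) 1) : kap u * (1 + u + u ^ 2) = 1 := by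
  have := hu.1; unfold kap; field_simp

lemma v_zero_mem {u : ℝ} (hu : u ∈ Ioo (0 : ℝ) 1) : v 0 u ∈ Icc (2 / 3 : ℝ) 1 := by
  have hk := kap_mul hu
  have hp := kap_pos hu
  obtain ⟨h0, h1⟩ := hu
  rw [v_zero]
  constructor
  · nlinarith [mul_pos hp h0, mul_nonneg hp.le (mul_nonneg h0.le (sub_nonneg.2 h1.le)),
      mul_nonneg hp.le (sub_nonneg.2 h1.le)]
  · nlinarith [mul_pos hp h0, mul_pos hp (mul_pos h0 h0)]

lemma v_zero_mem' {u : ℝ} (hu : u ∈ Ioo (0 : ℝ) 1) : v 0 u ∈ Icc (1 / 3 : ℝ) 1 :=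
  ⟨by linarith [(v_zero_mem hu).1], (v_zero_mem hu).2⟩

lemma v_zero_pos {u : ℝ} (hu : u ∈ Ioo (0 : ℝ) 1) : 0 < v 0 u := by
  linarith [(v_zero_mem hu).1]

lemma one_sub_v_zero {u : ℝ} (hu : u ∈ Ioo (0 : ℝ) 1) : 1 - v 0 u = u ^ 2 * kap u := by
  rw [v_zero]; linarith [kap_mul hu]

lemma abs_v_zero_sub_one_le {u : ℝ} (hu : u ∈ Ioo (0 : ℝ) 1) : |v 0 u - 1| ≤ u ^ 2 := by
  rw [abs_sub_comm, one_sub_v_zero hu, abs_of_nonneg (by have := kap_pos hu; positivity)]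
  nlinarith [(kap_mem hu).2, sq_nonneg u]

lemma v_pos {u : ℝ} (hu : u ∈ Ioo (0 : ℝ) 1) (i : Fin 4) : 0 < v i u := by
  have h0 := hu.1
  have := v_zero_pos hu
  have := kap_pos hu
  fin_cases i
  · exact v_zero_pos hu
  · simp [v_one]
  · change 0 < v 2 u
    rw [v_two]; positivity
  · change 0 < v 3 u
    rw [v_three]; positivity

/-- The dilation factor `vᵢ / v_k` lies between multiples of `u^{±1}`; from below it is of order `u`
for `k = 0, 1` and of order one for `k = 2, 3`. -/
lemma ratio_lower {u : ℝ} (hu : u ∈ Ioo (0 : ℝ) 1) (i k : Fin 4) :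
    (if (k : ℕ) ≤ 1 then u else 1) / 3 ≤ v i u / v k u := by
  have h0 := hu.1
  have h1 := hu.2
  have hv := v_zero_mem' hu
  have hk := kap_mem hu
  have hlow : ∀ i, u / 3 ≤ v i u := by
    intro i
    fin_cases i
    · change u / 3 ≤ v 0 u
      linarith [hv.1]
    · simp only [Fin.mk_one, v_one]; linarith
    · change u / 3 ≤ v 2 u
      rw [v_two]; nlinarith [hv.1]
    · change u / 3 ≤ v 3 u
      rw [v_three]; nlinarith [hk.1]
  rw [le_div_iff₀ (v_pos hu k)]
  fin_cases k
  · change u / 3 * v 0 u ≤ v i u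
    nlinarith [hlow i, hv.2]
  · change u / 3 * v 1 u ≤ v i u
    rw [v_one]; linarith [hlow i]
  · change 1 / 3 * v 2 u ≤ v i u
    rw [v_two]; nlinarith [hlow i, hv.2]
  · change 1 / 3 * v 3 u ≤ v i u
    rw [v_three]; nlinarith [hlow i, hk.2]

/-- Real powers are bounded and Lipschitz on `[1/3, 1]`. -/
lemma exists_rpow_bound (e : ℝ) : ∃ C : ℝ, 1 ≤ C ∧ ∀ x ∈ Icc (1 / 3 : ℝ) 1,
    0 ≤ x ^ e ∧ x ^ e ≤ C ∧ ∀ y ∈ Icc (1 / 3 : ℝ) 1, |x ^ e - y ^ e| ≤ C * |x - y| := by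
  have hc : ∀ p : ℝ, ContinuousOn (fun x : ℝ => x ^ p) (Icc (1 / 3 : ℝ) 1) := by
    intro p x hx
    exact (Real.continuousAt_rpow_const _ _ (Or.inl (by linarith [hx.1]))).continuousWithinAt
  obtain ⟨C₁, h₁⟩ := isCompact_Icc.exists_bound_of_continuousOn (hc e)
  obtain ⟨C₂, h₂⟩ := isCompact_Icc.exists_bound_of_continuousOn
    ((continuousOn_const (c := e)).mul (hc (e - 1)))
  refine ⟨max 1 (max C₁ C₂), le_max_left _ _, fun x hx => ⟨?_, ?_, fun y hy => ?_⟩⟩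
  · exact Real.rpow_nonneg (by linarith [hx.1]) _
  · exact ((le_abs_self _).trans (h₁ x hx)).trans ((le_max_left _ _).trans (le_max_right _ _))
  · have := (convex_Icc (1 / 3 : ℝ) 1).norm_image_sub_le_of_norm_hasDerivWithin_le
      (f := fun x : ℝ => x ^ e) (f' := fun x => e * x ^ (e - 1)) (C := max 1 (max C₁ C₂))
      (fun z hz => (Real.hasDerivAt_rpow_const (Or.inl (by linarith [hz.1]))).hasDerivWithinAt)
      (fun z hz => (h₂ z hz).trans ((le_max_right _ _).trans (le_max_right _ _))) hy hx
    simpa [Real.norm_eq_abs] using this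

/-- `f` is nonnegative, bounded by `C` and `C`-Lipschitz on `(0, 1)`. -/
def BddLip (C : ℝ) (f : ℝ → ℝ) : Prop :=
  ∀ u ∈ Ioo (0 : ℝ) 1, 0 ≤ f u ∧ f u ≤ C ∧ ∀ w ∈ Ioo (0 : ℝ) 1, |f u - f w| ≤ C * |u - w|

lemma BddLip.mono {C D : ℝ} {f : ℝ → ℝ} (h : BddLip C f) (hCD : C ≤ D) : BddLip D f :=
  fun u hu => ⟨(h u hu).1, (h u hu).2.1.trans hCD, fun w hw =>
    ((h u hu).2.2 w hw).trans (mul_le_mul_of_nonneg_right hCD (abs_nonneg _))⟩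

lemma BddLip.mul {C D : ℝ} {f g : ℝ → ℝ} (hC : 0 ≤ C) (hD : 0 ≤ D) (hf : BddLip C f)
    (hg : BddLip D g) : BddLip (2 * (C * D)) (fun u => f u * g u) := by
  intro u hu
  obtain ⟨f0, f1, f2⟩ := hf u hu
  obtain ⟨g0, g1, g2⟩ := hg u hu
  refine ⟨mul_nonneg f0 g0, ?_, fun w hw => ?_⟩
  · nlinarith [mul_le_mul f1 g1 g0 hC, mul_nonneg hC hD]
  · have e : f u * g u - f w * g w = f u * (g u - g w) + (f u - f w) * g w := by ring
    obtain ⟨g0', g1', -⟩ := hg w hw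
    rw [e]
    refine (abs_add_le _ _).trans ?_
    rw [abs_mul, abs_mul, abs_of_nonneg f0, abs_of_nonneg g0']
    have h1 := mul_le_mul f1 (g2 w hw) (abs_nonneg _) hC
    have h2 := mul_le_mul (f2 w hw) g1' g0' (mul_nonneg hC (abs_nonneg _))
    nlinarith

lemma BddLip.continuousOn {C : ℝ} {f : ℝ → ℝ} (h : BddLip C f) :
    ContinuousOn f (Ioo 0 1) := by
  have : LipschitzOnWith C.toNNReal f (Ioo 0 1) := by
    refine LipschitzOnWith.of_dist_le_mul fun x hx y hy => ?_
    rw [Real.dist_eq, Real.dist_eq]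
    exact ((h x hx).2.2 y hy).trans
      (mul_le_mul_of_nonneg_right (Real.le_coe_toNNReal C) (abs_nonneg _))
  exact this.continuousOn

lemma kap_lip {u w : ℝ} (hu : u ∈ Ioo (0 : ℝ) 1) (hw : w ∈ Ioo (0 : ℝ) 1) :
    |kap u - kap w| ≤ 3 * |u - w| := by
  have e : kap u - kap w = (w - u) * (1 + u + w) * (kap u * kap w) := by
    have := hu.1; have := hw.1; unfold kap; field_simp; ring
  have h1 := kap_mem hu
  have h2 := kap_mem hw
  rw [e, abs_mul, abs_mul, abs_sub_comm w u, abs_of_nonneg (a := 1 + u + w)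
    (by linarith [hu.1, hw.1]), abs_of_nonneg (a := kap u * kap w)
    (mul_nonneg (by linarith [h1.1]) (by linarith [h2.1]))]
  have h3 : kap u * kap w ≤ 1 := by nlinarith [h1.1, h2.1, h1.2, h2.2]
  have h3' : 0 ≤ kap u * kap w := mul_nonneg (by linarith [h1.1]) (by linarith [h2.1])
  have h4 : (1 + u + w) * (kap u * kap w) ≤ 3 * 1 :=
    mul_le_mul (by linarith [hu.2, hw.2]) h3 h3' (by norm_num)
  nlinarith [abs_nonneg (u - w)]

lemma v_zero_lip {u w : ℝ} (hu : u ∈ Ioo (0 : ℝ) 1) (hw : w ∈ Ioo (0 : ℝ) 1) :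
    |v 0 u - v 0 w| ≤ 7 * |u - w| := by
  have e : v 0 u - v 0 w = (u - w) * kap u + (1 + w) * (kap u - kap w) := by
    rw [v_zero, v_zero]; ring
  rw [e]
  refine (abs_add_le _ _).trans ?_
  rw [abs_mul, abs_mul, abs_of_pos (kap_pos hu), abs_of_pos (a := 1 + w) (by linarith [hw.1])]
  have h1 := kap_mem hu
  have h2 := kap_lip hu hw
  have h3 : (1 + w) * |kap u - kap w| ≤ 2 * (3 * |u - w|) :=
    mul_le_mul (by linarith [hw.2]) h2 (abs_nonneg _) (by norm_num)
  nlinarith [abs_nonneg (u - w), h1.2]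

lemma exists_bddLip_kap (e : ℝ) : ∃ C : ℝ, 1 ≤ C ∧ BddLip C (fun u => kap u ^ e) := by
  obtain ⟨C, hC, h⟩ := exists_rpow_bound e
  refine ⟨3 * C, by linarith, fun u hu => ?_⟩
  obtain ⟨h0, h1, h2⟩ := h _ (kap_mem hu)
  refine ⟨h0, by linarith, fun w hw => (h2 _ (kap_mem hw)).trans ?_⟩
  nlinarith [kap_lip hu hw]

lemma exists_bddLip_v_zero (e : ℝ) : ∃ C : ℝ, 1 ≤ C ∧ BddLip C (fun u => v 0 u ^ e) := by
  obtain ⟨C, hC, h⟩ := exists_rpow_bound e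
  refine ⟨7 * C, by linarith, fun u hu => ?_⟩
  obtain ⟨h0, h1, h2⟩ := h _ (v_zero_mem' hu)
  refine ⟨h0, by linarith, fun w hw => (h2 _ (v_zero_mem' hw)).trans ?_⟩
  nlinarith [v_zero_lip hu hw]

/-- One constant for all regular weights: the powers of `v₁` and `κ` and the factor `μ`. -/
structure WeightBound (β C : ℝ) : Prop where
  one_le : 1 ≤ C
  mu : BddLip C (mu β)
  va : BddLip C (fun u => v 0 u ^ (2 * β + 3 / 2))
  vb : BddLip C (fun u => v 0 u ^ (2 * β - 1 / 2))
  ka : BddLip C (fun u => kap u ^ (2 * β + 3 / 2))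
  kb : BddLip C (fun u => kap u ^ (2 * β - 1 / 2))
  va_sub_one : ∀ u ∈ Ioo (0 : ℝ) 1, |v 0 u ^ (2 * β + 3 / 2) - 1| ≤ C * u ^ 2
  ka_sub_va : ∀ u ∈ Ioo (0 : ℝ) 1,
    |kap u ^ (2 * β + 3 / 2) - v 0 u ^ (2 * β + 3 / 2)| ≤ C * u

lemma exists_weightBound (β : ℝ) : ∃ C : ℝ, WeightBound β C := by
  obtain ⟨C₁, h₁, b₁⟩ := exists_bddLip_v_zero (-2 * β - 1)
  obtain ⟨C₂, h₂, b₂⟩ := exists_bddLip_kap (1 / 2 - β)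
  obtain ⟨C₃, h₃, b₃⟩ := exists_bddLip_v_zero (2 * β + 3 / 2)
  obtain ⟨C₄, h₄, b₄⟩ := exists_bddLip_v_zero (2 * β - 1 / 2)
  obtain ⟨C₅, h₅, b₅⟩ := exists_bddLip_kap (2 * β + 3 / 2)
  obtain ⟨C₆, h₆, b₆⟩ := exists_bddLip_kap (2 * β - 1 / 2)
  obtain ⟨C₇, h₇, b₇⟩ := exists_rpow_bound (2 * β + 3 / 2)
  have hm : 0 ≤ 2 * (C₁ * C₂) := by positivity
  refine ⟨2 * (C₁ * C₂) + C₃ + C₄ + C₅ + C₆ + C₇, by linarith, ?_, b₃.mono ?_, b₄.mono ?_,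
    b₅.mono ?_, b₆.mono ?_, fun u hu => ?_, fun u hu => ?_⟩
  · exact (b₁.mul (by linarith) (by linarith) b₂).mono (by linarith)
  iterate 4 linarith
  · obtain ⟨-, -, h⟩ := b₇ _ (v_zero_mem' hu)
    have := h 1 (by norm_num)
    rw [Real.one_rpow] at this
    refine this.trans (mul_le_mul (by linarith) (abs_v_zero_sub_one_le hu) (abs_nonneg _)
      (by linarith))
  · obtain ⟨-, -, h⟩ := b₇ _ (kap_mem hu)
    refine (h _ (v_zero_mem' hu)).trans (mul_le_mul (by linarith) ?_ (abs_nonneg _)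
      (by linarith))
    have e : kap u - v 0 u = -(u * kap u) := by rw [v_zero]; ring
    rw [e, abs_neg, abs_of_nonneg (mul_nonneg hu.1.le (kap_pos hu).le)]
    nlinarith [(kap_mem hu).2, hu.1]

/-- The values `N_{i,k} = N (ω vᵢ / v_k)` entering the collision integrand. -/
noncomputable def sample (N : ℝ → ℝ) (ω u : ℝ) (i k : Fin 4) : ℝ := N (ω * v i u / v k u)

/-- The collision integrand as a cubic polynomial in the sixteen values `n i k = N_{i,k}`, with the
powers of `u` separated from the regular weights. In every bracket the two terms of opposite sign
nearly cancel at `u = 0`. -/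
noncomputable def core (β u : ℝ) (n : Fin 4 → Fin 4 → ℝ) : ℝ :=
  let va := v 0 u ^ (2 * β + 3 / 2)
  let vb := v 0 u ^ (2 * β - 1 / 2)
  let ka := kap u ^ (2 * β + 3 / 2)
  let kb := kap u ^ (2 * β - 1 / 2)
  mu β u * (u ^ (-2 * β - 1) * ((n 0 1 - va * n 1 1) * (n 2 1 * n 3 1)
      - vb * ((n 0 0 - va * n 1 0) * (n 2 0 * n 3 0)))
    + u ^ (1 / 2 : ℝ) * ((ka * n 2 1 - va * n 3 1) * (n 0 1 * n 1 1)
      - vb * ((ka * n 2 0 - va * n 3 0) * (n 0 0 * n 1 0)))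
    + u ^ (-3 / 2 : ℝ) * (kb * ((n 0 3 - va * n 1 3) * (n 2 3 * n 3 3))
      - vb * ((n 0 2 - va * n 1 2) * (n 2 2 * n 3 2)))
    + u ^ (2 * β) * (kb * ((ka * n 2 3 - va * n 3 3) * (n 0 3 * n 1 3))
      - vb * ((ka * n 2 2 - va * n 3 2) * (n 0 2 * n 1 2))))

lemma collisionIntegrand_eq_core (β : ℝ) (N : ℝ → ℝ) (ω : ℝ) {u : ℝ} (hu : u ∈ Ioo (0 : ℝ) 1) :
    collisionIntegrand β N ω u = core β u (sample N ω u) := by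
  set n := sample N ω u with hn
  set va := v 0 u ^ (2 * β + 3 / 2) with hva
  set vb := v 0 u ^ (2 * β - 1 / 2) with hvb
  set ka := kap u ^ (2 * β + 3 / 2) with hka
  set kb := kap u ^ (2 * β - 1 / 2) with hkb
  have h0 := hu.1
  have hv := v_zero_pos hu
  have hk := kap_pos hu
  have hprod : (∏ i, v i u) ^ (-β - 1 / 2) / (1 + u + u ^ 2) = u ^ (-2 * β - 1) * mu β u := by
    have e1 : ∏ i, v i u = (u * v 0 u) ^ (2 : ℕ) * kap u := by
      rw [Fin.prod_univ_four, v_one, v_two, v_three]; ring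
    rw [e1, div_eq_mul_one_div, show 1 / (1 + u + u ^ 2) = kap u from rfl,
      Real.mul_rpow (by positivity) hk.le, ← Real.rpow_natCast_mul (by positivity),
      Real.mul_rpow h0.le hv.le, mul_assoc, ← Real.rpow_add_one hk.ne', mu]
    rw [show ((2 : ℕ) : ℝ) * (-β - 1 / 2) = -2 * β - 1 by push_cast; ring,
      show -β - 1 / 2 + 1 = 1 / 2 - β by ring, mul_assoc]
  have hv2a : v 2 u ^ (2 * β + 3 / 2) = u ^ (2 * β + 3 / 2) * va := by
    rw [v_two, Real.mul_rpow h0.le hv.le]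
  have hv2b : v 2 u ^ (2 * β - 1 / 2) = u ^ (2 * β - 1 / 2) * vb := by
    rw [v_two, Real.mul_rpow h0.le hv.le]
  have hv3a : v 3 u ^ (2 * β + 3 / 2) = u ^ (2 * β + 3 / 2) * ka := by
    rw [v_three, Real.mul_rpow h0.le hk.le]
  have hv3b : v 3 u ^ (2 * β - 1 / 2) = u ^ (2 * β - 1 / 2) * kb := by
    rw [v_three, Real.mul_rpow h0.le hk.le]
  have p1 : u ^ (1 / 2 : ℝ) = u ^ (-2 * β - 1) * u ^ (2 * β + 3 / 2) := by
    rw [← Real.rpow_add h0]; congr 1; ring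
  have p2 : u ^ (-3 / 2 : ℝ) = u ^ (-2 * β - 1) * u ^ (2 * β - 1 / 2) := by
    rw [← Real.rpow_add h0]; congr 1; ring
  have p3 : u ^ (2 * β) = u ^ (-2 * β - 1) * u ^ (2 * β + 3 / 2) * u ^ (2 * β - 1 / 2) := by
    rw [← Real.rpow_add h0, ← Real.rpow_add h0]; congr 1; ring
  have hP : ∀ j k : Fin 4, ∏ i ∈ Finset.univ.erase j, N (ω * v i u / v k u)
      = ![n 1 k * n 2 k * n 3 k, n 0 k * n 2 k * n 3 k, n 0 k * n 1 k * n 3 k,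
        n 0 k * n 1 k * n 2 k] j := by
    intro j k
    fin_cases j
    · rw [show (Finset.univ : Finset (Fin 4)).erase ⟨0, by norm_num⟩ = {1, 2, 3} by decide]
      simp [hn, sample, mul_assoc]
    · rw [show (Finset.univ : Finset (Fin 4)).erase ⟨1, by norm_num⟩ = {0, 2, 3} by decide]
      simp [hn, sample, mul_assoc]
    · rw [show (Finset.univ : Finset (Fin 4)).erase ⟨2, by norm_num⟩ = {0, 1, 3} by decide]
      simp [hn, sample, mul_assoc]
    · rw [show (Finset.univ : Finset (Fin 4)).erase ⟨3, by norm_num⟩ = {0, 1, 2} by decide]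
      simp [hn, sample, mul_assoc]
  unfold collisionIntegrand
  rw [hprod]
  simp only [hP, Fin.sum_univ_four, v_one, hv2a, hv2b, hv3a, hv3b, Real.one_rpow, core, ← hva,
    ← hvb, ← hka, ← hkb, p1, p2, p3]
  simp
  ring

/-! ### Pointwise bounds for the collision integrand -/

/-- `N` is bounded by `A` on `(0, ∞)` and `A`-Lipschitz there as a function of `log ω`; for a
continuous `N` this says that `N` and `D N` are bounded by `A`. -/
structure GoodFn (A : ℝ) (N : ℝ → ℝ) : Prop where
  bound : ∀ ω : ℝ, 0 < ω → |N ω| ≤ A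
  lip : ∀ x : ℝ, 0 < x → ∀ y : ℝ, 0 < y → |N x - N y| ≤ A * |Real.log x - Real.log y|

lemma GoodFn.nonneg {A : ℝ} {N : ℝ → ℝ} (h : GoodFn A N) : 0 ≤ A :=
  (abs_nonneg _).trans (h.bound 1 one_pos)

lemma GoodFn.mono {A B : ℝ} {N : ℝ → ℝ} (h : GoodFn A N) (hAB : A ≤ B) : GoodFn B N :=
  ⟨fun ω hω => (h.bound ω hω).trans hAB, fun x hx y hy => (h.lip x hx y hy).trans
    (mul_le_mul_of_nonneg_right hAB (abs_nonneg _))⟩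

lemma GoodFn.continuousOn {A : ℝ} {N : ℝ → ℝ} (h : GoodFn A N) : ContinuousOn N (Ioi 0) := by
  intro x hx
  have hx : 0 < x := hx
  have hlog : Filter.Tendsto (fun y => A * |Real.log y - Real.log x|) (nhds x) (nhds 0) := by
    have : ContinuousAt (fun y => A * |Real.log y - Real.log x|) x :=
      ((Real.continuousAt_log hx.ne').sub continuousAt_const).abs.const_mul A
    simpa [ContinuousAt] using this
  rw [ContinuousWithinAt, tendsto_iff_dist_tendsto_zero]
  refine squeeze_zero' (Filter.Eventually.of_forall fun _ => dist_nonneg) ?_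
    (hlog.mono_left nhdsWithin_le_nhds)
  filter_upwards [self_mem_nhdsWithin] with y hy
  exact h.lip y hy x hx

/-- Bounds for the sixteen values `n i k`: the values with `i = 0, 1` differ by `O(u²)`, those with
`i = 2, 3` by `O(u)`. -/
structure SampleBound (A u : ℝ) (n : Fin 4 → Fin 4 → ℝ) : Prop where
  bound : ∀ i k, |n i k| ≤ A
  sub01 : ∀ k, |n 0 k - n 1 k| ≤ 2 * A * u ^ 2
  sub23 : ∀ k, |n 2 k - n 3 k| ≤ A * u

lemma mul_ratio_pos {ω u : ℝ} (hω : 0 < ω) (hu : u ∈ Ioo (0 : ℝ) 1) (i k : Fin 4) :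
    0 < ω * v i u / v k u := div_pos (mul_pos hω (v_pos hu i)) (v_pos hu k)

lemma GoodFn.sampleBound {A : ℝ} {N : ℝ → ℝ} (h : GoodFn A N) {ω u : ℝ} (hω : 0 < ω)
    (hu : u ∈ Ioo (0 : ℝ) 1) : SampleBound A u (sample N ω u) := by
  have hA := h.nonneg
  have hlog : ∀ i j k, |Real.log (ω * v i u / v k u) - Real.log (ω * v j u / v k u)|
      = |Real.log (v i u / v j u)| := by
    intro i j k
    have h1 := (v_pos hu i).ne'
    have h2 := (v_pos hu j).ne'
    have h3 := (v_pos hu k).ne'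
    rw [← Real.log_div (mul_ratio_pos hω hu i k).ne' (mul_ratio_pos hω hu j k).ne']
    congr 2
    field_simp
  refine ⟨fun i k => h.bound _ (mul_ratio_pos hω hu i k), fun k => ?_, fun k => ?_⟩
  · refine (h.lip _ (mul_ratio_pos hω hu 0 k) _ (mul_ratio_pos hω hu 1 k)).trans ?_
    rw [hlog, v_one, div_one, mul_comm 2 A, mul_assoc]
    refine mul_le_mul_of_nonneg_left ?_ hA
    have hv := v_zero_mem hu
    have h0 := v_zero_pos hu
    rw [abs_of_nonpos (Real.log_nonpos h0.le hv.2)]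
    have h1 := Real.one_sub_inv_le_log_of_pos h0
    have h2 : (v 0 u)⁻¹ - 1 = (1 - v 0 u) * (v 0 u)⁻¹ := by field_simp
    have h3 : (v 0 u)⁻¹ ≤ 2 := by
      rw [inv_le_comm₀ h0 two_pos]; linarith [hv.1]
    have h4 : 1 - v 0 u ≤ u ^ 2 := by
      have := abs_v_zero_sub_one_le hu
      rw [abs_le] at this
      linarith [this.1]
    have h5 : (1 - v 0 u) * (v 0 u)⁻¹ ≤ u ^ 2 * 2 :=
      mul_le_mul h4 h3 (inv_nonneg.2 h0.le) (sq_nonneg u)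
    linarith
  · refine (h.lip _ (mul_ratio_pos hω hu 2 k) _ (mul_ratio_pos hω hu 3 k)).trans ?_
    rw [hlog]
    refine mul_le_mul_of_nonneg_left ?_ hA
    have h0 := hu.1
    have e : v 2 u / v 3 u = 1 + u := by
      have := (kap_pos hu).ne'
      rw [v_two, v_three, v_zero]; field_simp
    rw [e, abs_of_nonneg (Real.log_nonneg (by linarith))]
    linarith [Real.log_le_sub_one_of_pos (show 0 < 1 + u by linarith)]

/-- Admissible exponents: `r = 1 / (2 p₀)` and an exponent `s > -1` such that `u^s` dominates all
kernels of the collision operator. -/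
structure Exponents (β r s : ℝ) : Prop where
  r_pos : 0 < r
  r_le : r ≤ 1 / 2
  s_gt : -1 < s
  s_le : s ≤ 0
  s_le₁ : s ≤ 1 - 2 * β - r
  s_le₂ : s ≤ 2 * β + 1

lemma rpow_le_rpow_of_mem {u x y : ℝ} (hu : u ∈ Ioo (0 : ℝ) 1) (h : y ≤ x) : u ^ x ≤ u ^ y :=
  Real.rpow_le_rpow_of_exponent_ge hu.1 hu.2.le h

lemma abs_sub_mul_le {C A u a x y : ℝ} (hC : 1 ≤ C) (hA : 0 ≤ A) (ha : |a - 1| ≤ C * u ^ 2)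
    (hxy : |x - y| ≤ 2 * A * u ^ 2) (hy : |y| ≤ A) : |x - a * y| ≤ 3 * C * A * u ^ 2 := by
  have e : x - a * y = (x - y) - (a - 1) * y := by ring
  rw [e]
  refine (abs_sub _ _).trans ?_
  rw [abs_mul]
  have h1 := mul_le_mul ha hy (abs_nonneg _) (by positivity)
  nlinarith [mul_nonneg hA (sq_nonneg u)]

lemma abs_mul_sub_mul_le {C A u a b x y : ℝ} (hC : 1 ≤ C) (hb0 : 0 ≤ b)
    (hb : b ≤ C) (hab : |a - b| ≤ C * u) (hxy : |x - y| ≤ A * u)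
    (hx : |x| ≤ A) (hu : 0 ≤ u) : |a * x - b * y| ≤ 2 * C * A * u := by
  have e : a * x - b * y = (a - b) * x + b * (x - y) := by ring
  rw [e]
  refine (abs_add_le _ _).trans ?_
  rw [abs_mul, abs_mul, abs_of_nonneg hb0]
  have h1 := mul_le_mul hab hx (abs_nonneg _) (by positivity)
  have h2 := mul_le_mul hb hxy (abs_nonneg _) (by linarith)
  nlinarith

lemma abs_mul_le_of_nonneg {C K m x : ℝ} (hm0 : 0 ≤ m) (hm : m ≤ C) (hx : |x| ≤ K) :
    |m * x| ≤ C * K := by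
  rw [abs_mul, abs_of_nonneg hm0]
  exact mul_le_mul hm hx (abs_nonneg _) (hm0.trans hm)

lemma abs_mul_three_le {A B x y z : ℝ} (hx : |x| ≤ B) (hy : |y| ≤ A) (hz : |z| ≤ A) (hB : 0 ≤ B)
    (hA : 0 ≤ A) : |x * (y * z)| ≤ B * (A * A) := by
  rw [abs_mul, abs_mul]
  exact mul_le_mul hx (mul_le_mul hy hz (abs_nonneg _) hA) (by positivity) hB

/-- `b x - c y` is at most `2 C K` in absolute value when `b, c ∈ [0, C]` and `|x|, |y| ≤ K`. -/
lemma abs_weighted_sub_le {C K b c x y : ℝ} (hb0 : 0 ≤ b) (hb : b ≤ C)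
    (hc0 : 0 ≤ c) (hc : c ≤ C) (hx : |x| ≤ K) (hy : |y| ≤ K) :
    |b * x - c * y| ≤ 2 * C * K := by
  refine (abs_sub _ _).trans ?_
  rw [abs_mul, abs_mul, abs_of_nonneg hb0, abs_of_nonneg hc0]
  have h1 := mul_le_mul hb hx (abs_nonneg _) (by linarith)
  have h2 := mul_le_mul hc hy (abs_nonneg _) (by linarith)
  linarith

/-- The cancellation in each bracket makes up for the singular power of `u` in front of it: the
integrand is dominated by the integrable kernel `u^s`. -/
lemma abs_core_le {β C r s A u : ℝ} (hW : WeightBound β C) (hE : Exponents β r s) (hA : 0 ≤ A)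
    (hu : u ∈ Ioo (0 : ℝ) 1) {n : Fin 4 → Fin 4 → ℝ} (hn : SampleBound A u n) :
    |core β u n| ≤ 20 * C ^ 3 * A ^ 3 * u ^ s := by
  have hC := hW.one_le
  have hC0 : 0 ≤ C := by linarith
  obtain ⟨m0, m1, -⟩ := hW.mu u hu
  obtain ⟨va0, va1, -⟩ := hW.va u hu
  obtain ⟨vb0, vb1, -⟩ := hW.vb u hu
  obtain ⟨ka0, ka1, -⟩ := hW.ka u hu
  obtain ⟨kb0, kb1, -⟩ := hW.kb u hu
  have h0 := hu.1
  unfold core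
  beta_reduce at va0 va1 vb0 vb1 ka0 ka1 kb0 kb1
  set va := v 0 u ^ (2 * β + 3 / 2)
  set vb := v 0 u ^ (2 * β - 1 / 2)
  set ka := kap u ^ (2 * β + 3 / 2)
  set kb := kap u ^ (2 * β - 1 / 2)
  have hX : ∀ k, |(n 0 k - va * n 1 k) * (n 2 k * n 3 k)| ≤ 3 * C * A * u ^ 2 * (A * A) := fun k =>
    abs_mul_three_le (abs_sub_mul_le hC hA (hW.va_sub_one u hu) (hn.sub01 k) (hn.bound 1 k))
      (hn.bound 2 k) (hn.bound 3 k) (by positivity) hA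
  have hY : ∀ k, |(ka * n 2 k - va * n 3 k) * (n 0 k * n 1 k)| ≤ 2 * C * A * u * (A * A) := fun k =>
    abs_mul_three_le (abs_mul_sub_mul_le hC va0 va1 (hW.ka_sub_va u hu) (hn.sub23 k)
      (hn.bound 2 k) h0.le) (hn.bound 0 k) (hn.bound 1 k) (by positivity) hA
  have t1 := abs_weighted_sub_le zero_le_one hC vb0 vb1 (hX 1) (hX 0)
  have t2 := abs_weighted_sub_le zero_le_one hC vb0 vb1 (hY 1) (hY 0)
  have t3 := abs_weighted_sub_le kb0 kb1 vb0 vb1 (hX 3) (hX 2)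
  have t4 := abs_weighted_sub_le kb0 kb1 vb0 vb1 (hY 3) (hY 2)
  rw [one_mul] at t1 t2
  have e1 : u ^ (-2 * β - 1) * u ^ 2 ≤ u ^ s := by
    rw [← Real.rpow_natCast, ← Real.rpow_add h0]
    exact rpow_le_rpow_of_mem hu (by push_cast; linarith [hE.s_le₁, hE.r_pos])
  have e2 : u ^ (1 / 2 : ℝ) * u ≤ u ^ s := by
    rw [← Real.rpow_add_one h0.ne']
    exact rpow_le_rpow_of_mem hu (by linarith [hE.s_le])
  have e3 : u ^ (-3 / 2 : ℝ) * u ^ 2 ≤ u ^ s := by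
    rw [← Real.rpow_natCast, ← Real.rpow_add h0]
    exact rpow_le_rpow_of_mem hu (by push_cast; linarith [hE.s_le])
  have e4 : u ^ (2 * β) * u ≤ u ^ s := by
    rw [← Real.rpow_add_one h0.ne']
    exact rpow_le_rpow_of_mem hu hE.s_le₂
  have hp : ∀ {x e K L : ℝ} (p : ℝ), |x| ≤ 2 * C * (K * L * (A * A)) → u ^ p * L ≤ e → 0 ≤ K →
      |u ^ p * x| ≤ 2 * C * K * (A * A) * e := by
    intro x e K L p hx he hK
    have hp0 : 0 ≤ u ^ p := Real.rpow_nonneg h0.le _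
    rw [abs_mul, abs_of_nonneg hp0]
    calc u ^ p * |x| ≤ u ^ p * (2 * C * (K * L * (A * A))) := mul_le_mul_of_nonneg_left hx hp0
      _ = 2 * C * K * (A * A) * (u ^ p * L) := by ring
      _ ≤ _ := mul_le_mul_of_nonneg_left he (by positivity)
  have g1 := hp _ t1 e1 (by positivity)
  have g2 := hp _ t2 e2 (by positivity)
  have g3 := hp _ t3 e3 (by positivity)
  have g4 := hp _ t4 e4 (by positivity)
  rw [abs_mul, abs_of_nonneg m0]
  have hsum := (abs_add_le _ _).trans (add_le_add ((abs_add_le _ _).trans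
    (add_le_add ((abs_add_le _ _).trans (add_le_add g1 g2)) g3)) g4)
  refine (mul_le_mul m1 hsum (abs_nonneg _) hC0).trans (le_of_eq ?_)
  ring

/-- The weight of the `k`-th column of samples: `u^r` for `k = 0, 1`, where the dilation factor may
be as small as `u`, and `1` for `k = 2, 3`. -/
noncomputable def colWeight (r u : ℝ) (k : Fin 4) : ℝ := if (k : ℕ) ≤ 1 then u ^ r else 1

/-- The diffusive part of the difference `core β u n - core β u n'`, where `w = n - n'`: differences
of `w` at neighbouring points with nonnegative coefficients. -/
noncomputable def diffusive (β u : ℝ) (n w : Fin 4 → Fin 4 → ℝ) : ℝ :=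
  let va := v 0 u ^ (2 * β + 3 / 2)
  let vb := v 0 u ^ (2 * β - 1 / 2)
  let ka := kap u ^ (2 * β + 3 / 2)
  let kb := kap u ^ (2 * β - 1 / 2)
  mu β u * (u ^ (-2 * β - 1) * (n 2 1 * n 3 1) * (w 0 1 - w 1 1)
    + u ^ (-2 * β - 1) * (va * vb) * (n 2 0 * n 3 0) * (w 1 0 - w 0 0)
    + u ^ (2 * β) * (ka * kb) * (n 0 3 * n 1 3) * (w 2 3 - w 3 3)
    + u ^ (2 * β) * (va * vb) * (n 0 2 * n 1 2) * (w 3 2 - w 2 2))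

/-- The part of the difference `core β u n - core β u n'` with the non-integrable weight `u^(-3/2)`,
which is controlled by a change of variables in `u`. -/
noncomputable def crossPart (β u : ℝ) (n w : Fin 4 → Fin 4 → ℝ) : ℝ :=
  let va := v 0 u ^ (2 * β + 3 / 2)
  let vb := v 0 u ^ (2 * β - 1 / 2)
  let kb := kap u ^ (2 * β - 1 / 2)
  mu β u * u ^ (-3 / 2 : ℝ) * (kb * (n 2 3 * n 3 3) * (w 0 3 - va * w 1 3)
    - vb * (n 2 2 * n 3 2) * (w 0 2 - va * w 1 2))

/-- The difference of two products `x y z`, of which `x` is a small bracket, once the leading term has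
been removed: `d` is the defect of the weight in the bracket and `c` the value of the bracket. The
variable `w0` only completes the sum. -/
lemma tri_diff_le {K A L a b c d a' b' w0 w1 w2 w3 : ℝ} (hK : 0 ≤ K) (hA : 0 ≤ A)
    (hb : |b| ≤ A) (ha' : |a'| ≤ A) (hc : |c| ≤ K * A * L) (hd : |d| ≤ K * L)
    (hbb : |b'| ≤ A) (hL : 0 ≤ L) (ha : |a| ≤ A)  :
    |d * w1 * (a * b) + c * (w2 * b' + a' * w3)| ≤
      K * A ^ 2 * L * (|w0| + |w1| + |w2| + |w3|) := by
  have h1 : |d * w1 * (a * b)| ≤ K * L * |w1| * (A * A) := by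
    rw [abs_mul, abs_mul d, abs_mul a]
    have := mul_le_mul ha hb (abs_nonneg _) hA
    exact mul_le_mul (mul_le_mul_of_nonneg_right hd (abs_nonneg _)) this (by positivity)
      (by positivity)
  have h2 : |c * (w2 * b' + a' * w3)| ≤ K * A * L * (|w2| * A + A * |w3|) := by
    rw [abs_mul]
    refine mul_le_mul hc ((abs_add_le _ _).trans ?_) (abs_nonneg _) (by positivity)
    rw [abs_mul, abs_mul]
    exact add_le_add (mul_le_mul_of_nonneg_left hbb (abs_nonneg _))
      (mul_le_mul_of_nonneg_right ha' (abs_nonneg _))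
  have h3 : 0 ≤ K * A ^ 2 * L * |w0| := by positivity
  have := (abs_add_le (d * w1 * (a * b)) (c * (w2 * b' + a' * w3))).trans (add_le_add h1 h2)
  nlinarith

/-- The difference of two collision integrands is a diffusive part, a cross part, and a remainder
dominated by the integrable kernel `u^s`. -/
lemma core_sub_remainder_le {β C r s A u : ℝ} (hW : WeightBound β C) (hE : Exponents β r s)
    (hA : 0 ≤ A) (hu : u ∈ Ioo (0 : ℝ) 1) {n n' : Fin 4 → Fin 4 → ℝ} (hn : SampleBound A u n)
    (hn' : SampleBound A u n') :
    |core β u n - core β u n' - diffusive β u n (n - n') - crossPart β u n (n - n')| ≤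
      8 * C ^ 3 * A ^ 2 * (u ^ s * ∑ k, ∑ i, colWeight r u k * |n i k - n' i k|) := by
  have hC := hW.one_le
  have hC0 : 0 ≤ C := by linarith
  obtain ⟨m0, m1, -⟩ := hW.mu u hu
  obtain ⟨va0, va1, -⟩ := hW.va u hu
  obtain ⟨vb0, vb1, -⟩ := hW.vb u hu
  obtain ⟨ka0, ka1, -⟩ := hW.ka u hu
  obtain ⟨kb0, kb1, -⟩ := hW.kb u hu
  have hva1 := hW.va_sub_one u hu
  have hkva := hW.ka_sub_va u hu
  have h0 := hu.1
  have h1 := hu.2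
  unfold core diffusive crossPart
  simp only [Pi.sub_apply]
  beta_reduce at va0 va1 vb0 vb1 ka0 ka1 kb0 kb1
  set va := v 0 u ^ (2 * β + 3 / 2)
  set vb := v 0 u ^ (2 * β - 1 / 2)
  set ka := kap u ^ (2 * β + 3 / 2)
  set kb := kap u ^ (2 * β - 1 / 2)
  set w : Fin 4 → Fin 4 → ℝ := fun i k => n i k - n' i k with hw
  let S : Fin 4 → ℝ := fun k => |w 0 k| + |w 1 k| + |w 2 k| + |w 3 k|
  have hS : ∀ k, 0 ≤ S k := fun k => by positivity
  have hsum : ∑ k, ∑ i, colWeight r u k * |n i k - n' i k|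
      = u ^ r * (S 0 + S 1) + (S 2 + S 3) := by
    have : ∀ k, ∑ i, colWeight r u k * |n i k - n' i k| = colWeight r u k * S k := by
      intro k
      rw [← Finset.mul_sum, Fin.sum_univ_four]
    simp only [this, Fin.sum_univ_four]
    simp [colWeight]
    ring
  have hva1' : |1 - va| ≤ 3 * C * u ^ 2 := by
    rw [abs_sub_comm]; nlinarith [sq_nonneg u]
  have hkva' : |ka - va| ≤ 2 * C * u := by nlinarith
  have hX : ∀ k, |n' 0 k - va * n' 1 k| ≤ 3 * C * A * u ^ 2 := fun k =>
    abs_sub_mul_le hC hA hva1 (hn'.sub01 k) (hn'.bound 1 k)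
  have hY : ∀ k, |ka * n' 2 k - va * n' 3 k| ≤ 2 * C * A * u := fun k =>
    abs_mul_sub_mul_le hC va0 va1 hkva (hn'.sub23 k) (hn'.bound 2 k) h0.le
  -- the four brackets of weight `u^(-2β-1)` and `u^(2β)`, after removal of the diffusive part
  have r11 : |(1 - va) * w 1 1 * (n 2 1 * n 3 1)
      + (n' 0 1 - va * n' 1 1) * (w 2 1 * n 3 1 + n' 2 1 * w 3 1)| ≤
        3 * C * A ^ 2 * u ^ 2 * S 1 :=
    tri_diff_le (by positivity) hA (hn.bound 3 1) (hn'.bound 2 1) (hX 1) hva1' (hn.bound 3 1)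
      (by positivity) (hn.bound 2 1)
  have r10 : |(1 - va) * w 0 0 * (n 2 0 * n 3 0)
      + (n' 0 0 - va * n' 1 0) * (w 2 0 * n 3 0 + n' 2 0 * w 3 0)| ≤
        3 * C * A ^ 2 * u ^ 2 * S 0 := by
    refine (tri_diff_le (by positivity) hA (hn.bound 3 0) (hn'.bound 2 0) (hX 0) hva1'
      (hn.bound 3 0) (by positivity) (hn.bound 2 0) (w0 := w 1 0)).trans (le_of_eq ?_)
    simp only [S]; ring
  have r43 : |(ka - va) * w 3 3 * (n 0 3 * n 1 3)
      + (ka * n' 2 3 - va * n' 3 3) * (w 0 3 * n 1 3 + n' 0 3 * w 1 3)| ≤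
        2 * C * A ^ 2 * u * S 3 := by
    refine (tri_diff_le (by positivity) hA (hn.bound 1 3) (hn'.bound 0 3) (hY 3) hkva'
      (hn.bound 1 3) (by positivity) (hn.bound 0 3) (w0 := w 2 3)).trans (le_of_eq ?_)
    simp only [S]; ring
  have r42 : |(ka - va) * w 2 2 * (n 0 2 * n 1 2)
      + (ka * n' 2 2 - va * n' 3 2) * (w 0 2 * n 1 2 + n' 0 2 * w 1 2)| ≤
        2 * C * A ^ 2 * u * S 2 := by
    refine (tri_diff_le (by positivity) hA (hn.bound 1 2) (hn'.bound 0 2) (hY 2) hkva'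
      (hn.bound 1 2) (by positivity) (hn.bound 0 2) (w0 := w 3 2)).trans (le_of_eq ?_)
    simp only [S]; ring
  -- the brackets of weight `u^(-3/2)`, after removal of the cross part
  have r3 : ∀ k, |(n' 0 k - va * n' 1 k) * (w 2 k * n 3 k + n' 2 k * w 3 k)| ≤
      3 * C * A ^ 2 * u ^ 2 * S k := by
    intro k
    have := tri_diff_le (a := 0) (b := 0) (d := 0) (w1 := w 1 k) (w0 := w 0 k) (w2 := w 2 k)
      (w3 := w 3 k) (K := 3 * C) (L := u ^ 2) (by positivity) hA (by simpa using hA)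
      (hn'.bound 2 k) (hX k) (by simpa using (by positivity)) (hn.bound 3 k) (by positivity)
      (by simpa using hA)
    simpa using this
  -- the brackets of weight `u^(1/2)`, where no cancellation is needed
  have r2 : ∀ k, |(ka * w 2 k - va * w 3 k) * (n 0 k * n 1 k)
      + (ka * n' 2 k - va * n' 3 k) * (w 0 k * n 1 k + n' 0 k * w 1 k)| ≤
        2 * C * A ^ 2 * S k := by
    intro k
    have h1 : |(ka * w 2 k - va * w 3 k) * (n 0 k * n 1 k)| ≤
        (C * |w 2 k| + C * |w 3 k|) * (A * A) := by
      refine abs_mul_three_le ((abs_sub _ _).trans ?_) (hn.bound 0 k) (hn.bound 1 k)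
        (by positivity) hA
      rw [abs_mul, abs_mul, abs_of_nonneg ka0, abs_of_nonneg va0]
      gcongr
    have h2 : |(ka * n' 2 k - va * n' 3 k) * (w 0 k * n 1 k + n' 0 k * w 1 k)| ≤
        2 * C * A * (|w 0 k| * A + A * |w 1 k|) := by
      rw [abs_mul]
      refine mul_le_mul ((hY k).trans ?_) ((abs_add_le _ _).trans ?_) (abs_nonneg _)
        (by positivity)
      · exact mul_le_of_le_one_right (by positivity) hu.2.le
      · rw [abs_mul, abs_mul]
        exact add_le_add (mul_le_mul_of_nonneg_left (hn.bound 1 k) (abs_nonneg _))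
          (mul_le_mul_of_nonneg_right (hn'.bound 0 k) (abs_nonneg _))
    have h3 : 0 ≤ C * A ^ 2 * (|w 2 k| + |w 3 k|) := by positivity
    refine (abs_add_le _ _).trans ((add_le_add h1 h2).trans ?_)
    simp only [S]
    nlinarith
  have e1 : u ^ (-2 * β - 1) * u ^ 2 ≤ u ^ s * u ^ r := by
    rw [← Real.rpow_natCast, ← Real.rpow_add h0, ← Real.rpow_add h0]
    exact rpow_le_rpow_of_mem hu (by push_cast; linarith [hE.s_le₁])
  have e2 : u ^ (1 / 2 : ℝ) ≤ u ^ s * u ^ r := by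
    rw [← Real.rpow_add h0]
    exact rpow_le_rpow_of_mem hu (by linarith [hE.s_le, hE.r_le])
  have e3 : u ^ (-3 / 2 : ℝ) * u ^ 2 ≤ u ^ s := by
    rw [← Real.rpow_natCast, ← Real.rpow_add h0]
    exact rpow_le_rpow_of_mem hu (by push_cast; linarith [hE.s_le])
  have e4 : u ^ (2 * β) * u ≤ u ^ s := by
    rw [← Real.rpow_add_one h0.ne']
    exact rpow_le_rpow_of_mem hu hE.s_le₂
  have hp : ∀ {b c x y e K L P Q : ℝ} (p : ℝ), 0 ≤ b → b ≤ C → 0 ≤ c → c ≤ C →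
      |x| ≤ K * L * P → |y| ≤ K * L * Q → u ^ p * L ≤ e → 0 ≤ K → 0 ≤ P → 0 ≤ Q → 0 ≤ L →
      |u ^ p * (b * x - c * y)| ≤ C * K * e * (P + Q) := by
    intro b c x y e K L P Q p hb0 hb hc0 hc hx hy he hK hP hQ hL
    have hp0 : 0 ≤ u ^ p := Real.rpow_nonneg h0.le _
    rw [abs_mul, abs_of_nonneg hp0]
    have : |b * x - c * y| ≤ C * (K * L * P) + C * (K * L * Q) := by
      refine (abs_sub _ _).trans ?_
      rw [abs_mul, abs_mul, abs_of_nonneg hb0, abs_of_nonneg hc0]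
      exact add_le_add (mul_le_mul hb hx (abs_nonneg _) hC0) (mul_le_mul hc hy (abs_nonneg _) hC0)
    calc u ^ p * |b * x - c * y| ≤ u ^ p * (C * (K * L * P) + C * (K * L * Q)) :=
          mul_le_mul_of_nonneg_left this hp0
      _ = C * K * (P + Q) * (u ^ p * L) := by ring
      _ ≤ C * K * (P + Q) * e := mul_le_mul_of_nonneg_left he (by positivity)
      _ = _ := by ring
  have g1 := hp _ zero_le_one hC vb0 vb1 r11 r10 e1 (by positivity) (hS 1) (hS 0) (by positivity)
  have g2 := hp (K := 2 * C * A ^ 2) (L := 1) (P := S 1) (Q := S 0) (e := u ^ s * u ^ r) (1 / 2)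
    zero_le_one hC vb0 vb1 (by rw [mul_one]; exact r2 1) (by rw [mul_one]; exact r2 0)
    (by rw [mul_one]; exact e2) (by positivity) (hS 1) (hS 0) zero_le_one
  have g3 := hp _ kb0 kb1 vb0 vb1 (r3 3) (r3 2) e3 (by positivity) (hS 3) (hS 2) (by positivity)
  have g4 := hp _ kb0 kb1 vb0 vb1 r43 r42 e4 (by positivity) (hS 3) (hS 2) (by positivity)
  have htot := (abs_add_le _ _).trans (add_le_add ((abs_add_le _ _).trans
    (add_le_add ((abs_add_le _ _).trans (add_le_add g1 g2)) g3)) g4)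
  have hfin := abs_mul_le_of_nonneg m0 m1 htot
  rw [hsum]
  have hz : 0 ≤ C ^ 3 * A ^ 2 * u ^ s * (u ^ r * (S 0 + S 1) + (S 2 + S 3)) := by
    have := hS 0; have := hS 1; have := hS 2; have := hS 3
    positivity
  refine le_trans (le_of_eq ?_) (hfin.trans ?_)
  · congr 1
    simp only [hw]
    ring
  · linarith [hz]

lemma abs_mul_three_sub_le {A q x y z x' y' z' : ℝ} (hA : 0 ≤ A) (hq : 0 ≤ q)
    (hy : |y| ≤ A) (hz : |z| ≤ A) (hx' : |x'| ≤ A) (hy' : |y'| ≤ A)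
    (hxx : |x - x'| ≤ q) (hyy : |y - y'| ≤ q) (hzz : |z - z'| ≤ q) :
    |x * (y * z) - x' * (y' * z')| ≤ 3 * A ^ 2 * q := by
  have e : x * (y * z) - x' * (y' * z') =
      (x - x') * (y * z) + x' * ((y - y') * z) + x' * (y' * (z - z')) := by ring
  rw [e]
  have h1 := abs_mul_three_le hxx hy hz hq hA
  have h2 : |x' * ((y - y') * z)| ≤ A * (q * A) := by
    rw [abs_mul, abs_mul]; gcongr
  have h3 : |x' * (y' * (z - z'))| ≤ A * (A * q) := by
    rw [abs_mul, abs_mul]; gcongr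
  have := abs_add_three ((x - x') * (y * z)) (x' * ((y - y') * z)) (x' * (y' * (z - z')))
  nlinarith

/-- A crude Lipschitz bound for the collision integrand, without use of cancellations. -/
lemma abs_core_sub_le {β C r s A q u : ℝ} (hW : WeightBound β C) (hE : Exponents β r s)
    (hA : 0 ≤ A) (hq : 0 ≤ q) (hu : u ∈ Ioo (0 : ℝ) 1) {n n' : Fin 4 → Fin 4 → ℝ}
    (hn : ∀ i k, |n i k| ≤ A) (hn' : ∀ i k, |n' i k| ≤ A) (hnn : ∀ i k, |n i k - n' i k| ≤ q) :
    |core β u n - core β u n'| ≤ 48 * C ^ 3 * A ^ 2 * q * u ^ (-3 : ℝ) := by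
  have hC := hW.one_le
  have hC0 : 0 ≤ C := by linarith
  obtain ⟨m0, m1, -⟩ := hW.mu u hu
  obtain ⟨va0, va1, -⟩ := hW.va u hu
  obtain ⟨vb0, vb1, -⟩ := hW.vb u hu
  obtain ⟨ka0, ka1, -⟩ := hW.ka u hu
  obtain ⟨kb0, kb1, -⟩ := hW.kb u hu
  have h0 := hu.1
  unfold core
  beta_reduce at va0 va1 vb0 vb1 ka0 ka1 kb0 kb1
  set va := v 0 u ^ (2 * β + 3 / 2)
  set vb := v 0 u ^ (2 * β - 1 / 2)
  set ka := kap u ^ (2 * β + 3 / 2)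
  set kb := kap u ^ (2 * β - 1 / 2)
  have htri : ∀ i j l k, |n i k * (n j k * n l k) - n' i k * (n' j k * n' l k)| ≤ 3 * A ^ 2 * q :=
    fun i j l k => abs_mul_three_sub_le hA hq (hn j k) (hn l k) (hn' i k) (hn' j k)
      (hnn i k) (hnn j k) (hnn l k)
  have hX : ∀ k, |(n 0 k - va * n 1 k) * (n 2 k * n 3 k)
      - (n' 0 k - va * n' 1 k) * (n' 2 k * n' 3 k)| ≤ 2 * C * (3 * A ^ 2 * q) := by
    intro k
    refine le_trans (le_of_eq ?_)
      (abs_weighted_sub_le zero_le_one hC va0 va1 (htri 0 2 3 k) (htri 1 2 3 k))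
    congr 1; ring
  have hY : ∀ k, |(ka * n 2 k - va * n 3 k) * (n 0 k * n 1 k)
      - (ka * n' 2 k - va * n' 3 k) * (n' 0 k * n' 1 k)| ≤ 2 * C * (3 * A ^ 2 * q) := by
    intro k
    refine le_trans (le_of_eq ?_)
      (abs_weighted_sub_le ka0 ka1 va0 va1 (htri 2 0 1 k) (htri 3 0 1 k))
    congr 1; ring
  have t1 := abs_weighted_sub_le zero_le_one hC vb0 vb1 (hX 1) (hX 0)
  have t2 := abs_weighted_sub_le zero_le_one hC vb0 vb1 (hY 1) (hY 0)
  have t3 := abs_weighted_sub_le kb0 kb1 vb0 vb1 (hX 3) (hX 2)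
  have t4 := abs_weighted_sub_le kb0 kb1 vb0 vb1 (hY 3) (hY 2)
  have hp : ∀ {x K : ℝ} (p : ℝ), -3 ≤ p → |x| ≤ K → |u ^ p * x| ≤ u ^ (-3 : ℝ) * K := by
    intro x K p hp hx
    rw [abs_mul, abs_of_nonneg (Real.rpow_nonneg h0.le _)]
    exact mul_le_mul (rpow_le_rpow_of_mem hu hp) hx (abs_nonneg _) (Real.rpow_nonneg h0.le _)
  have g1 := hp (-2 * β - 1) (by linarith [hE.s_le₁, hE.s_gt, hE.r_pos]) t1
  have g2 := hp (1 / 2) (by norm_num) t2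
  have g3 := hp (-3 / 2) (by norm_num) t3
  have g4 := hp (2 * β) (by linarith [hE.s_le₂, hE.s_gt]) t4
  have htot := (abs_add_le _ _).trans (add_le_add ((abs_add_le _ _).trans
    (add_le_add ((abs_add_le _ _).trans (add_le_add g1 g2)) g3)) g4)
  have hfin := abs_mul_le_of_nonneg m0 m1 htot
  refine le_trans (le_of_eq ?_) (hfin.trans (le_of_eq ?_))
  · congr 1
    ring
  · ring

/-! ### The regularized collision operator -/

/-- A cutoff in `u` that removes the singularity at `u = 0` of every weight; there is no cutoff for
`ε = 0`. -/
noncomputable def reg (ε u : ℝ) : ℝ := (u / (u + ε)) ^ 3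

/-- The collision operator with the integrand multiplied by the cutoff `reg ε`. -/
noncomputable def collisionReg (β ε : ℝ) (N : ℝ → ℝ) (ω : ℝ) : ℝ :=
  ∫ u in Ioo (0 : ℝ) 1, reg ε u * collisionIntegrand β N ω u

lemma reg_nonneg {ε u : ℝ} (hε : 0 ≤ ε) (hu : 0 < u) : 0 ≤ reg ε u := by
  unfold reg; positivity

lemma reg_le_one {ε u : ℝ} (hε : 0 ≤ ε) (hu : 0 < u) : reg ε u ≤ 1 := by
  unfold reg
  exact pow_le_one₀ (by positivity) (by rw [div_le_one (by positivity)]; linarith)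

lemma reg_mul_rpow_le {ε u : ℝ} (hε : 0 < ε) (hu : 0 < u) :
    reg ε u * u ^ (-3 : ℝ) ≤ (ε ^ 3)⁻¹ := by
  have e : u ^ (-3 : ℝ) = (u ^ 3)⁻¹ := by
    rw [Real.rpow_neg hu.le]; norm_cast
  rw [e, reg, div_pow, show u ^ 3 / (u + ε) ^ 3 * (u ^ 3)⁻¹ = ((u + ε) ^ 3)⁻¹ by field_simp]
  gcongr
  linarith

lemma reg_sub_le {ε u w : ℝ} (hε : 0 ≤ ε) (hu : 0 < u) (hw : 0 < w) :
    |reg ε u - reg ε w| ≤ 3 * (|u - w| / u) := by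
  unfold reg
  set x := u / (u + ε) with hx
  set y := w / (w + ε) with hy
  have hx0 : 0 ≤ x := by positivity
  have hy0 : 0 ≤ y := by positivity
  have hx1 : x ≤ 1 := by rw [hx, div_le_one (by positivity)]; linarith
  have hy1 : y ≤ 1 := by rw [hy, div_le_one (by positivity)]; linarith
  have e : x ^ 3 - y ^ 3 = (x - y) * (x ^ 2 + x * y + y ^ 2) := by ring
  have h1 : |x ^ 2 + x * y + y ^ 2| ≤ 3 := by
    rw [abs_of_nonneg (by positivity)]; nlinarith
  have h2 : |x - y| ≤ |u - w| / u := by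
    have : x - y = (u - w) / (u + ε) * (ε / (w + ε)) := by
      rw [hx, hy]; field_simp; ring
    rw [this, abs_mul, abs_div, abs_of_pos (a := u + ε) (by positivity),
      abs_of_nonneg (a := ε / (w + ε)) (by positivity)]
    have h3 : ε / (w + ε) ≤ 1 := by rw [div_le_one (by positivity)]; linarith
    have h4 : |u - w| / (u + ε) ≤ |u - w| / u := by gcongr; linarith
    calc _ ≤ |u - w| / u * 1 := mul_le_mul h4 h3 (by positivity) (by positivity)
      _ = _ := mul_one _
  rw [e, abs_mul]
  have := mul_le_mul h2 h1 (abs_nonneg _) (by positivity)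
  linarith

lemma reg_zero {u : ℝ} (hu : 0 < u) : reg 0 u = 1 := by
  unfold reg; rw [add_zero, div_self hu.ne', one_pow]

lemma continuousOn_reg {ε : ℝ} (hε : 0 ≤ ε) : ContinuousOn (reg ε) (Ioo 0 1) := by
  unfold reg
  refine ContinuousOn.pow (ContinuousOn.div continuousOn_id (by fun_prop) fun u hu => ?_) 3
  have := hu.1
  positivity

lemma collisionReg_zero (β : ℝ) (N : ℝ → ℝ) (ω : ℝ) :
    collisionReg β 0 N ω = collision β N ω := by
  refine setIntegral_congr_fun measurableSet_Ioo fun u hu => ?_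
  simp only [reg_zero hu.1, one_mul]

/-- The collision operator commutes with dilations. -/
lemma collisionReg_dilate (β ε : ℝ) (N : ℝ → ℝ) (a ω : ℝ) :
    collisionReg β ε (fun x => N (x * a)) ω = collisionReg β ε N (ω * a) := by
  have h : ∀ u i k, ω * v i u / v k u * a = ω * a * v i u / v k u := fun u i k => by ring
  simp only [collisionReg, collisionIntegrand, h]

lemma continuousOn_kap : ContinuousOn kap (Ioo 0 1) := by
  unfold kap
  refine ContinuousOn.div continuousOn_const (by fun_prop) fun u hu => ?_
  have := hu.1
  positivity

lemma continuousOn_v (i : Fin 4) : ContinuousOn (v i) (Ioo 0 1) := by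
  have h0 : ContinuousOn (v 0) (Ioo 0 1) := by
    rw [show v 0 = fun u => (1 + u) * kap u from funext v_zero]
    exact ContinuousOn.mul (by fun_prop) continuousOn_kap
  fin_cases i
  · exact h0
  · change ContinuousOn (v 1) _
    rw [show v 1 = fun u => 1 from funext v_one]
    fun_prop
  · change ContinuousOn (v 2) _
    rw [show v 2 = fun u => u * v 0 u from funext v_two]
    exact ContinuousOn.mul (by fun_prop) h0
  · change ContinuousOn (v 3) _
    rw [show v 3 = fun u => u * kap u from funext v_three]
    exact ContinuousOn.mul (by fun_prop) continuousOn_kap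

lemma continuousOn_rpow_v_zero (e : ℝ) : ContinuousOn (fun u => v 0 u ^ e) (Ioo 0 1) :=
  (continuousOn_v 0).rpow_const fun _ hu => Or.inl (v_zero_pos hu).ne'

lemma continuousOn_rpow_kap (e : ℝ) : ContinuousOn (fun u => kap u ^ e) (Ioo 0 1) :=
  continuousOn_kap.rpow_const fun _ hu => Or.inl (kap_pos hu).ne'

lemma continuousOn_rpow_Ioo (e : ℝ) : ContinuousOn (fun u : ℝ => u ^ e) (Ioo 0 1) :=
  continuousOn_id.rpow_const fun _ hu => Or.inl hu.1.ne'

lemma continuousOn_mu (β : ℝ) : ContinuousOn (mu β) (Ioo 0 1) :=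
  (continuousOn_rpow_v_zero _).mul (continuousOn_rpow_kap _)

section Continuity

variable {X : Type*} [TopologicalSpace X] {S : Set X} {f : X → ℝ} {n w : X → Fin 4 → Fin 4 → ℝ}

/-- All weights that occur in `core` are continuous. -/
lemma continuousOn_weights (β : ℝ) (hf : ContinuousOn f S) (hS : MapsTo f S (Ioo 0 1)) :
    ContinuousOn (fun z => mu β (f z)) S ∧
    ContinuousOn (fun z => v 0 (f z) ^ (2 * β + 3 / 2)) S ∧
    ContinuousOn (fun z => v 0 (f z) ^ (2 * β - 1 / 2)) S ∧
    ContinuousOn (fun z => kap (f z) ^ (2 * β + 3 / 2)) S ∧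
    ContinuousOn (fun z => kap (f z) ^ (2 * β - 1 / 2)) S ∧
    ContinuousOn (fun z => f z ^ (-2 * β - 1)) S ∧
    ContinuousOn (fun z => f z ^ (1 / 2 : ℝ)) S ∧
    ContinuousOn (fun z => f z ^ (-3 / 2 : ℝ)) S ∧
    ContinuousOn (fun z => f z ^ (2 * β)) S :=
  ⟨(continuousOn_mu β).comp hf hS, (continuousOn_rpow_v_zero _).comp hf hS,
    (continuousOn_rpow_v_zero _).comp hf hS, (continuousOn_rpow_kap _).comp hf hS,
    (continuousOn_rpow_kap _).comp hf hS, (continuousOn_rpow_Ioo _).comp hf hS,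
    (continuousOn_rpow_Ioo _).comp hf hS, (continuousOn_rpow_Ioo _).comp hf hS,
    (continuousOn_rpow_Ioo _).comp hf hS⟩

lemma continuousOn_core (β : ℝ) (hf : ContinuousOn f S) (hS : MapsTo f S (Ioo 0 1))
    (hn : ∀ i k, ContinuousOn (fun z => n z i k) S) :
    ContinuousOn (fun z => core β (f z) (n z)) S := by
  obtain ⟨hm, hva, hvb, hka, hkb, h1, h2, h3, h4⟩ := continuousOn_weights β hf hS
  exact hm.mul ((((h1.mul ((((hn 0 1).sub (hva.mul (hn 1 1))).mul ((hn 2 1).mul (hn 3 1))).sub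
    (hvb.mul (((hn 0 0).sub (hva.mul (hn 1 0))).mul ((hn 2 0).mul (hn 3 0)))))).add
    (h2.mul ((((hka.mul (hn 2 1)).sub (hva.mul (hn 3 1))).mul ((hn 0 1).mul (hn 1 1))).sub
    (hvb.mul (((hka.mul (hn 2 0)).sub (hva.mul (hn 3 0))).mul ((hn 0 0).mul (hn 1 0))))))).add
    (h3.mul ((hkb.mul (((hn 0 3).sub (hva.mul (hn 1 3))).mul ((hn 2 3).mul (hn 3 3)))).sub
    (hvb.mul (((hn 0 2).sub (hva.mul (hn 1 2))).mul ((hn 2 2).mul (hn 3 2))))))).add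
    (h4.mul ((hkb.mul (((hka.mul (hn 2 3)).sub (hva.mul (hn 3 3))).mul ((hn 0 3).mul (hn 1 3)))).sub
    (hvb.mul (((hka.mul (hn 2 2)).sub (hva.mul (hn 3 2))).mul ((hn 0 2).mul (hn 1 2)))))))

/-- The values `N_{i,k}` depend continuously on parameters, also when `N` itself does. -/
lemma continuousOn_sample_param {N : X → ℝ → ℝ} {g : X → ℝ}
    (hN : ContinuousOn (fun p : X × ℝ => N p.1 p.2) (S ×ˢ Ioi 0))
    (hf : ContinuousOn f S) (hS : MapsTo f S (Ioo 0 1))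
    (hg : ContinuousOn g S) (hgS : MapsTo g S (Ioi 0)) (i k : Fin 4) :
    ContinuousOn (fun z => sample (N z) (g z) (f z) i k) S := by
  have h1 := (continuousOn_v i).comp hf hS
  have h2 := (continuousOn_v k).comp hf hS
  have h3 : ContinuousOn (fun z => (z, g z * v i (f z) / v k (f z))) S :=
    continuousOn_id.prodMk ((hg.mul h1).div h2 fun z hz => (v_pos (hS hz) k).ne')
  exact hN.comp h3 fun z hz => ⟨hz, mul_ratio_pos (hgS hz) (hS hz) i k⟩

lemma continuousOn_sample {N : ℝ → ℝ} {g : X → ℝ} (hN : ContinuousOn N (Ioi 0))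
    (hf : ContinuousOn f S) (hS : MapsTo f S (Ioo 0 1))
    (hg : ContinuousOn g S) (hgS : MapsTo g S (Ioi 0)) (i k : Fin 4) :
    ContinuousOn (fun z => sample N (g z) (f z) i k) S :=
  continuousOn_sample_param (N := fun _ => N)
    (hN.comp continuous_snd.continuousOn fun _ hz => hz.2) hf hS hg hgS i k

end Continuity

lemma continuousOn_sample_u {N : ℝ → ℝ} (hN : ContinuousOn N (Ioi 0)) {ω : ℝ} (hω : 0 < ω)
    (i k : Fin 4) : ContinuousOn (fun u => sample N ω u i k) (Ioo 0 1) :=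
  continuousOn_sample (f := id) (g := fun _ => ω) hN continuousOn_id (fun _ h => h)
    continuousOn_const (fun _ _ => hω) i k

lemma continuousOn_collisionIntegrand (β : ℝ) {N : ℝ → ℝ} (hN : ContinuousOn N (Ioi 0)) {ω : ℝ}
    (hω : 0 < ω) : ContinuousOn (collisionIntegrand β N ω) (Ioo 0 1) :=
  (continuousOn_core (f := id) β continuousOn_id (fun _ h => h)
    (continuousOn_sample_u hN hω)).congr fun _ hu => collisionIntegrand_eq_core β N ω hu

lemma integrableOn_rpow {s : ℝ} (hs : -1 < s) :
    IntegrableOn (fun u : ℝ => u ^ s) (Ioo 0 1) :=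
  (intervalIntegral.integrableOn_Ioo_rpow_iff one_pos).2 hs

lemma integrableOn_of_bound {f g : ℝ → ℝ} (hf : ContinuousOn f (Ioo 0 1))
    (hg : IntegrableOn g (Ioo 0 1)) (h : ∀ u ∈ Ioo (0 : ℝ) 1, |f u| ≤ g u) :
    IntegrableOn f (Ioo 0 1) :=
  Integrable.mono' hg (hf.aestronglyMeasurable measurableSet_Ioo)
    ((ae_restrict_iff' measurableSet_Ioo).2 (Filter.Eventually.of_forall h))

lemma abs_setIntegral_le {f g : ℝ → ℝ} (hg : IntegrableOn g (Ioo 0 1))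
    (h : ∀ u ∈ Ioo (0 : ℝ) 1, |f u| ≤ g u) :
    |∫ u in Ioo (0 : ℝ) 1, f u| ≤ ∫ u in Ioo (0 : ℝ) 1, g u := by
  rw [← Real.norm_eq_abs]
  exact norm_integral_le_of_norm_le hg
    ((ae_restrict_iff' measurableSet_Ioo).2 (Filter.Eventually.of_forall h))

lemma abs_collisionIntegrand_le {β C r s A : ℝ} (hW : WeightBound β C) (hE : Exponents β r s)
    {N : ℝ → ℝ} (hN : GoodFn A N) {ω u : ℝ} (hω : 0 < ω) (hu : u ∈ Ioo (0 : ℝ) 1) :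
    |collisionIntegrand β N ω u| ≤ 20 * C ^ 3 * A ^ 3 * u ^ s := by
  rw [collisionIntegrand_eq_core β N ω hu]
  exact abs_core_le hW hE hN.nonneg hu (hN.sampleBound hω hu)

lemma integrableOn_reg_mul {β C r s A ε : ℝ} (hW : WeightBound β C) (hE : Exponents β r s)
    {N : ℝ → ℝ} (hN : GoodFn A N) {ω : ℝ} (hω : 0 < ω) (hε : 0 ≤ ε) :
    IntegrableOn (fun u => reg ε u * collisionIntegrand β N ω u) (Ioo 0 1) := by
  refine integrableOn_of_bound ((continuousOn_reg hε).mul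
    (continuousOn_collisionIntegrand β hN.continuousOn hω))
    ((integrableOn_rpow hE.s_gt).const_mul (20 * C ^ 3 * A ^ 3)) fun u hu => ?_
  rw [abs_mul, abs_of_nonneg (reg_nonneg hε hu.1)]
  refine (mul_le_of_le_one_left (abs_nonneg _) (reg_le_one hε hu.1)).trans ?_
  exact abs_collisionIntegrand_le hW hE hN hω hu

/-- The mass of the kernel `u^s`. -/
noncomputable def massS (s : ℝ) : ℝ := ∫ u in Ioo (0 : ℝ) 1, u ^ s

lemma massS_nonneg (s : ℝ) : 0 ≤ massS s :=
  setIntegral_nonneg measurableSet_Ioo fun _ hu => Real.rpow_nonneg hu.1.le _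

lemma abs_collisionReg_le {β C r s A ε : ℝ} (hW : WeightBound β C) (hE : Exponents β r s)
    {N : ℝ → ℝ} (hN : GoodFn A N) {ω : ℝ} (hω : 0 < ω) (hε : 0 ≤ ε) :
    |collisionReg β ε N ω| ≤ 20 * C ^ 3 * A ^ 3 * massS s := by
  rw [massS, ← integral_const_mul]
  refine abs_setIntegral_le ((integrableOn_rpow hE.s_gt).const_mul _) fun u hu => ?_
  rw [abs_mul, abs_of_nonneg (reg_nonneg hε hu.1)]
  exact (mul_le_of_le_one_left (abs_nonneg _) (reg_le_one hε hu.1)).trans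
    (abs_collisionIntegrand_le hW hE hN hω hu)

/-- The mass of the kernel `u^s` removed by the cutoff. -/
noncomputable def cutMass (s ε : ℝ) : ℝ := ∫ u in Ioo (0 : ℝ) 1, (1 - reg ε u) * u ^ s

lemma abs_one_sub_reg_mul_le {ε u : ℝ} (s : ℝ) (hε : 0 ≤ ε) (hu : 0 < u) :
    |(1 - reg ε u) * u ^ s| ≤ u ^ s := by
  have h := Real.rpow_nonneg hu.le s
  rw [abs_mul, abs_of_nonneg h, abs_of_nonneg (by linarith [reg_le_one hε hu])]
  exact mul_le_of_le_one_left h (by linarith [reg_nonneg hε hu])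

lemma integrableOn_cut {s ε : ℝ} (hs : -1 < s) (hε : 0 ≤ ε) :
    IntegrableOn (fun u => (1 - reg ε u) * u ^ s) (Ioo 0 1) :=
  integrableOn_of_bound ((continuousOn_const.sub (continuousOn_reg hε)).mul
    (continuousOn_rpow_Ioo s)) (integrableOn_rpow hs) fun _ hu =>
    abs_one_sub_reg_mul_le s hε hu.1

lemma abs_collision_sub_collisionReg_le {β C r s A ε : ℝ} (hW : WeightBound β C)
    (hE : Exponents β r s) {N : ℝ → ℝ} (hN : GoodFn A N) {ω : ℝ} (hω : 0 < ω) (hε : 0 ≤ ε) :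
    |collision β N ω - collisionReg β ε N ω| ≤ 20 * C ^ 3 * A ^ 3 * cutMass s ε := by
  rw [← collisionReg_zero, collisionReg, collisionReg,
    ← integral_sub (integrableOn_reg_mul hW hE hN hω le_rfl) (integrableOn_reg_mul hW hE hN hω hε),
    cutMass, ← integral_const_mul]
  refine abs_setIntegral_le ((integrableOn_cut hE.s_gt hε).const_mul _) fun u hu => ?_
  rw [reg_zero hu.1, ← sub_mul, abs_mul, abs_of_nonneg (by linarith [reg_le_one hε hu.1])]
  have := mul_le_mul_of_nonneg_left (abs_collisionIntegrand_le hW hE hN hω hu)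
    (show 0 ≤ 1 - reg ε u by linarith [reg_le_one hε hu.1])
  linarith

lemma cutMass_nonneg {s ε : ℝ} (hε : 0 ≤ ε) : 0 ≤ cutMass s ε :=
  setIntegral_nonneg measurableSet_Ioo fun u hu =>
    mul_nonneg (by linarith [reg_le_one hε hu.1]) (Real.rpow_nonneg hu.1.le _)

lemma tendsto_cutMass {s : ℝ} (hs : -1 < s) :
    Filter.Tendsto (cutMass s) (nhdsWithin 0 (Ioi 0)) (nhds 0) := by
  suffices Filter.Tendsto (cutMass s) (nhdsWithin 0 (Ioi 0))
      (nhds (∫ u in Ioo (0 : ℝ) 1, (0 : ℝ))) by simpa using this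
  refine tendsto_integral_filter_of_dominated_convergence (fun u => u ^ s) ?_ ?_
    (integrableOn_rpow hs) ?_
  · filter_upwards [self_mem_nhdsWithin] with ε hε
    exact (integrableOn_cut hs (le_of_lt hε)).aestronglyMeasurable
  · filter_upwards [self_mem_nhdsWithin] with ε hε
    exact (ae_restrict_iff' measurableSet_Ioo).2
      (Filter.Eventually.of_forall fun u hu => abs_one_sub_reg_mul_le s (le_of_lt hε) hu.1)
  · refine (ae_restrict_iff' measurableSet_Ioo).2 (Filter.Eventually.of_forall fun u hu => ?_)
    have hc : ContinuousAt (fun ε => (1 - reg ε u) * u ^ s) 0 := by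
      have h1 := hu.1
      have h2 : ContinuousAt (fun ε : ℝ => u / (u + ε)) 0 := by
        refine ContinuousAt.div continuousAt_const (by fun_prop) ?_
        simpa using h1.ne'
      unfold reg
      fun_prop
    have := hc.tendsto
    rw [reg_zero hu.1, sub_self, zero_mul] at this
    exact this.mono_left nhdsWithin_le_nhds

/-- For fixed `ε > 0` the regularized operator is Lipschitz in the supremum norm. -/
lemma abs_collisionReg_sub_le {β C r s A q ε : ℝ} (hW : WeightBound β C) (hE : Exponents β r s)
    {N M : ℝ → ℝ} (hN : GoodFn A N) (hM : GoodFn A M) (hε : 0 < ε)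
    (hq : ∀ x : ℝ, 0 < x → |N x - M x| ≤ q) {ω : ℝ} (hω : 0 < ω) :
    |collisionReg β ε N ω - collisionReg β ε M ω| ≤ 48 * C ^ 3 * A ^ 2 * (ε ^ 3)⁻¹ * q := by
  have hq0 : 0 ≤ q := (abs_nonneg _).trans (hq 1 one_pos)
  have hC := hW.one_le
  rw [collisionReg, collisionReg, ← integral_sub (integrableOn_reg_mul hW hE hN hω hε.le)
    (integrableOn_reg_mul hW hE hM hω hε.le)]
  refine (abs_setIntegral_le (g := fun _ => 48 * C ^ 3 * A ^ 2 * (ε ^ 3)⁻¹ * q)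
    (integrableOn_const (by simp)) fun u hu => ?_).trans (by simp)
  rw [← mul_sub, abs_mul, abs_of_nonneg (reg_nonneg hε.le hu.1),
    collisionIntegrand_eq_core β N ω hu, collisionIntegrand_eq_core β M ω hu]
  have h1 := abs_core_sub_le hW hE hN.nonneg hq0 hu (hN.sampleBound hω hu).bound
    (hM.sampleBound hω hu).bound fun i k => hq _ (mul_ratio_pos hω hu i k)
  have h2 := mul_le_mul_of_nonneg_left h1 (reg_nonneg hε.le hu.1)
  have h3 := mul_le_mul_of_nonneg_left (reg_mul_rpow_le hε hu.1)
    (show 0 ≤ 48 * C ^ 3 * A ^ 2 * q by positivity)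
  linarith

/-! ### The cross terms: a change of variables -/

/-- `φ` is an injective `C¹` map of `(0, 1)` into itself that agrees with the identity to third
order at `0`. -/
structure NearId (φ φ' : ℝ → ℝ) : Prop where
  mapsTo : MapsTo φ (Ioo 0 1) (Ioo 0 1)
  cont : ContinuousOn φ (Icc 0 1)
  zero : φ 0 = 0
  one : 1 / 2 ≤ φ 1
  inj : InjOn φ (Ioo 0 1)
  deriv : ∀ u ∈ Ioo (0 : ℝ) 1, HasDerivAt φ (φ' u) u
  deriv_nonneg : ∀ u ∈ Ioo (0 : ℝ) 1, 0 ≤ φ' u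
  lower : ∀ u ∈ Ioo (0 : ℝ) 1, u / 3 ≤ φ u
  upper : ∀ u ∈ Ioo (0 : ℝ) 1, φ u ≤ u
  sub_le : ∀ u ∈ Ioo (0 : ℝ) 1, u - φ u ≤ u ^ 3
  deriv_sub_le : ∀ u ∈ Ioo (0 : ℝ) 1, |φ' u - 1| ≤ 6 * u ^ 2

/-- The substitution `φ = v₃` with `N_{2,3}(u) = N_{1,3}(φ u)`. -/
lemma nearId_v_two :
    NearId (v 2) (fun u => (1 + 2 * u) * kap u ^ 2) where
  mapsTo u hu := by
    have h0 := hu.1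
    have hv := v_zero_mem hu
    rw [v_two]
    exact ⟨mul_pos h0 (v_zero_pos hu), by nlinarith [hu.2, hv.2]⟩
  cont := by
    have : v 2 = fun u : ℝ => u * (1 + u) / (1 + u + u ^ 2) := by ext u; simp [v]
    rw [this]
    refine ContinuousOn.div (by fun_prop) (by fun_prop) fun u hu => ?_
    have := hu.1
    positivity
  zero := by simp [v]
  one := by simp [v]; norm_num
  inj := by
    intro u hu w hw h
    have h0 := hu.1
    have h1 := hw.1
    simp only [v, Fin.isValue, Matrix.cons_val] at h
    rw [div_eq_div_iff (by positivity) (by positivity)] at h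
    have h2 : (u - w) * (1 + u + w) = 0 := by linear_combination h
    rcases mul_eq_zero.1 h2 with h | h
    · linarith
    · linarith
  deriv u hu := by
    have h0 := hu.1
    have e : v 2 = fun u : ℝ => (u + u ^ 2) / (1 + u + u ^ 2) := by
      ext u; simp [v]; ring
    rw [e]
    have h1 : HasDerivAt (fun u : ℝ => u + u ^ 2) (1 + 2 * u) u := by
      simpa using (hasDerivAt_id' u).fun_add (hasDerivAt_pow 2 u)
    have h2 : HasDerivAt (fun u : ℝ => 1 + u + u ^ 2) (1 + 2 * u) u := by
      simpa using ((hasDerivAt_id' u).const_add 1).fun_add (hasDerivAt_pow 2 u)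
    refine (h1.fun_div h2 (by positivity)).congr_deriv ?_
    unfold kap
    field_simp
    ring
  deriv_nonneg u hu := by have := hu.1; positivity
  lower u hu := by
    rw [v_two]; nlinarith [hu.1, (v_zero_mem hu).1]
  upper u hu := by
    rw [v_two]; nlinarith [hu.1, (v_zero_mem hu).2]
  sub_le u hu := by
    have h0 := hu.1
    have e : u - v 2 u = u ^ 3 * kap u := by
      rw [v_two]; linear_combination u * one_sub_v_zero hu
    rw [e]
    exact mul_le_of_le_one_right (by positivity) (kap_mem hu).2
  deriv_sub_le u hu := by
    have h0 := hu.1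
    have hk := kap_mul hu
    have hk1 := kap_mem hu
    have e : (1 + 2 * u) * kap u ^ 2 - 1 = -(u ^ 2 * ((3 + 2 * u + u ^ 2) * kap u ^ 2)) := by
      linear_combination (kap u * (1 + u + u ^ 2) + 1) * hk
    rw [e, abs_neg, abs_of_nonneg (by positivity)]
    have h2 : kap u ^ 2 ≤ 1 := by nlinarith [hk1.1, hk1.2]
    have h3 : (3 + 2 * u + u ^ 2) * kap u ^ 2 ≤ 6 * 1 :=
      mul_le_mul (by nlinarith [hu.2]) h2 (by positivity) (by norm_num)
    nlinarith [sq_nonneg u]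

/-- The substitution `φ(u) = u / (1 + u²)` with `N_{2,4}(u) = N_{1,4}(φ u)`. -/
lemma nearId_div :
    NearId (fun u => u / (1 + u ^ 2)) (fun u => (1 - u ^ 2) / (1 + u ^ 2) ^ 2) where
  mapsTo u hu := by
    have h0 := hu.1
    refine ⟨by positivity, ?_⟩
    rw [div_lt_one (by positivity)]
    nlinarith [hu.2]
  cont := ContinuousOn.div (by fun_prop) (by fun_prop) fun u _ => by positivity
  zero := by simp
  one := by norm_num
  inj := by
    intro u hu w hw h
    have h : u / (1 + u ^ 2) = w / (1 + w ^ 2) := h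
    rw [div_eq_div_iff (by positivity) (by positivity)] at h
    have h2 : (u - w) * (1 - u * w) = 0 := by linear_combination h
    rcases mul_eq_zero.1 h2 with h | h
    · linarith
    · nlinarith [hu.1, hu.2, hw.1, hw.2]
  deriv u hu := by
    have h2 : HasDerivAt (fun u : ℝ => 1 + u ^ 2) (2 * u) u := by
      simpa using (hasDerivAt_pow 2 u).const_add 1
    refine ((hasDerivAt_id' u).fun_div h2 (by positivity)).congr_deriv ?_
    ring
  deriv_nonneg u hu := by
    have : 0 ≤ 1 - u ^ 2 := by nlinarith [hu.1, hu.2]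
    positivity
  lower u hu := by
    have h0 := hu.1
    rw [div_le_div_iff₀ (by norm_num) (by positivity)]
    nlinarith [hu.2, mul_nonneg h0.le (sub_nonneg.2 hu.2.le),
      mul_nonneg (mul_nonneg h0.le h0.le) (sub_nonneg.2 hu.2.le)]
  upper u hu := by
    have h0 := hu.1
    rw [div_le_iff₀ (by positivity)]
    nlinarith [mul_pos h0 (mul_pos h0 h0)]
  sub_le u hu := by
    have h0 := hu.1
    have e : u - u / (1 + u ^ 2) = u ^ 3 / (1 + u ^ 2) := by field_simp; ring
    rw [e]
    exact div_le_self (by positivity) (by nlinarith)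
  deriv_sub_le u hu := by
    have h0 := hu.1
    have e : (1 - u ^ 2) / (1 + u ^ 2) ^ 2 - 1 = -(u ^ 2 * ((3 + u ^ 2) / (1 + u ^ 2) ^ 2)) := by
      field_simp; ring
    rw [e, abs_neg, abs_of_nonneg (by positivity)]
    have h3 : (3 + u ^ 2) / (1 + u ^ 2) ^ 2 ≤ 6 := by
      rw [div_le_iff₀ (by positivity)]
      nlinarith [sq_nonneg (u ^ 2), sq_nonneg u]
    nlinarith [sq_nonneg u]

/-- Two nearly equal weights: the substitution `φ` changes `reg ε · u^(-3/2) θ` by `O(u^(1/2))`. -/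
lemma NearId.weight_sub_le {φ φ' θ α : ℝ → ℝ} (h : NearId φ φ') {C D B ε u : ℝ} (hB : 0 ≤ B)
    (hθ : BddLip B θ) (hα : |α u - 1| ≤ C * u ^ 2) (hε : 0 ≤ ε)
    (hD : 1 ≤ D ∧ ∀ x ∈ Icc (1 / 3 : ℝ) 1, 0 ≤ x ^ (-3 / 2 : ℝ) ∧ x ^ (-3 / 2 : ℝ) ≤ D ∧
      ∀ y ∈ Icc (1 / 3 : ℝ) 1, |x ^ (-3 / 2 : ℝ) - y ^ (-3 / 2 : ℝ)| ≤ D * |x - y|)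
    (hu : u ∈ Ioo (0 : ℝ) 1) :
    |φ' u * (reg ε (φ u) * φ u ^ (-3 / 2 : ℝ) * θ (φ u)) -
      reg ε u * u ^ (-3 / 2 : ℝ) * θ u * α u| ≤ B * (7 * D + 4 + C) * u ^ (1 / 2 : ℝ) := by
  have h0 := hu.1
  obtain ⟨hφ0, hφ1⟩ := h.mapsTo hu
  have hup := h.upper u hu
  have hsub := h.sub_le u hu
  set y := φ u / u with hy
  have hyu : φ u = u * y := by rw [hy]; field_simp
  have hy1 : y ∈ Icc (1 / 3 : ℝ) 1 := by
    constructor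
    · rw [hy, le_div_iff₀ h0]; linarith [h.lower u hu]
    · rw [hy, div_le_one h0]; exact hup
  have hy2 : |y - 1| ≤ u ^ 2 := by
    rw [abs_sub_comm, abs_of_nonneg (by linarith [hy1.2])]
    have : 1 - y = (u - φ u) / u := by rw [hy]; field_simp
    rw [this, div_le_iff₀ h0]
    linarith [hsub, show u ^ 2 * u = u ^ 3 by ring]
  obtain ⟨p0, p1, p2⟩ := hD.2 y hy1
  have p3 : |y ^ (-3 / 2 : ℝ) - 1| ≤ D * u ^ 2 := by
    have := p2 1 (by norm_num)
    rw [Real.one_rpow] at this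
    exact this.trans (mul_le_mul_of_nonneg_left hy2 (by linarith))
  have hpow : φ u ^ (-3 / 2 : ℝ) = u ^ (-3 / 2 : ℝ) * y ^ (-3 / 2 : ℝ) := by
    rw [hyu, Real.mul_rpow h0.le (by linarith [hy1.1])]
  have hd := h.deriv_sub_le u hu
  have hR0 := reg_nonneg hε hφ0
  have hR1 := reg_le_one hε hφ0
  have hr0 := reg_nonneg hε h0
  have hr1 := reg_le_one hε h0
  have hRr : |reg ε (φ u) - reg ε u| ≤ 3 * u ^ 2 := by
    rw [abs_sub_comm]
    refine (reg_sub_le hε h0 hφ0).trans ?_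
    rw [abs_of_nonneg (by linarith)]
    have : (u - φ u) / u ≤ u ^ 2 := by
      rw [div_le_iff₀ h0]; linarith [show u ^ 2 * u = u ^ 3 by ring]
    linarith
  obtain ⟨t0, t1, t2⟩ := hθ (φ u) (h.mapsTo hu)
  obtain ⟨s0, s1, -⟩ := hθ u hu
  have t3 : |θ (φ u) - θ u| ≤ B * u ^ 2 := by
    refine (t2 u hu).trans (mul_le_mul_of_nonneg_left ?_ hB)
    rw [abs_sub_comm, abs_of_nonneg (by linarith)]
    nlinarith [hu.2, sq_nonneg u]
  have e : φ' u * (reg ε (φ u) * φ u ^ (-3 / 2 : ℝ) * θ (φ u)) -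
      reg ε u * u ^ (-3 / 2 : ℝ) * θ u * α u = u ^ (-3 / 2 : ℝ) *
      ((φ' u - 1) * (y ^ (-3 / 2 : ℝ) * (reg ε (φ u) * θ (φ u)))
        + (y ^ (-3 / 2 : ℝ) - 1) * (reg ε (φ u) * θ (φ u))
        + (reg ε (φ u) - reg ε u) * θ (φ u) + reg ε u * (θ (φ u) - θ u)
        - reg ε u * θ u * (α u - 1)) := by
    rw [hpow]; ring
  have hRt : |reg ε (φ u) * θ (φ u)| ≤ B := by
    rw [abs_of_nonneg (mul_nonneg hR0 t0)]
    nlinarith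
  have b1 : |(φ' u - 1) * (y ^ (-3 / 2 : ℝ) * (reg ε (φ u) * θ (φ u)))| ≤ 6 * u ^ 2 * (D * B) := by
    rw [abs_mul, abs_mul (y ^ _), abs_of_nonneg p0]
    exact mul_le_mul hd (mul_le_mul p1 hRt (abs_nonneg _) (by linarith)) (by positivity)
      (by positivity)
  have b2 : |(y ^ (-3 / 2 : ℝ) - 1) * (reg ε (φ u) * θ (φ u))| ≤ D * u ^ 2 * B := by
    rw [abs_mul]
    exact mul_le_mul p3 hRt (abs_nonneg _) (mul_nonneg (by linarith) (sq_nonneg u))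
  have b3 : |(reg ε (φ u) - reg ε u) * θ (φ u)| ≤ 3 * u ^ 2 * B := by
    rw [abs_mul, abs_of_nonneg t0]
    exact mul_le_mul hRr t1 t0 (by positivity)
  have b4 : |reg ε u * (θ (φ u) - θ u)| ≤ 1 * (B * u ^ 2) := by
    rw [abs_mul, abs_of_nonneg hr0]
    exact mul_le_mul hr1 t3 (abs_nonneg _) zero_le_one
  have b5 : |reg ε u * θ u * (α u - 1)| ≤ 1 * B * (C * u ^ 2) := by
    rw [abs_mul, abs_of_nonneg (mul_nonneg hr0 s0)]
    exact mul_le_mul (mul_le_mul hr1 s1 s0 zero_le_one) hα (abs_nonneg _) (by positivity)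
  have hp : 0 ≤ u ^ (-3 / 2 : ℝ) := Real.rpow_nonneg h0.le _
  have hpp : u ^ (1 / 2 : ℝ) = u ^ (-3 / 2 : ℝ) * u ^ 2 := by
    rw [← Real.rpow_natCast, ← Real.rpow_add h0]; congr 1; norm_num
  rw [e, abs_mul, abs_of_nonneg hp, hpp]
  have hsum := (abs_sub _ _).trans (add_le_add ((abs_add_le _ _).trans (add_le_add
    ((abs_add_le _ _).trans (add_le_add ((abs_add_le _ _).trans (add_le_add b1 b2)) b3)) b4)) b5)
  refine (mul_le_mul_of_nonneg_left hsum hp).trans (le_of_eq ?_)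
  ring

/-- The non-integrable weight `u^(-3/2)` is harmless in front of a difference `H u - H (φ u)` with
`φ` close to the identity: a substitution moves the difference to the weight. -/
lemma NearId.abs_integral_le {φ φ' θ α H : ℝ → ℝ} (h : NearId φ φ') {β r s C D B Q ε : ℝ}
    (hE : Exponents β r s) (hC : 0 ≤ C) (hB : 0 ≤ B)
    (hθ : BddLip B θ) (hα : ∀ u ∈ Ioo (0 : ℝ) 1, |α u - 1| ≤ C * u ^ 2)
    (hαc : ContinuousOn α (Ioo 0 1)) (hε : 0 < ε)
    (hD : 1 ≤ D ∧ ∀ x ∈ Icc (1 / 3 : ℝ) 1, 0 ≤ x ^ (-3 / 2 : ℝ) ∧ x ^ (-3 / 2 : ℝ) ≤ D ∧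
      ∀ y ∈ Icc (1 / 3 : ℝ) 1, |x ^ (-3 / 2 : ℝ) - y ^ (-3 / 2 : ℝ)| ≤ D * |x - y|)
    (hH : ContinuousOn H (Ioo 0 1)) (hHQ : ∀ u ∈ Ioo (0 : ℝ) 1, |H u| ≤ Q) :
    |∫ u in Ioo (0 : ℝ) 1, reg ε u * u ^ (-3 / 2 : ℝ) * θ u * (H u - α u * H (φ u))| ≤
      B * (7 * D + 4 + C) * ∫ u in Ioo (0 : ℝ) 1, u ^ s * (|H u| + |H (φ u)|) := by
  have hD1 := hD.1
  have hK : 0 ≤ B * (7 * D + 4 + C) := by positivity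
  have hφc : ContinuousOn φ (Ioo 0 1) := h.cont.mono Ioo_subset_Icc_self
  have hHφ : ContinuousOn (fun u => H (φ u)) (Ioo 0 1) := hH.comp hφc h.mapsTo
  have hθc := hθ.continuousOn
  have hrc := continuousOn_reg hε.le
  have hgc : ContinuousOn (fun u => reg ε u * u ^ (-3 / 2 : ℝ) * θ u) (Ioo 0 1) :=
    (hrc.mul (continuousOn_rpow_Ioo _)).mul hθc
  have hgb : ∀ u ∈ Ioo (0 : ℝ) 1, 0 ≤ reg ε u * u ^ (-3 / 2 : ℝ) * θ u ∧
      reg ε u * u ^ (-3 / 2 : ℝ) * θ u ≤ (ε ^ 3)⁻¹ * B := by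
    intro u hu
    have h1 : reg ε u * u ^ (-3 / 2 : ℝ) ≤ (ε ^ 3)⁻¹ :=
      (mul_le_mul_of_nonneg_left (rpow_le_rpow_of_mem hu (by norm_num))
        (reg_nonneg hε.le hu.1)).trans (reg_mul_rpow_le hε hu.1)
    have h2 : 0 ≤ reg ε u * u ^ (-3 / 2 : ℝ) :=
      mul_nonneg (reg_nonneg hε.le hu.1) (Real.rpow_nonneg hu.1.le _)
    exact ⟨mul_nonneg h2 (hθ u hu).1, mul_le_mul h1 (hθ u hu).2.1 (hθ u hu).1 (by positivity)⟩
  set g : ℝ → ℝ := fun u => reg ε u * u ^ (-3 / 2 : ℝ) * θ u with hg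
  set G : ℝ → ℝ := fun u => g u * H u with hG
  have hQ : 0 ≤ Q := (abs_nonneg _).trans (hHQ (1 / 2) (by norm_num))
  have hGint : IntegrableOn G (Ioo 0 1) := by
    refine integrableOn_of_bound (g := fun _ => (ε ^ 3)⁻¹ * B * Q) (hgc.mul hH)
      (integrableOn_const (by simp)) fun u hu => ?_
    rw [abs_mul, abs_of_nonneg (hgb u hu).1]
    exact mul_le_mul (hgb u hu).2 (hHQ u hu) (abs_nonneg _) (by positivity)
  set S := φ '' Ioo 0 1 with hS
  have hSm : MeasurableSet S := measurableSet_Ioo.image_of_continuousOn_injOn hφc h.inj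
  have hSsub : S ⊆ Ioo 0 1 := h.mapsTo.image_subset
  have hder : ∀ u ∈ Ioo (0 : ℝ) 1, HasDerivWithinAt φ (φ' u) (Ioo 0 1) u :=
    fun u hu => (h.deriv u hu).hasDerivWithinAt
  have hGφ : IntegrableOn (fun u => φ' u * G (φ u)) (Ioo 0 1) := by
    have := (integrableOn_image_iff_integrableOn_abs_deriv_smul measurableSet_Ioo hder h.inj
      G).1 (hGint.mono_set hSsub)
    refine this.congr_fun (fun u hu => ?_) measurableSet_Ioo
    simp [abs_of_nonneg (h.deriv_nonneg u hu)]
  have hsplit : ∫ u in Ioo (0 : ℝ) 1, G u =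
      (∫ u in Ioo (0 : ℝ) 1, φ' u * G (φ u)) + ∫ u in Ioo (0 : ℝ) 1 \ S, G u := by
    have h1 := integral_image_eq_integral_abs_deriv_smul measurableSet_Ioo hder h.inj G
    have h2 : ∫ u in Ioo (0 : ℝ) 1, |φ' u| • G (φ u) = ∫ u in Ioo (0 : ℝ) 1, φ' u * G (φ u) := by
      refine setIntegral_congr_fun measurableSet_Ioo fun u hu => ?_
      simp [abs_of_nonneg (h.deriv_nonneg u hu)]
    rw [← h2, ← h1, ← setIntegral_union disjoint_sdiff_right (measurableSet_Ioo.diff hSm)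
      (hGint.mono_set hSsub) (hGint.mono_set sdiff_subset), union_sdiff_cancel hSsub]
  have hG2 : IntegrableOn (fun u => g u * (α u * H (φ u))) (Ioo 0 1) := by
    refine integrableOn_of_bound (g := fun _ => (ε ^ 3)⁻¹ * B * ((1 + C) * Q))
      (hgc.mul (hαc.mul hHφ)) (integrableOn_const (by simp)) fun u hu => ?_
    rw [abs_mul, abs_of_nonneg (hgb u hu).1, abs_mul]
    have hα1 : |α u| ≤ 1 + C := by
      have h1 := abs_sub_abs_le_abs_sub (α u) 1
      have h2 := hα u hu
      have h3 : C * u ^ 2 ≤ C := mul_le_of_le_one_right hC (by nlinarith [hu.1, hu.2])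
      rw [abs_one] at h1
      linarith
    exact mul_le_mul (hgb u hu).2 (mul_le_mul hα1 (hHQ _ (h.mapsTo hu)) (abs_nonneg _)
      (by positivity)) (by positivity) (by positivity)
  have hI1 : IntegrableOn (fun u => u ^ s * |H u|) (Ioo 0 1) := by
    refine integrableOn_of_bound ((continuousOn_rpow_Ioo s).mul hH.abs)
      ((integrableOn_rpow hE.s_gt).mul_const Q) fun u hu => ?_
    rw [abs_mul, abs_of_nonneg (Real.rpow_nonneg hu.1.le _), abs_abs]
    exact mul_le_mul_of_nonneg_left (hHQ u hu) (Real.rpow_nonneg hu.1.le _)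
  have hI2 : IntegrableOn (fun u => u ^ s * |H (φ u)|) (Ioo 0 1) := by
    refine integrableOn_of_bound ((continuousOn_rpow_Ioo s).mul hHφ.abs)
      ((integrableOn_rpow hE.s_gt).mul_const Q) fun u hu => ?_
    rw [abs_mul, abs_of_nonneg (Real.rpow_nonneg hu.1.le _), abs_abs]
    exact mul_le_mul_of_nonneg_left (hHQ _ (h.mapsTo hu)) (Real.rpow_nonneg hu.1.le _)
  have e1 : ∫ u in Ioo (0 : ℝ) 1, reg ε u * u ^ (-3 / 2 : ℝ) * θ u * (H u - α u * H (φ u)) =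
      (∫ u in Ioo (0 : ℝ) 1, (φ' u * G (φ u) - g u * (α u * H (φ u)))) +
        ∫ u in Ioo (0 : ℝ) 1 \ S, G u := by
    rw [integral_sub hGφ hG2, sub_add_eq_add_sub, ← hsplit, ← integral_sub hGint hG2]
    refine integral_congr_ae (Filter.Eventually.of_forall fun u => ?_)
    simp only [hG, hg]
    ring
  have b1 : |∫ u in Ioo (0 : ℝ) 1, (φ' u * G (φ u) - g u * (α u * H (φ u)))| ≤
      ∫ u in Ioo (0 : ℝ) 1, B * (7 * D + 4 + C) * (u ^ s * |H (φ u)|) := by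
    refine abs_setIntegral_le (hI2.const_mul _) fun u hu => ?_
    have e : φ' u * G (φ u) - g u * (α u * H (φ u)) =
        (φ' u * (reg ε (φ u) * φ u ^ (-3 / 2 : ℝ) * θ (φ u)) -
          reg ε u * u ^ (-3 / 2 : ℝ) * θ u * α u) * H (φ u) := by
      simp only [hG, hg]; ring
    rw [e, abs_mul]
    refine (mul_le_mul_of_nonneg_right ((h.weight_sub_le hB hθ (hα u hu) hε.le hD hu).trans ?_)
      (abs_nonneg _)).trans (le_of_eq (mul_assoc _ (u ^ s) _))
    exact mul_le_mul_of_nonneg_left (rpow_le_rpow_of_mem hu (by linarith [hE.s_le])) hK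
  -- outside the range of `φ` the weight is bounded
  have b2 : |∫ u in Ioo (0 : ℝ) 1 \ S, G u| ≤
      ∫ u in Ioo (0 : ℝ) 1, B * (7 * D + 4 + C) * (u ^ s * |H u|) := by
    have hI : IntegrableOn (fun u => B * (7 * D + 4 + C) * (u ^ s * |H u|)) (Ioo 0 1) :=
      hI1.const_mul _
    have hnn : ∀ u ∈ Ioo (0 : ℝ) 1, 0 ≤ B * (7 * D + 4 + C) * (u ^ s * |H u|) := fun u hu =>
      mul_nonneg hK (mul_nonneg (Real.rpow_nonneg hu.1.le _) (abs_nonneg _))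
    have h1 : |∫ u in Ioo (0 : ℝ) 1 \ S, G u| ≤
        ∫ u in Ioo (0 : ℝ) 1 \ S, B * (7 * D + 4 + C) * (u ^ s * |H u|) := by
      rw [← Real.norm_eq_abs]
      refine norm_integral_le_of_norm_le (hI.mono_set sdiff_subset)
        ((ae_restrict_iff' (measurableSet_Ioo.diff hSm)).2
          (Filter.Eventually.of_forall fun u hu => ?_))
      have huI := hu.1
      have hu2 : 1 / 2 ≤ u := by
        by_contra hlt
        refine hu.2 ?_
        have := intermediate_value_Ioo zero_le_one h.cont
        exact this ⟨by rw [h.zero]; exact huI.1, by linarith [h.one]⟩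
      have hpow : u ^ (-3 / 2 : ℝ) ≤ 4 := by
        have : u ^ (-3 / 2 : ℝ) ≤ (1 / 2 : ℝ) ^ (-3 / 2 : ℝ) :=
          Real.rpow_le_rpow_of_nonpos (by norm_num) hu2 (by norm_num)
        refine this.trans ?_
        have h4 : (4 : ℝ) = (1 / 2 : ℝ) ^ (-2 : ℝ) := by
          rw [Real.rpow_neg (by norm_num)]; norm_num
        rw [h4]
        exact Real.rpow_le_rpow_of_exponent_ge (by norm_num) (by norm_num) (by norm_num)
      have hs1 : 1 ≤ u ^ s := Real.one_le_rpow_of_pos_of_le_one_of_nonpos huI.1 huI.2.le hE.s_le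
      have hg1 : g u ≤ 1 * 4 * B := by
        have t0 := hθ u huI
        exact mul_le_mul (mul_le_mul (reg_le_one hε.le huI.1) hpow
          (Real.rpow_nonneg huI.1.le _) zero_le_one) t0.2.1 t0.1 (by norm_num)
      rw [Real.norm_eq_abs, abs_mul, abs_of_nonneg (hgb u huI).1]
      refine (mul_le_mul_of_nonneg_right ?_ (abs_nonneg _)).trans
        (le_of_eq (mul_assoc _ (u ^ s) _))
      have h5 : 1 * 4 * B ≤ B * (7 * D + 4 + C) := by nlinarith
      exact hg1.trans (h5.trans (le_mul_of_one_le_right hK hs1))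
    refine h1.trans (setIntegral_mono_set hI ?_ (Filter.Eventually.of_forall sdiff_subset))
    exact (ae_restrict_iff' measurableSet_Ioo).2 (Filter.Eventually.of_forall hnn)
  rw [e1]
  refine (abs_add_le _ _).trans ((add_le_add b1 b2).trans (le_of_eq ?_))
  rw [← integral_const_mul, ← integral_add (hI2.const_mul _) (hI1.const_mul _)]
  refine integral_congr_ae (Filter.Eventually.of_forall fun u => ?_)
  simp only
  ring

/-! ### The difference of two collision integrals -/

/-- The diffusive part couples the point `ω = ω v_k / v_k` to `ω vᵢ / v_k` for the pairs
`(i, k) = (i, partner i)`. -/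
def partner : Fin 4 → Fin 4 := ![1, 0, 3, 2]

/-- The rate, as a density in `u`, of the jump from `ω` to `ω vᵢ / v_k`, where `k = partner i`. -/
noncomputable def jumpRate (β : ℝ) (N : ℝ → ℝ) (ω u : ℝ) (i : Fin 4) : ℝ :=
  let va := v 0 u ^ (2 * β + 3 / 2)
  let vb := v 0 u ^ (2 * β - 1 / 2)
  let ka := kap u ^ (2 * β + 3 / 2)
  let kb := kap u ^ (2 * β - 1 / 2)
  let n := sample N ω u
  mu β u * ![u ^ (-2 * β - 1) * (n 2 1 * n 3 1), u ^ (-2 * β - 1) * (va * vb) * (n 2 0 * n 3 0),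
    u ^ (2 * β) * (ka * kb) * (n 0 3 * n 1 3), u ^ (2 * β) * (va * vb) * (n 0 2 * n 1 2)] i

/-- The sum of the sixteen values `|W_{i,k}|`, with the weights of the columns. -/
noncomputable def kernelSum (r : ℝ) (W : ℝ → ℝ) (ω u : ℝ) : ℝ :=
  ∑ k, ∑ i, colWeight r u k * |sample W ω u i k|

lemma sample_self (N : ℝ → ℝ) (ω : ℝ) {u : ℝ} (hu : u ∈ Ioo (0 : ℝ) 1) (k : Fin 4) :
    sample N ω u k k = N ω := by
  unfold sample
  rw [mul_div_assoc, div_self (v_pos hu k).ne', mul_one]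

lemma diffusive_eq_sum (β : ℝ) (N : ℝ → ℝ) (ω u : ℝ) (w : Fin 4 → Fin 4 → ℝ) :
    diffusive β u (sample N ω u) w =
      ∑ i, jumpRate β N ω u i * (w i (partner i) - w (partner i) (partner i)) := by
  simp only [diffusive, jumpRate, partner, Fin.sum_univ_four, Fin.isValue, Matrix.cons_val]
  ring

section JumpRate

variable {β C r s A ε ω : ℝ} {N : ℝ → ℝ}

lemma jumpRate_nonneg (hW : WeightBound β C) (hpos : ∀ x : ℝ, 0 < x → 0 ≤ N x) (hω : 0 < ω)
    {u : ℝ} (hu : u ∈ Ioo (0 : ℝ) 1) (i : Fin 4) : 0 ≤ jumpRate β N ω u i := by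
  have hn : ∀ i k, 0 ≤ sample N ω u i k := fun i k => hpos _ (mul_ratio_pos hω hu i k)
  have hm := (hW.mu u hu).1
  have hva := (hW.va u hu).1
  have hvb := (hW.vb u hu).1
  have hka := (hW.ka u hu).1
  have hkb := (hW.kb u hu).1
  have h1 := Real.rpow_nonneg hu.1.le (-2 * β - 1)
  have h2 := Real.rpow_nonneg hu.1.le (2 * β)
  unfold jumpRate
  refine mul_nonneg hm ?_
  fin_cases i
  · exact mul_nonneg h1 (mul_nonneg (hn 2 1) (hn 3 1))
  · exact mul_nonneg (mul_nonneg h1 (mul_nonneg hva hvb)) (mul_nonneg (hn 2 0) (hn 3 0))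
  · exact mul_nonneg (mul_nonneg h2 (mul_nonneg hka hkb)) (mul_nonneg (hn 0 3) (hn 1 3))
  · exact mul_nonneg (mul_nonneg h2 (mul_nonneg hva hvb)) (mul_nonneg (hn 0 2) (hn 1 2))

lemma jumpRate_le (hW : WeightBound β C) (hE : Exponents β r s) (hN : GoodFn A N)
    (hω : 0 < ω) {u : ℝ} (hu : u ∈ Ioo (0 : ℝ) 1) (i : Fin 4) :
    jumpRate β N ω u i ≤ C ^ 3 * A ^ 2 * u ^ (-3 : ℝ) := by
  have hA := hN.nonneg
  have hb := (hN.sampleBound hω hu).bound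
  have hC := hW.one_le
  obtain ⟨m0, m1, -⟩ := hW.mu u hu
  obtain ⟨va0, va1, -⟩ := hW.va u hu
  obtain ⟨vb0, vb1, -⟩ := hW.vb u hu
  obtain ⟨ka0, ka1, -⟩ := hW.ka u hu
  obtain ⟨kb0, kb1, -⟩ := hW.kb u hu
  beta_reduce at va0 va1 vb0 vb1 ka0 ka1 kb0 kb1
  have hp : ∀ {p x y c d : ℝ}, -3 ≤ p → |x| ≤ A → |y| ≤ A → 0 ≤ c → c ≤ C → 0 ≤ d → d ≤ C →
      mu β u * (u ^ p * (c * d) * (x * y)) ≤ C ^ 3 * A ^ 2 * u ^ (-3 : ℝ) := by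
    intro p x y c d hp hx hy hc0 hc hd0 hd
    have hup := Real.rpow_nonneg hu.1.le p
    have h1 : |x * y| ≤ A * A := by
      rw [abs_mul]; exact mul_le_mul hx hy (abs_nonneg _) hA
    have h2 : c * d ≤ C * C := mul_le_mul hc hd hd0 (by linarith)
    have h3 : u ^ p * (c * d) ≤ u ^ (-3 : ℝ) * (C * C) :=
      mul_le_mul (rpow_le_rpow_of_mem hu hp) h2 (mul_nonneg hc0 hd0)
        (Real.rpow_nonneg hu.1.le _)
    have h4 : |u ^ p * (c * d) * (x * y)| ≤ u ^ (-3 : ℝ) * (C * C) * (A * A) := by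
      rw [abs_mul, abs_of_nonneg (mul_nonneg hup (mul_nonneg hc0 hd0))]
      exact mul_le_mul h3 h1 (abs_nonneg _)
        (mul_nonneg (Real.rpow_nonneg hu.1.le _) (by positivity))
    have h5 := (le_abs_self _).trans (abs_mul_le_of_nonneg m0 m1 h4)
    linarith
  have e1 : -3 ≤ -2 * β - 1 := by linarith [hE.s_le₁, hE.s_gt, hE.r_pos]
  have e2 : -3 ≤ 2 * β := by linarith [hE.s_le₂, hE.s_gt]
  unfold jumpRate
  fin_cases i
  · have := hp e1 (hb 2 1) (hb 3 1) zero_le_one hC zero_le_one hC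
    rw [mul_one, mul_one] at this
    exact this
  · exact hp e1 (hb 2 0) (hb 3 0) va0 va1 vb0 vb1
  · exact hp e2 (hb 0 3) (hb 1 3) ka0 ka1 kb0 kb1
  · exact hp e2 (hb 0 2) (hb 1 2) va0 va1 vb0 vb1

lemma reg_mul_jumpRate_le (hW : WeightBound β C) (hE : Exponents β r s) (hN : GoodFn A N)
    (hε : 0 < ε) (hω : 0 < ω) {u : ℝ} (hu : u ∈ Ioo (0 : ℝ) 1) (i : Fin 4) :
    reg ε u * jumpRate β N ω u i ≤ C ^ 3 * A ^ 2 * (ε ^ 3)⁻¹ := by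
  have hC := hW.one_le
  have h1 := mul_le_mul_of_nonneg_left (jumpRate_le hW hE hN hω hu i) (reg_nonneg hε.le hu.1)
  have h2 := mul_le_mul_of_nonneg_left (reg_mul_rpow_le hε hu.1)
    (show 0 ≤ C ^ 3 * A ^ 2 by positivity)
  linarith

lemma continuousOn_jumpRate {X : Type*} [TopologicalSpace X] {S : Set X} {f g : X → ℝ} (β : ℝ)
    (hN : ContinuousOn N (Ioi 0)) (hf : ContinuousOn f S) (hS : MapsTo f S (Ioo 0 1))
    (hg : ContinuousOn g S) (hgS : MapsTo g S (Ioi 0)) (i : Fin 4) :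
    ContinuousOn (fun z => jumpRate β N (g z) (f z) i) S := by
  obtain ⟨hm, hva, hvb, hka, hkb, h1, -, -, h4⟩ := continuousOn_weights β hf hS
  have hn := continuousOn_sample hN hf hS hg hgS
  unfold jumpRate
  fin_cases i
  · exact hm.mul (h1.mul ((hn 2 1).mul (hn 3 1)))
  · exact hm.mul ((h1.mul (hva.mul hvb)).mul ((hn 2 0).mul (hn 3 0)))
  · exact hm.mul ((h4.mul (hka.mul hkb)).mul ((hn 0 3).mul (hn 1 3)))
  · exact hm.mul ((h4.mul (hva.mul hvb)).mul ((hn 0 2).mul (hn 1 2)))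

lemma continuousOn_jumpRate_u (β : ℝ) (hN : ContinuousOn N (Ioi 0)) (hω : 0 < ω) (i : Fin 4) :
    ContinuousOn (fun u => jumpRate β N ω u i) (Ioo 0 1) :=
  continuousOn_jumpRate (f := id) (g := fun _ => ω) β hN continuousOn_id (fun _ h => h)
    continuousOn_const (fun _ _ => hω) i

lemma integrableOn_jumpRate_mul (hW : WeightBound β C) (hE : Exponents β r s) (hN : GoodFn A N)
    (hpos : ∀ x : ℝ, 0 < x → 0 ≤ N x) (hε : 0 < ε) (hω : 0 < ω) (i : Fin 4) {f : ℝ → ℝ} {Q : ℝ}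
    (hf : ContinuousOn f (Ioo 0 1)) (hfQ : ∀ u ∈ Ioo (0 : ℝ) 1, |f u| ≤ Q) :
    IntegrableOn (fun u => reg ε u * jumpRate β N ω u i * f u) (Ioo 0 1) := by
  have hC := hW.one_le
  refine integrableOn_of_bound (g := fun _ => C ^ 3 * A ^ 2 * (ε ^ 3)⁻¹ * Q)
    (((continuousOn_reg hε.le).mul (continuousOn_jumpRate_u β hN.continuousOn hω i)).mul hf)
    (integrableOn_const (by simp)) fun u hu => ?_
  rw [abs_mul, abs_of_nonneg (mul_nonneg (reg_nonneg hε.le hu.1)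
    (jumpRate_nonneg hW hpos hω hu i))]
  exact mul_le_mul (reg_mul_jumpRate_le hW hE hN hε hω hu i) (hfQ u hu) (abs_nonneg _)
    (by positivity)

end JumpRate

lemma colWeight_nonneg (r : ℝ) {u : ℝ} (hu : u ∈ Ioo (0 : ℝ) 1) (k : Fin 4) :
    0 ≤ colWeight r u k := by
  unfold colWeight
  split_ifs
  · exact Real.rpow_nonneg hu.1.le _
  · exact zero_le_one

lemma colWeight_le_one {r : ℝ} (hr : 0 ≤ r) {u : ℝ} (hu : u ∈ Ioo (0 : ℝ) 1) (k : Fin 4) :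
    colWeight r u k ≤ 1 := by
  unfold colWeight
  split_ifs
  · exact Real.rpow_le_one hu.1.le hu.2.le hr
  · exact le_rfl

lemma continuousOn_colWeight (r : ℝ) (k : Fin 4) :
    ContinuousOn (fun u => colWeight r u k) (Ioo 0 1) := by
  unfold colWeight
  split_ifs
  · exact continuousOn_rpow_Ioo r
  · exact continuousOn_const

lemma kernelSum_nonneg (r : ℝ) (W : ℝ → ℝ) (ω : ℝ) {u : ℝ} (hu : u ∈ Ioo (0 : ℝ) 1) :
    0 ≤ kernelSum r W ω u :=
  Finset.sum_nonneg fun k _ => Finset.sum_nonneg fun _ _ =>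
    mul_nonneg (colWeight_nonneg r hu k) (abs_nonneg _)

lemma kernelSum_le {r Q : ℝ} (hr : 0 ≤ r) {W : ℝ → ℝ} (hQ : ∀ x : ℝ, 0 < x → |W x| ≤ Q) {ω : ℝ}
    (hω : 0 < ω) {u : ℝ} (hu : u ∈ Ioo (0 : ℝ) 1) : kernelSum r W ω u ≤ 16 * Q := by
  have : kernelSum r W ω u ≤ ∑ _k : Fin 4, ∑ _i : Fin 4, Q :=
    Finset.sum_le_sum fun k _ => Finset.sum_le_sum fun i _ =>
      (mul_le_of_le_one_left (abs_nonneg _) (colWeight_le_one hr hu k)).trans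
        (hQ _ (mul_ratio_pos hω hu i k))
  refine this.trans (le_of_eq ?_)
  simp
  ring

lemma continuousOn_kernelSum (r : ℝ) {W : ℝ → ℝ} (hW : ContinuousOn W (Ioi 0)) {ω : ℝ}
    (hω : 0 < ω) : ContinuousOn (kernelSum r W ω) (Ioo 0 1) := by
  unfold kernelSum
  refine continuousOn_finsetSum _ fun k _ => continuousOn_finsetSum _ fun i _ => ?_
  exact (continuousOn_colWeight r k).mul (continuousOn_sample_u hW hω i k).abs

lemma integrableOn_kernelSum {r s Q : ℝ} (hr : 0 ≤ r) (hs : -1 < s) {W : ℝ → ℝ}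
    (hW : ContinuousOn W (Ioi 0)) (hQ : ∀ x : ℝ, 0 < x → |W x| ≤ Q) {ω : ℝ} (hω : 0 < ω) :
    IntegrableOn (fun u => u ^ s * kernelSum r W ω u) (Ioo 0 1) := by
  refine integrableOn_of_bound ((continuousOn_rpow_Ioo s).mul (continuousOn_kernelSum r hW hω))
    ((integrableOn_rpow hs).mul_const (16 * Q)) fun u hu => ?_
  have h0 := Real.rpow_nonneg hu.1.le s
  rw [abs_of_nonneg (mul_nonneg h0 (kernelSum_nonneg r W ω hu))]
  exact mul_le_mul_of_nonneg_left (kernelSum_le hr hQ hω hu) h0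

lemma bddLip_const {A x : ℝ} (h0 : 0 ≤ x) (h : x ≤ A) : BddLip A (fun _ => x) := by
  intro u _
  refine ⟨h0, h, fun w _ => ?_⟩
  rw [sub_self, abs_zero]
  exact mul_nonneg (h0.trans h) (abs_nonneg _)

lemma abs_log_sub_le {u w : ℝ} (hu : 0 < u) (hw : 0 < w) :
    |Real.log (1 + u) - Real.log (1 + w)| ≤ |u - w| := by
  rw [← Real.log_div (by positivity) (by positivity)]
  have h1 := Real.log_le_sub_one_of_pos (show 0 < (1 + u) / (1 + w) by positivity)
  have h2 := Real.one_sub_inv_le_log_of_pos (show 0 < (1 + u) / (1 + w) by positivity)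
  have e1 : (1 + u) / (1 + w) - 1 = (u - w) / (1 + w) := by field_simp; ring
  have e2 : 1 - ((1 + u) / (1 + w))⁻¹ = (u - w) / (1 + u) := by field_simp; ring
  rw [e1] at h1
  rw [e2] at h2
  have hd : ∀ c : ℝ, 0 < c → |(u - w) / (1 + c)| ≤ |u - w| := by
    intro c hc
    rw [abs_div, abs_of_pos (show 0 < 1 + c by linarith)]
    exact div_le_self (abs_nonneg _) (by linarith)
  have d1 := (abs_le.1 (hd w hw)).2
  have d2 := (abs_le.1 (hd u hu)).1
  exact abs_le.2 ⟨by linarith, by linarith⟩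

lemma sample_two_three (N : ℝ → ℝ) (ω : ℝ) {u : ℝ} (hu : u ∈ Ioo (0 : ℝ) 1) :
    sample N ω u 2 3 = N (ω * (1 + u)) := by
  have h1 := hu.1.ne'
  have h2 := (kap_pos hu).ne'
  unfold sample
  rw [v_two, v_three, v_zero]
  congr 1
  field_simp

lemma sample_three_two (N : ℝ → ℝ) (ω : ℝ) {u : ℝ} (hu : u ∈ Ioo (0 : ℝ) 1) :
    sample N ω u 3 2 = N (ω / (1 + u)) := by
  have h1 := hu.1
  have h2 := (kap_pos hu).ne'
  unfold sample
  rw [v_two, v_three, v_zero]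
  congr 1
  field_simp

section CrossTerms

variable {A ω : ℝ} {N : ℝ → ℝ}

lemma bddLip_sample_two_three (hN : GoodFn A N) (hpos : ∀ x : ℝ, 0 < x → 0 ≤ N x) (hω : 0 < ω) :
    BddLip A (fun u => sample N ω u 2 3) := by
  intro u hu
  have h0 := hu.1
  refine ⟨hpos _ (mul_ratio_pos hω hu 2 3), (le_abs_self _).trans
    (hN.bound _ (mul_ratio_pos hω hu 2 3)), fun w hw => ?_⟩
  have h1 := hw.1
  beta_reduce
  rw [sample_two_three N ω hu, sample_two_three N ω hw]
  refine (hN.lip _ (by positivity) _ (by positivity)).trans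
    (mul_le_mul_of_nonneg_left ?_ hN.nonneg)
  rw [Real.log_mul hω.ne' (by positivity), Real.log_mul hω.ne' (by positivity),
    add_sub_add_left_eq_sub]
  exact abs_log_sub_le h0 h1

lemma bddLip_sample_three_two (hN : GoodFn A N) (hpos : ∀ x : ℝ, 0 < x → 0 ≤ N x) (hω : 0 < ω) :
    BddLip A (fun u => sample N ω u 3 2) := by
  intro u hu
  have h0 := hu.1
  refine ⟨hpos _ (mul_ratio_pos hω hu 3 2), (le_abs_self _).trans
    (hN.bound _ (mul_ratio_pos hω hu 3 2)), fun w hw => ?_⟩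
  have h1 := hw.1
  beta_reduce
  rw [sample_three_two N ω hu, sample_three_two N ω hw]
  refine (hN.lip _ (by positivity) _ (by positivity)).trans
    (mul_le_mul_of_nonneg_left ?_ hN.nonneg)
  rw [Real.log_div hω.ne' (by positivity), Real.log_div hω.ne' (by positivity),
    sub_sub_sub_cancel_left, abs_sub_comm]
  exact abs_log_sub_le h0 h1

/-- With denominator `v₃`, the value for `v₂` is the value for `v₁` at another parameter. -/
lemma sample_one_two (W : ℝ → ℝ) (ω : ℝ) {u : ℝ} (hu : u ∈ Ioo (0 : ℝ) 1) :
    sample W ω u 1 2 = sample W ω (v 2 u) 0 2 := by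
  have h := nearId_v_two.mapsTo hu
  have h1 := (v_zero_pos h).ne'
  have h2 := h.1.ne'
  unfold sample
  rw [v_one, v_two (v 2 u)]
  congr 1
  field_simp

/-- With denominator `v₄`, the value for `v₂` is the value for `v₁` at another parameter. -/
lemma sample_one_three (W : ℝ → ℝ) (ω : ℝ) {u : ℝ} (hu : u ∈ Ioo (0 : ℝ) 1) :
    sample W ω u 1 3 = sample W ω (u / (1 + u ^ 2)) 0 3 := by
  have h := nearId_div.mapsTo hu
  have h0 := hu.1
  have h1 := (kap_pos h).ne'
  have h2 : 0 < u / (1 + u ^ 2) := h.1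
  unfold sample
  rw [v_one, v_three, v_zero, v_three]
  congr 1
  unfold kap at h1 ⊢
  field_simp
  ring

/-- The contribution of the cross part is dominated by the integrable kernel `u^s`. -/
lemma abs_integral_crossPart_le {β C D r s Q ε : ℝ} (hW : WeightBound β C) (hE : Exponents β r s)
    (hD : 1 ≤ D ∧ ∀ x ∈ Icc (1 / 3 : ℝ) 1, 0 ≤ x ^ (-3 / 2 : ℝ) ∧ x ^ (-3 / 2 : ℝ) ≤ D ∧
      ∀ y ∈ Icc (1 / 3 : ℝ) 1, |x ^ (-3 / 2 : ℝ) - y ^ (-3 / 2 : ℝ)| ≤ D * |x - y|)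
    (hN : GoodFn A N) (hpos : ∀ x : ℝ, 0 < x → 0 ≤ N x) (hω : 0 < ω) (hε : 0 < ε) {W : ℝ → ℝ}
    (hWc : ContinuousOn W (Ioi 0)) (hQ : ∀ x : ℝ, 0 < x → |W x| ≤ Q) :
    IntegrableOn (fun u => reg ε u * crossPart β u (sample N ω u) (sample W ω u)) (Ioo 0 1) ∧
    |∫ u in Ioo (0 : ℝ) 1, reg ε u * crossPart β u (sample N ω u) (sample W ω u)| ≤
      8 * C ^ 2 * A ^ 2 * (7 * D + 4 + C) * ∫ u in Ioo (0 : ℝ) 1, u ^ s * kernelSum r W ω u := by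
  have hC := hW.one_le
  have hA := hN.nonneg
  have hQ0 : 0 ≤ Q := (abs_nonneg _).trans (hQ 1 one_pos)
  have hself : BddLip A (fun _ => N ω) :=
    bddLip_const (hpos ω hω) ((le_abs_self _).trans (hN.bound ω hω))
  have hθ₃ : BddLip (8 * C ^ 2 * A ^ 2) (fun u => mu β u * (kap u ^ (2 * β - 1 / 2) *
      (sample N ω u 2 3 * N ω))) :=
    (hW.mu.mul (by positivity) (by positivity) (hW.kb.mul (by positivity) (by positivity)
      ((bddLip_sample_two_three hN hpos hω).mul hA hA hself))).mono (by nlinarith)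
  have hθ₂ : BddLip (8 * C ^ 2 * A ^ 2) (fun u => mu β u * (v 0 u ^ (2 * β - 1 / 2) *
      (N ω * sample N ω u 3 2))) :=
    (hW.mu.mul (by positivity) (by positivity) (hW.vb.mul (by positivity) (by positivity)
      (hself.mul hA hA (bddLip_sample_three_two hN hpos hω)))).mono (by nlinarith)
  set θ₃ : ℝ → ℝ := fun u => mu β u * (kap u ^ (2 * β - 1 / 2) * (sample N ω u 2 3 * N ω))
  set θ₂ : ℝ → ℝ := fun u => mu β u * (v 0 u ^ (2 * β - 1 / 2) * (N ω * sample N ω u 3 2))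
  have hB : 0 ≤ 8 * C ^ 2 * A ^ 2 := by positivity
  have hs := fun i k => continuousOn_sample_u hWc hω i k
  have hsQ : ∀ i k, ∀ u ∈ Ioo (0 : ℝ) 1, |sample W ω u i k| ≤ Q := fun i k u hu =>
    hQ _ (mul_ratio_pos hω hu i k)
  have hvac := continuousOn_rpow_v_zero (2 * β + 3 / 2)
  have key₂ := nearId_v_two.abs_integral_le hE (by linarith) hB hθ₂ hW.va_sub_one hvac hε hD
    (hs 0 2) (hsQ 0 2)
  have key₃ := nearId_div.abs_integral_le hE (by linarith) hB hθ₃ hW.va_sub_one hvac hε hD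
    (hs 0 3) (hsQ 0 3)
  have hint : ∀ (θ : ℝ → ℝ) (k : Fin 4), BddLip (8 * C ^ 2 * A ^ 2) θ →
      IntegrableOn (fun u => reg ε u * u ^ (-3 / 2 : ℝ) * θ u *
        (sample W ω u 0 k - v 0 u ^ (2 * β + 3 / 2) * sample W ω u 1 k)) (Ioo 0 1) := by
    intro θ k hθ
    refine integrableOn_of_bound
      (g := fun _ => (ε ^ 3)⁻¹ * (8 * C ^ 2 * A ^ 2) * (Q + C * Q))
      ((((continuousOn_reg hε.le).mul (continuousOn_rpow_Ioo _)).mul hθ.continuousOn).mul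
        ((hs 0 k).sub (hvac.mul (hs 1 k)))) (integrableOn_const (by simp)) fun u hu => ?_
    have h1 : reg ε u * u ^ (-3 / 2 : ℝ) ≤ (ε ^ 3)⁻¹ :=
      (mul_le_mul_of_nonneg_left (rpow_le_rpow_of_mem hu (by norm_num))
        (reg_nonneg hε.le hu.1)).trans (reg_mul_rpow_le hε hu.1)
    have h2 : 0 ≤ reg ε u * u ^ (-3 / 2 : ℝ) :=
      mul_nonneg (reg_nonneg hε.le hu.1) (Real.rpow_nonneg hu.1.le _)
    rw [abs_mul, abs_of_nonneg (mul_nonneg h2 (hθ u hu).1)]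
    refine mul_le_mul (mul_le_mul h1 (hθ u hu).2.1 (hθ u hu).1 (by positivity)) ?_
      (abs_nonneg _) (by positivity)
    refine (abs_sub _ _).trans (add_le_add (hsQ 0 k u hu) ?_)
    rw [abs_mul, abs_of_nonneg (hW.va u hu).1]
    exact mul_le_mul (hW.va u hu).2.1 (hsQ 1 k u hu) (abs_nonneg _) (by linarith)
  have e : ∀ u ∈ Ioo (0 : ℝ) 1, reg ε u * crossPart β u (sample N ω u) (sample W ω u) =
      reg ε u * u ^ (-3 / 2 : ℝ) * θ₃ u *
        (sample W ω u 0 3 - v 0 u ^ (2 * β + 3 / 2) * sample W ω u 1 3) -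
      reg ε u * u ^ (-3 / 2 : ℝ) * θ₂ u *
        (sample W ω u 0 2 - v 0 u ^ (2 * β + 3 / 2) * sample W ω u 1 2) := by
    intro u hu
    simp only [crossPart, sample_self N ω hu, θ₃, θ₂]
    ring
  refine ⟨((hint θ₃ 3 hθ₃).sub (hint θ₂ 2 hθ₂)).congr_fun (fun u hu => (e u hu).symm)
    measurableSet_Ioo, ?_⟩
  rw [setIntegral_congr_fun measurableSet_Ioo e, integral_sub (hint θ₃ 3 hθ₃) (hint θ₂ 2 hθ₂)]
  have c₂ : ∫ u in Ioo (0 : ℝ) 1, reg ε u * u ^ (-3 / 2 : ℝ) * θ₂ u *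
      (sample W ω u 0 2 - v 0 u ^ (2 * β + 3 / 2) * sample W ω u 1 2) =
      ∫ u in Ioo (0 : ℝ) 1, reg ε u * u ^ (-3 / 2 : ℝ) * θ₂ u *
      (sample W ω u 0 2 - v 0 u ^ (2 * β + 3 / 2) * sample W ω (v 2 u) 0 2) :=
    setIntegral_congr_fun measurableSet_Ioo fun u hu => by
      simp only [sample_one_two W ω hu]
  have c₃ : ∫ u in Ioo (0 : ℝ) 1, reg ε u * u ^ (-3 / 2 : ℝ) * θ₃ u *
      (sample W ω u 0 3 - v 0 u ^ (2 * β + 3 / 2) * sample W ω u 1 3) =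
      ∫ u in Ioo (0 : ℝ) 1, reg ε u * u ^ (-3 / 2 : ℝ) * θ₃ u *
      (sample W ω u 0 3 - v 0 u ^ (2 * β + 3 / 2) * sample W ω (u / (1 + u ^ 2)) 0 3) :=
    setIntegral_congr_fun measurableSet_Ioo fun u hu => by
      simp only [sample_one_three W ω hu]
  rw [c₂, c₃]
  refine (abs_sub _ _).trans ((add_le_add key₃ key₂).trans ?_)
  rw [← mul_add]
  refine mul_le_mul_of_nonneg_left ?_ (by have := hD.1; positivity)
  have hI : ∀ k : Fin 4, IntegrableOn (fun u => u ^ s *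
      (|sample W ω u 0 k| + |sample W ω u 1 k|)) (Ioo 0 1) := by
    intro k
    refine integrableOn_of_bound ((continuousOn_rpow_Ioo s).mul ((hs 0 k).abs.add (hs 1 k).abs))
      ((integrableOn_rpow hE.s_gt).mul_const (Q + Q)) fun u hu => ?_
    have h0 := Real.rpow_nonneg hu.1.le s
    rw [abs_of_nonneg (mul_nonneg h0 (by positivity))]
    exact mul_le_mul_of_nonneg_left (add_le_add (hsQ 0 k u hu) (hsQ 1 k u hu)) h0
  have d₂ : ∫ u in Ioo (0 : ℝ) 1, u ^ s * (|sample W ω u 0 2| + |sample W ω (v 2 u) 0 2|) =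
      ∫ u in Ioo (0 : ℝ) 1, u ^ s * (|sample W ω u 0 2| + |sample W ω u 1 2|) :=
    setIntegral_congr_fun measurableSet_Ioo fun u hu => by
      simp only [sample_one_two W ω hu]
  have d₃ : ∫ u in Ioo (0 : ℝ) 1, u ^ s *
      (|sample W ω u 0 3| + |sample W ω (u / (1 + u ^ 2)) 0 3|) =
      ∫ u in Ioo (0 : ℝ) 1, u ^ s * (|sample W ω u 0 3| + |sample W ω u 1 3|) :=
    setIntegral_congr_fun measurableSet_Ioo fun u hu => by
      simp only [sample_one_three W ω hu]
  rw [d₂, d₃, ← integral_add (hI 3) (hI 2)]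
  refine setIntegral_mono_on ((hI 3).add (hI 2))
    (integrableOn_kernelSum hE.r_pos.le hE.s_gt hWc hQ hω) measurableSet_Ioo fun u hu => ?_
  rw [← mul_add]
  refine mul_le_mul_of_nonneg_left ?_ (Real.rpow_nonneg hu.1.le s)
  have hcw := colWeight_nonneg r hu
  simp only [kernelSum, Fin.sum_univ_four]
  have p0 := mul_nonneg (hcw 0) (abs_nonneg (sample W ω u 0 0))
  have p1 := mul_nonneg (hcw 0) (abs_nonneg (sample W ω u 1 0))
  have p2 := mul_nonneg (hcw 0) (abs_nonneg (sample W ω u 2 0))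
  have p3 := mul_nonneg (hcw 0) (abs_nonneg (sample W ω u 3 0))
  have q0 := mul_nonneg (hcw 1) (abs_nonneg (sample W ω u 0 1))
  have q1 := mul_nonneg (hcw 1) (abs_nonneg (sample W ω u 1 1))
  have q2 := mul_nonneg (hcw 1) (abs_nonneg (sample W ω u 2 1))
  have q3 := mul_nonneg (hcw 1) (abs_nonneg (sample W ω u 3 1))
  have w2 : colWeight r u 2 = 1 := by simp [colWeight]
  have w3 : colWeight r u 3 = 1 := by simp [colWeight]
  rw [w2, w3]
  have := abs_nonneg (sample W ω u 2 2)
  have := abs_nonneg (sample W ω u 3 2)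
  have := abs_nonneg (sample W ω u 2 3)
  have := abs_nonneg (sample W ω u 3 3)
  linarith

end CrossTerms

/-- The total jump rate at `ω`. -/
noncomputable def totalRate (β ε : ℝ) (N : ℝ → ℝ) (ω : ℝ) : ℝ :=
  ∫ u in Ioo (0 : ℝ) 1, ∑ i, reg ε u * jumpRate β N ω u i

/-- The constant `K` of the one-step estimates. -/
def StepConst (β r s K : ℝ) : Prop :=
  0 ≤ K ∧ ∀ (A ε : ℝ) (N M : ℝ → ℝ), GoodFn A N → GoodFn A M → (∀ x : ℝ, 0 < x → 0 ≤ N x) →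
    0 < ε → ∀ ω : ℝ, 0 < ω →
    |collisionReg β ε N ω - collisionReg β ε M ω - ∫ u in Ioo (0 : ℝ) 1, ∑ i,
      reg ε u * jumpRate β N ω u i *
        (sample (fun x => N x - M x) ω u i (partner i) - (N ω - M ω))| ≤
      K * A ^ 2 * ∫ u in Ioo (0 : ℝ) 1, u ^ s * kernelSum r (fun x => N x - M x) ω u

/-- Up to a bounded operator in `W = N - M`, the difference of two collision integrals is the
generator of a jump process applied to `W`. Only `N` has to be nonnegative. -/
lemma exists_stepConst {β C r s : ℝ} (hW : WeightBound β C) (hE : Exponents β r s) :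
    ∃ K : ℝ, StepConst β r s K := by
  obtain ⟨D, hD⟩ := exists_rpow_bound (-3 / 2)
  have hC := hW.one_le
  have hD1 := hD.1
  refine ⟨8 * C ^ 2 * (7 * D + 4 + C) + 8 * C ^ 3, by positivity, ?_⟩
  intro A ε N M hN hM hpos hε ω hω
  have hA := hN.nonneg
  set W : ℝ → ℝ := fun x => N x - M x with hWdef
  have hWc : ContinuousOn W (Ioi 0) := hN.continuousOn.sub hM.continuousOn
  have hQ : ∀ x : ℝ, 0 < x → |W x| ≤ A + A := fun x hx =>
    (abs_sub _ _).trans (add_le_add (hN.bound x hx) (hM.bound x hx))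
  have hs := fun i k => continuousOn_sample_u hWc hω i k
  obtain ⟨hcross, hcross_le⟩ := abs_integral_crossPart_le hW hE hD hN hpos hω hε hWc hQ
  have hdiffi : ∀ i, IntegrableOn (fun u => reg ε u * jumpRate β N ω u i *
      (sample W ω u i (partner i) - (N ω - M ω))) (Ioo 0 1) := fun i =>
    integrableOn_jumpRate_mul hW hE hN hpos hε hω i ((hs _ _).sub continuousOn_const)
      (Q := (A + A) + (A + A)) fun u hu => (abs_sub _ _).trans
        (add_le_add (hQ _ (mul_ratio_pos hω hu i _)) (hQ ω hω))
  have hdiff : IntegrableOn (fun u => ∑ i, reg ε u * jumpRate β N ω u i *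
      (sample W ω u i (partner i) - (N ω - M ω))) (Ioo 0 1) :=
    integrable_finsetSum _ fun i _ => hdiffi i
  have hJ := (integrableOn_reg_mul hW hE hN hω hε.le).sub (integrableOn_reg_mul hW hE hM hω hε.le)
  have e : collisionReg β ε N ω - collisionReg β ε M ω - ∫ u in Ioo (0 : ℝ) 1, ∑ i,
      reg ε u * jumpRate β N ω u i * (sample W ω u i (partner i) - (N ω - M ω)) =
      (∫ u in Ioo (0 : ℝ) 1, reg ε u * crossPart β u (sample N ω u) (sample W ω u)) +
      ∫ u in Ioo (0 : ℝ) 1, (((reg ε u * collisionIntegrand β N ω u -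
        reg ε u * collisionIntegrand β M ω u) - ∑ i, reg ε u * jumpRate β N ω u i *
          (sample W ω u i (partner i) - (N ω - M ω))) -
        reg ε u * crossPart β u (sample N ω u) (sample W ω u)) := by
    have h1 := integral_sub (hJ.sub hdiff) hcross
    have h2 := integral_sub hJ hdiff
    have h3 := integral_sub (integrableOn_reg_mul hW hE hN hω hε.le)
      (integrableOn_reg_mul hW hE hM hω hε.le)
    simp only [Pi.sub_apply] at h1 h2 h3
    rw [h1, h2, h3, collisionReg, collisionReg]
    ring
  have hrem : |∫ u in Ioo (0 : ℝ) 1, (((reg ε u * collisionIntegrand β N ω u -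
        reg ε u * collisionIntegrand β M ω u) - ∑ i, reg ε u * jumpRate β N ω u i *
          (sample W ω u i (partner i) - (N ω - M ω))) -
        reg ε u * crossPart β u (sample N ω u) (sample W ω u))| ≤
      ∫ u in Ioo (0 : ℝ) 1, 8 * C ^ 3 * A ^ 2 * (u ^ s * kernelSum r W ω u) := by
    refine abs_setIntegral_le
      ((integrableOn_kernelSum hE.r_pos.le hE.s_gt hWc hQ hω).const_mul _) fun u hu => ?_
    have h1 := core_sub_remainder_le hW hE hA hu (hN.sampleBound hω hu) (hM.sampleBound hω hu)
    have h2 : sample N ω u - sample M ω u = sample W ω u := rfl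
    rw [h2, diffusive_eq_sum] at h1
    have h3 : ∑ i, reg ε u * jumpRate β N ω u i * (sample W ω u i (partner i) - (N ω - M ω)) =
        reg ε u * ∑ i, jumpRate β N ω u i *
          (sample W ω u i (partner i) - sample W ω u (partner i) (partner i)) := by
      rw [Finset.mul_sum]
      refine Finset.sum_congr rfl fun i _ => ?_
      rw [sample_self W ω hu, mul_assoc]
    rw [h3, collisionIntegrand_eq_core β N ω hu, collisionIntegrand_eq_core β M ω hu,
      ← mul_sub, ← mul_sub, ← mul_sub, abs_mul, abs_of_nonneg (reg_nonneg hε.le hu.1)]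
    exact (mul_le_of_le_one_left (abs_nonneg _) (reg_le_one hε.le hu.1)).trans h1
  rw [e]
  refine (abs_add_le _ _).trans ((add_le_add hcross_le hrem).trans (le_of_eq ?_))
  rw [integral_const_mul]
  ring

/-! ### One explicit time step in the supremum norm -/

section Step

variable {β C r s A K ε τ ω : ℝ} {N M : ℝ → ℝ}

lemma totalRate_le (hW : WeightBound β C) (hE : Exponents β r s) (hN : GoodFn A N)
    (hpos : ∀ x : ℝ, 0 < x → 0 ≤ N x) (hε : 0 < ε) (hω : 0 < ω) :
    totalRate β ε N ω ≤ 4 * (C ^ 3 * A ^ 2 * (ε ^ 3)⁻¹) := by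
  refine (le_abs_self _).trans ((abs_setIntegral_le
    (g := fun _ => 4 * (C ^ 3 * A ^ 2 * (ε ^ 3)⁻¹)) (integrableOn_const (by simp))
    fun u hu => ?_).trans (by simp))
  rw [abs_of_nonneg (Finset.sum_nonneg fun i _ =>
    mul_nonneg (reg_nonneg hε.le hu.1) (jumpRate_nonneg hW hpos hω hu i))]
  refine (Finset.sum_le_sum fun i _ => reg_mul_jumpRate_le hW hE hN hε hω hu i).trans ?_
  simp

lemma integrableOn_reg_mul_jumpRate (hW : WeightBound β C) (hE : Exponents β r s)
    (hN : GoodFn A N) (hpos : ∀ x : ℝ, 0 < x → 0 ≤ N x) (hε : 0 < ε) (hω : 0 < ω) (i : Fin 4) :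
    IntegrableOn (fun u => reg ε u * jumpRate β N ω u i) (Ioo 0 1) := by
  have := integrableOn_jumpRate_mul hW hE hN hpos hε hω i (f := fun _ => 1) (Q := 1)
    continuousOn_const (by simp)
  simpa using this

lemma totalRate_eq_sum (hW : WeightBound β C) (hE : Exponents β r s)
    (hN : GoodFn A N) (hpos : ∀ x : ℝ, 0 < x → 0 ≤ N x) (hε : 0 < ε) (hω : 0 < ω) :
    totalRate β ε N ω = ∑ i, ∫ u in Ioo (0 : ℝ) 1, reg ε u * jumpRate β N ω u i :=
  integral_finsetSum _ fun i _ => integrableOn_reg_mul_jumpRate hW hE hN hpos hε hω i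

/-- After one time step, the difference `W = N - M` is bounded by an average of `|W|` with total
mass `1 + O(τ)`. This is where nonnegativity of `N` and the restriction on `τ` enter. -/
lemma abs_step_le (hW : WeightBound β C) (hE : Exponents β r s) (hK : StepConst β r s K)
    (hN : GoodFn A N) (hM : GoodFn A M) (hpos : ∀ x : ℝ, 0 < x → 0 ≤ N x) (hε : 0 < ε)
    (hω : 0 < ω) (hτ : 0 ≤ τ) (hτΛ : τ * totalRate β ε N ω ≤ 1) :
    |N ω - M ω + τ * (collisionReg β ε N ω - collisionReg β ε M ω)| ≤
      (1 - τ * totalRate β ε N ω) * |N ω - M ω| +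
      τ * (∑ i, ∫ u in Ioo (0 : ℝ) 1, reg ε u * jumpRate β N ω u i *
        |sample (fun x => N x - M x) ω u i (partner i)|) +
      τ * (K * A ^ 2 * ∫ u in Ioo (0 : ℝ) 1, u ^ s * kernelSum r (fun x => N x - M x) ω u) := by
  have hrem := hK.2 A ε N M hN hM hpos hε ω hω
  set W : ℝ → ℝ := fun x => N x - M x with hWdef
  have hWc : ContinuousOn W (Ioi 0) := hN.continuousOn.sub hM.continuousOn
  have hQ : ∀ x : ℝ, 0 < x → |W x| ≤ A + A := fun x hx =>
    (abs_sub _ _).trans (add_le_add (hN.bound x hx) (hM.bound x hx))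
  have hs := fun i k => continuousOn_sample_u hWc hω i k
  have hsi : ∀ i, IntegrableOn (fun u => reg ε u * jumpRate β N ω u i *
      sample W ω u i (partner i)) (Ioo 0 1) := fun i =>
    integrableOn_jumpRate_mul hW hE hN hpos hε hω i (hs _ _) (Q := A + A)
      fun u hu => hQ _ (mul_ratio_pos hω hu i _)
  have hci : ∀ i, IntegrableOn (fun u => reg ε u * jumpRate β N ω u i * W ω) (Ioo 0 1) :=
    fun i => (integrableOn_reg_mul_jumpRate hW hE hN hpos hε hω i).mul_const _
  set Λ := totalRate β ε N ω with hΛ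
  have e1 : ∫ u in Ioo (0 : ℝ) 1, ∑ i,
      reg ε u * jumpRate β N ω u i * (sample W ω u i (partner i) - (N ω - M ω)) =
      (∑ i, ∫ u in Ioo (0 : ℝ) 1, reg ε u * jumpRate β N ω u i * sample W ω u i (partner i)) -
        Λ * W ω := by
    have h := integral_finsetSum Finset.univ fun i _ => (hsi i).sub (hci i)
    simp only [Pi.sub_apply] at h
    rw [hΛ, totalRate_eq_sum hW hE hN hpos hε hω, Finset.sum_mul, ← Finset.sum_sub_distrib]
    refine (integral_congr_ae (ae_of_all _ fun u => Finset.sum_congr rfl fun i _ =>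
      mul_sub _ _ (W ω))).trans (h.trans (Finset.sum_congr rfl fun i _ => ?_))
    rw [← integral_mul_const, ← integral_sub (hsi i) (hci i)]
  rw [e1] at hrem
  set I := ∑ i, ∫ u in Ioo (0 : ℝ) 1, reg ε u * jumpRate β N ω u i * sample W ω u i (partner i)
  have hI : |I| ≤ ∑ i, ∫ u in Ioo (0 : ℝ) 1, reg ε u * jumpRate β N ω u i *
      |sample W ω u i (partner i)| := by
    refine (Finset.abs_sum_le_sum_abs _ _).trans (Finset.sum_le_sum fun i _ => ?_)
    refine abs_setIntegral_le (integrableOn_jumpRate_mul hW hE hN hpos hε hω i (hs _ _).abs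
      (Q := A + A) fun u hu => by rw [abs_abs]; exact hQ _ (mul_ratio_pos hω hu i _)) fun u hu => ?_
    rw [abs_mul, abs_of_nonneg (mul_nonneg (reg_nonneg hε.le hu.1)
      (jumpRate_nonneg hW hpos hω hu i))]
  set R := collisionReg β ε N ω - collisionReg β ε M ω - (I - Λ * W ω) with hR
  have e2 : N ω - M ω + τ * (collisionReg β ε N ω - collisionReg β ε M ω) =
      (1 - τ * Λ) * W ω + τ * I + τ * R := by
    simp only [hR, hWdef]; ring
  rw [e2]
  refine (abs_add_le _ _).trans (add_le_add ((abs_add_le _ _).trans (add_le_add ?_ ?_)) ?_)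
  · rw [abs_mul, abs_of_nonneg (by linarith)]
  · rw [abs_mul, abs_of_nonneg hτ]
    exact mul_le_mul_of_nonneg_left hI hτ
  · rw [abs_mul, abs_of_nonneg hτ]
    exact mul_le_mul_of_nonneg_left hrem hτ

lemma mul_totalRate_le_one (hW : WeightBound β C) (hE : Exponents β r s) (hN : GoodFn A N)
    (hpos : ∀ x : ℝ, 0 < x → 0 ≤ N x) (hε : 0 < ε) (hω : 0 < ω) (hτ : 0 ≤ τ)
    (hτε : τ * (4 * (C ^ 3 * A ^ 2 * (ε ^ 3)⁻¹)) ≤ 1) : τ * totalRate β ε N ω ≤ 1 :=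
  (mul_le_mul_of_nonneg_left (totalRate_le hW hE hN hpos hε hω) hτ).trans hτε

/-- Stability of one time step in the supremum norm, uniformly in `ε`. -/
lemma step_sup_le (hW : WeightBound β C) (hE : Exponents β r s) (hK : StepConst β r s K)
    (hN : GoodFn A N) (hM : GoodFn A M) (hpos : ∀ x : ℝ, 0 < x → 0 ≤ N x) (hε : 0 < ε)
    (hτ : 0 ≤ τ) (hτε : τ * (4 * (C ^ 3 * A ^ 2 * (ε ^ 3)⁻¹)) ≤ 1) {q : ℝ}
    (hq : ∀ x : ℝ, 0 < x → |N x - M x| ≤ q) (hω : 0 < ω) :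
    |N ω - M ω + τ * (collisionReg β ε N ω - collisionReg β ε M ω)| ≤
      (1 + 16 * K * A ^ 2 * massS s * τ) * q := by
  have hΛ := mul_totalRate_le_one hW hE hN hpos hε hω hτ hτε
  refine (abs_step_le hW hE hK hN hM hpos hε hω hτ hΛ).trans ?_
  set W : ℝ → ℝ := fun x => N x - M x with hWdef
  have hWc : ContinuousOn W (Ioi 0) := hN.continuousOn.sub hM.continuousOn
  have h1 : ∑ i, ∫ u in Ioo (0 : ℝ) 1, reg ε u * jumpRate β N ω u i *
      |sample W ω u i (partner i)| ≤ totalRate β ε N ω * q := by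
    rw [totalRate_eq_sum hW hE hN hpos hε hω, Finset.sum_mul]
    refine Finset.sum_le_sum fun i _ => ?_
    rw [← integral_mul_const]
    refine setIntegral_mono_on (integrableOn_jumpRate_mul hW hE hN hpos hε hω i
      (continuousOn_sample_u hWc hω i _).abs (Q := q) fun u hu => ?_)
      ((integrableOn_reg_mul_jumpRate hW hE hN hpos hε hω i).mul_const _) measurableSet_Ioo
      fun u hu => ?_
    · rw [abs_abs]; exact hq _ (mul_ratio_pos hω hu i _)
    · exact mul_le_mul_of_nonneg_left (hq _ (mul_ratio_pos hω hu i _))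
        (mul_nonneg (reg_nonneg hε.le hu.1) (jumpRate_nonneg hW hpos hω hu i))
  have h2 : ∫ u in Ioo (0 : ℝ) 1, u ^ s * kernelSum r W ω u ≤ massS s * (16 * q) := by
    rw [massS, ← integral_mul_const]
    refine setIntegral_mono_on (integrableOn_kernelSum hE.r_pos.le hE.s_gt hWc hq hω)
      ((integrableOn_rpow hE.s_gt).mul_const _) measurableSet_Ioo fun u hu => ?_
    exact mul_le_mul_of_nonneg_left (kernelSum_le hE.r_pos.le hq hω hu)
      (Real.rpow_nonneg hu.1.le _)
  have h3 : (1 - τ * totalRate β ε N ω) * |N ω - M ω| ≤ (1 - τ * totalRate β ε N ω) * q :=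
    mul_le_mul_of_nonneg_left (hq ω hω) (by linarith)
  have h4 := mul_le_mul_of_nonneg_left h1 hτ
  have h5 := mul_le_mul_of_nonneg_left
    (mul_le_mul_of_nonneg_left h2 (mul_nonneg hK.1 (sq_nonneg A))) hτ
  linarith

end Step

/-! ### One explicit time step in `L^p` -/

/-- Jensen's inequality for the `p`-th power and an average of total mass at most `Θ`. -/
lemma pow_le_of_le_average {ι : Type*} [Fintype ι] {p : ℕ} (hp : 1 ≤ p) {V c x Θ : ℝ}
    {w X : ι → ℝ → ℝ} (hV : 0 ≤ V) (hc : 0 ≤ c) (hx : 0 ≤ x) (hΘ : 0 < Θ)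
    (hw : ∀ i, ∀ u ∈ Ioo (0 : ℝ) 1, 0 ≤ w i u) (hX : ∀ i, ∀ u ∈ Ioo (0 : ℝ) 1, 0 ≤ X i u)
    (hwi : ∀ i, IntegrableOn (w i) (Ioo 0 1))
    (hwX : ∀ i, IntegrableOn (fun u => w i u * X i u) (Ioo 0 1))
    (hwXp : ∀ i, IntegrableOn (fun u => w i u * X i u ^ p) (Ioo 0 1))
    (hle : V ≤ c * x + ∑ i, ∫ u in Ioo (0 : ℝ) 1, w i u * X i u)
    (hmass : c + ∑ i, ∫ u in Ioo (0 : ℝ) 1, w i u ≤ Θ) :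
    V ^ p ≤ Θ ^ (p - 1) * (c * x ^ p + ∑ i, ∫ u in Ioo (0 : ℝ) 1, w i u * X i u ^ p) := by
  obtain ⟨m, rfl⟩ : ∃ m, p = m + 1 := ⟨p - 1, by omega⟩
  rw [Nat.add_sub_cancel]
  set R := V / Θ with hR
  have hR0 : 0 ≤ R := by positivity
  have hVR : V = Θ * R := by rw [hR]; field_simp
  -- Young's inequality
  have young : ∀ y : ℝ, 0 ≤ y → (m + 1) * (y * R ^ m) ≤ y ^ (m + 1) + m * R ^ (m + 1) := by
    intro y hy
    have hg := Real.geom_mean_le_arith_mean2_weighted (w₁ := 1 / ((m : ℝ) + 1))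
      (w₂ := (m : ℝ) / (m + 1)) (p₁ := y ^ (m + 1)) (p₂ := R ^ (m + 1)) (by positivity)
      (by positivity) (by positivity) (by positivity) (by field_simp; ring)
    have e1 : (y ^ (m + 1)) ^ (1 / ((m : ℝ) + 1)) = y := by
      rw [← Real.rpow_natCast, ← Real.rpow_mul hy]
      push_cast
      rw [mul_one_div_cancel (by positivity), Real.rpow_one]
    have e2 : (R ^ (m + 1)) ^ ((m : ℝ) / (m + 1)) = R ^ m := by
      rw [← Real.rpow_natCast, ← Real.rpow_mul hR0, ← Real.rpow_natCast]
      congr 1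
      push_cast
      field_simp
    rw [e1, e2] at hg
    have h3 := mul_le_mul_of_nonneg_left hg (show (0 : ℝ) ≤ m + 1 by positivity)
    refine h3.trans (le_of_eq ?_)
    field_simp
  have hint : ∀ i, (m + 1) * (R ^ m * ∫ u in Ioo (0 : ℝ) 1, w i u * X i u) ≤
      (∫ u in Ioo (0 : ℝ) 1, w i u * X i u ^ (m + 1)) +
        m * R ^ (m + 1) * ∫ u in Ioo (0 : ℝ) 1, w i u := by
    intro i
    rw [← integral_const_mul, ← integral_const_mul, ← integral_const_mul,
      ← integral_add (hwXp i) ((hwi i).const_mul _)]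
    refine setIntegral_mono_on (((hwX i).const_mul _).const_mul _)
      ((hwXp i).add ((hwi i).const_mul _)) measurableSet_Ioo fun u hu => ?_
    have := mul_le_mul_of_nonneg_left (young _ (hX i u hu)) (hw i u hu)
    linarith
  have hsum := Finset.sum_le_sum fun i (_ : i ∈ Finset.univ) => hint i
  rw [Finset.sum_add_distrib, ← Finset.mul_sum, ← Finset.mul_sum, ← Finset.mul_sum] at hsum
  have h0 := mul_le_mul_of_nonneg_left (young x hx) hc
  set S1 := ∑ i, ∫ u in Ioo (0 : ℝ) 1, w i u * X i u
  set S2 := ∑ i, ∫ u in Ioo (0 : ℝ) 1, w i u * X i u ^ (m + 1)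
  set S0 := ∑ i, ∫ u in Ioo (0 : ℝ) 1, w i u
  have hRm : 0 ≤ R ^ m := by positivity
  have hRm1 : 0 ≤ (m : ℝ) * R ^ (m + 1) := by positivity
  have h1 := mul_le_mul_of_nonneg_left hle (show 0 ≤ ((m : ℝ) + 1) * R ^ m by positivity)
  have h2 := mul_le_mul_of_nonneg_left hmass hRm1
  have h3 : ((m : ℝ) + 1) * R ^ m * V = (m + 1) * (Θ * R ^ (m + 1)) := by rw [hVR]; ring
  have h4 : Θ * R ^ (m + 1) ≤ c * x ^ (m + 1) + S2 := by
    rw [h3] at h1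
    nlinarith
  calc V ^ (m + 1) = Θ ^ m * (Θ * R ^ (m + 1)) := by rw [hVR]; ring
    _ ≤ _ := mul_le_mul_of_nonneg_left h4 (by positivity)

/-- The integral `∫ |W|^p dω` over the half-line, as an extended nonnegative number. -/
noncomputable def energy (p : ℕ) (W : ℝ → ℝ) : ℝ≥0∞ :=
  ∫⁻ ω in Ioi (0 : ℝ), ENNReal.ofReal (|W ω| ^ p)

lemma lintegral_Ioi_comp_mul (f : ℝ → ℝ≥0∞) {a : ℝ} (ha : 0 < a) :
    ∫⁻ ω in Ioi (0 : ℝ), f (ω * a) = ENNReal.ofReal a⁻¹ * ∫⁻ ω in Ioi (0 : ℝ), f ω := by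
  have hm : MeasurableEmbedding (fun x : ℝ => x * a) :=
    (Homeomorph.mulRight₀ a ha.ne').measurableEmbedding
  have hpre : (fun x : ℝ => x * a) ⁻¹' Ioi 0 = Ioi 0 := by
    ext x; simp [mul_pos_iff_of_pos_right ha]
  have h1 : ∫⁻ ω in Ioi (0 : ℝ), f (ω * a) =
      ∫⁻ y, f y ∂(Measure.map (fun x : ℝ => x * a) (volume.restrict (Ioi 0))) :=
    (hm.lintegral_map f).symm
  rw [h1]
  conv_lhs => rw [← hpre]
  rw [← hm.restrict_map, Real.map_volume_mul_right ha.ne', Measure.restrict_smul,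
    lintegral_smul_measure, abs_of_pos (inv_pos.2 ha), smul_eq_mul]

/-- The coefficients of a jump and of the reversed jump, the former with the Jacobian of the dilation,
differ by `O(u²)` for the pair `v₁, v₂` and by `O(u)` for the pair `v₃, v₄`. -/
lemma exists_symmConst (β : ℝ) : ∃ D : ℝ, 0 ≤ D ∧
    ∀ u ∈ Ioo (0 : ℝ) 1,
      (v 0 u)⁻¹ - v 0 u ^ (2 * β + 3 / 2) * v 0 u ^ (2 * β - 1 / 2) ≤ D * u ^ 2 ∧
      v 0 u * (v 0 u ^ (2 * β + 3 / 2) * v 0 u ^ (2 * β - 1 / 2)) - 1 ≤ D * u ^ 2 ∧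
      kap u ^ (2 * β + 3 / 2) * kap u ^ (2 * β - 1 / 2) / (1 + u) -
        v 0 u ^ (2 * β + 3 / 2) * v 0 u ^ (2 * β - 1 / 2) ≤ D * u ∧
      (1 + u) * (v 0 u ^ (2 * β + 3 / 2) * v 0 u ^ (2 * β - 1 / 2)) -
        kap u ^ (2 * β + 3 / 2) * kap u ^ (2 * β - 1 / 2) ≤ D * u := by
  obtain ⟨D, hD, h⟩ := exists_rpow_bound (4 * β + 2)
  refine ⟨3 * D, by linarith, fun u hu => ?_⟩
  have h0 := hu.1
  have hv := v_zero_mem hu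
  have hvp := v_zero_pos hu
  have hk := kap_mem hu
  have hkp := kap_pos hu
  obtain ⟨-, -, hv1⟩ := h _ (v_zero_mem' hu)
  have h1 := hv1 1 (by norm_num)
  rw [Real.one_rpow] at h1
  have h2 := hv1 _ hk
  set X := v 0 u ^ (4 * β + 2)
  set Y := kap u ^ (4 * β + 2)
  have eX : v 0 u ^ (2 * β + 3 / 2) * v 0 u ^ (2 * β - 1 / 2) = X * (v 0 u)⁻¹ := by
    rw [← Real.rpow_add hvp, ← Real.rpow_neg_one, ← Real.rpow_add hvp]; congr 1; ring
  have eY : kap u ^ (2 * β + 3 / 2) * kap u ^ (2 * β - 1 / 2) = Y * (kap u)⁻¹ := by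
    rw [← Real.rpow_add hkp, ← Real.rpow_neg_one, ← Real.rpow_add hkp]; congr 1; ring
  have b1 : |X - 1| ≤ D * u ^ 2 :=
    h1.trans (mul_le_mul_of_nonneg_left (abs_v_zero_sub_one_le hu) (by linarith))
  have b2 : |X - Y| ≤ D * u := by
    refine h2.trans (mul_le_mul_of_nonneg_left ?_ (by linarith))
    have e : v 0 u - kap u = u * kap u := by rw [v_zero]; ring
    rw [e, abs_of_nonneg (by positivity)]
    exact mul_le_of_le_one_right h0.le hk.2
  have i1 : (v 0 u)⁻¹ ≤ 3 := by
    rw [inv_le_comm₀ hvp (by norm_num)]; linarith [hv.1]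
  have i2 : (kap u)⁻¹ ≤ 3 := by
    rw [inv_le_comm₀ hkp (by norm_num)]; linarith [hk.1]
  have hm : ∀ {x y z w : ℝ}, |x - y| ≤ w → 0 ≤ z → z ≤ 3 → (y - x) * z ≤ 3 * w := by
    intro x y z w h hz hz3
    have h1 : y - x ≤ w := by linarith [(abs_le.1 h).1]
    have h2 : 0 ≤ w := (abs_nonneg _).trans h
    nlinarith
  rw [eX, eY]
  refine ⟨?_, ?_, ?_, ?_⟩
  · have := hm b1 (inv_pos.2 hvp).le i1
    linarith
  · have e : v 0 u * (X * (v 0 u)⁻¹) = X := by field_simp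
    have := (abs_le.1 b1).2
    rw [e]
    nlinarith [mul_nonneg (show 0 ≤ D by linarith) (sq_nonneg u)]
  · have e : Y * (kap u)⁻¹ / (1 + u) = Y * (v 0 u)⁻¹ := by
      rw [v_zero]; field_simp
    have := hm b2 (inv_pos.2 hvp).le i1
    rw [e]
    linarith
  · have e : (1 + u) * (X * (v 0 u)⁻¹) = X * (kap u)⁻¹ := by
      rw [v_zero]; field_simp
    rw [abs_sub_comm] at b2
    have := hm b2 (inv_pos.2 hkp).le i2
    rw [e]
    linarith

/-- The constant `D` in the approximate symmetry of the jump rates: the rate of the jumps arriving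
at `x`, as seen after the substitution that makes `x` the variable of integration, exceeds the rate
of the reversed jumps, which leave from `x`, by at most `D A² u^s`. -/
def SymmConst (β s D : ℝ) : Prop :=
  0 ≤ D ∧ ∀ (A : ℝ) (N : ℝ → ℝ), GoodFn A N → (∀ x : ℝ, 0 < x → 0 ≤ N x) →
    ∀ x : ℝ, 0 < x → ∀ u ∈ Ioo (0 : ℝ) 1, ∀ i : Fin 4,
      (v i u / v (partner i) u)⁻¹ * jumpRate β N (x / (v i u / v (partner i) u)) u i ≤
        jumpRate β N x u (partner i) + D * A ^ 2 * u ^ s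

/-- Jumps `i` and `partner i` are inverse to each other and have the same two values of `N` in their
rates, so only the weights have to be compared. -/
lemma exists_jumpRate_symm {β C r s : ℝ} (hW : WeightBound β C) (hE : Exponents β r s) :
    ∃ D : ℝ, SymmConst β s D := by
  obtain ⟨D, hD, h⟩ := exists_symmConst β
  have hC := hW.one_le
  refine ⟨C * D, by positivity, fun A N hN hpos x hx u hu i => ?_⟩
  have h0 := hu.1
  obtain ⟨d1, d2, d3, d4⟩ := h u hu
  obtain ⟨m0, m1, -⟩ := hW.mu u hu
  have hb := (hN.sampleBound hx hu).bound
  have hA := hN.nonneg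
  have hn : ∀ i k, 0 ≤ sample N x u i k := fun i k => hpos _ (mul_ratio_pos hx hu i k)
  have hv := fun i => (v_pos hu i).ne'
  have hs : ∀ i j k, sample N (x / (v i u / v k u)) u j k = sample N x u j i := by
    intro i j k
    have := hv i; have := hv k
    unfold sample
    congr 1
    field_simp
  have hxy : ∀ {i j k : Fin 4}, 0 ≤ sample N x u i k * sample N x u j k ∧
      sample N x u i k * sample N x u j k ≤ A ^ 2 := by
    intro i j k
    refine ⟨mul_nonneg (hn _ _) (hn _ _), ?_⟩
    rw [sq]
    exact mul_le_mul ((le_abs_self _).trans (hb _ _)) ((le_abs_self _).trans (hb _ _)) (hn _ _) hA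
  -- a product of a power of `u`, a weight difference and two samples
  have hmain : ∀ {p L d y : ℝ}, d ≤ D * L → 0 ≤ L → u ^ p * L ≤ u ^ s → 0 ≤ y → y ≤ A ^ 2 →
      mu β u * (u ^ p * d * y) ≤ C * D * A ^ 2 * u ^ s := by
    intro p L d y hd hL hp hy0 hy
    have hup := Real.rpow_nonneg h0.le p
    have hus := Real.rpow_nonneg h0.le s
    have h1 : u ^ p * d ≤ D * u ^ s := by
      calc u ^ p * d ≤ u ^ p * (D * L) := mul_le_mul_of_nonneg_left hd hup
        _ = D * (u ^ p * L) := by ring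
        _ ≤ _ := mul_le_mul_of_nonneg_left hp hD
    have h2 : u ^ p * d * y ≤ D * u ^ s * A ^ 2 :=
      (mul_le_mul_of_nonneg_right h1 hy0).trans (mul_le_mul_of_nonneg_left hy (by positivity))
    calc mu β u * (u ^ p * d * y) ≤ mu β u * (D * u ^ s * A ^ 2) :=
          mul_le_mul_of_nonneg_left h2 m0
      _ ≤ C * (D * u ^ s * A ^ 2) := mul_le_mul_of_nonneg_right m1 (by positivity)
      _ = _ := by ring
  have e1 : u ^ (-2 * β - 1) * u ^ 2 ≤ u ^ s := by
    rw [← Real.rpow_natCast, ← Real.rpow_add h0]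
    exact rpow_le_rpow_of_mem hu (by push_cast; linarith [hE.s_le₁, hE.r_pos])
  have e4 : u ^ (2 * β) * u ≤ u ^ s := by
    rw [← Real.rpow_add_one h0.ne']
    exact rpow_le_rpow_of_mem hu hE.s_le₂
  have hσ : v 2 u / v 3 u = 1 + u := by
    have := (kap_pos hu).ne'
    rw [v_two, v_three, v_zero]; field_simp
  fin_cases i
  · have := hmain d1 (sq_nonneg u) e1 (hxy (i := 2) (j := 3) (k := 0)).1 hxy.2
    have a := hs 0 2 1
    have b := hs 0 3 1
    rw [v_one, div_one] at a b
    simp only [jumpRate, partner, Fin.zero_eta, Fin.isValue, Matrix.cons_val, v_one, div_one, a, b]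
    linarith
  · have := hmain d2 (sq_nonneg u) e1 (hxy (i := 2) (j := 3) (k := 1)).1 hxy.2
    have a := hs 1 2 0
    have b := hs 1 3 0
    simp only [jumpRate, partner, Fin.mk_one, Fin.isValue, Matrix.cons_val, a, b]
    rw [v_one, inv_div, div_one]
    linarith
  · have := hmain d3 h0.le e4 (hxy (i := 0) (j := 1) (k := 2)).1 hxy.2
    have a := hs 2 0 3
    have b := hs 2 1 3
    simp only [jumpRate, partner, Fin.reduceFinMk, Fin.isValue, Matrix.cons_val, a, b]
    rw [hσ]
    rw [div_eq_mul_inv] at this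
    linarith
  · have := hmain d4 h0.le e4 (hxy (i := 0) (j := 1) (k := 3)).1 hxy.2
    have a := hs 3 0 2
    have b := hs 3 1 2
    simp only [jumpRate, partner, Fin.reduceFinMk, Fin.isValue, Matrix.cons_val, a, b]
    rw [inv_div, hσ]
    linarith

lemma aemeasurable_ofReal_of_continuousOn {g : ℝ → ℝ → ℝ}
    (hg : ContinuousOn (fun z : ℝ × ℝ => g z.1 z.2) (Ioi 0 ×ˢ Ioo 0 1)) :
    AEMeasurable (fun z : ℝ × ℝ => ENNReal.ofReal (g z.1 z.2))
      ((volume.restrict (Ioi 0)).prod (volume.restrict (Ioo 0 1))) := by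
  rw [Measure.prod_restrict]
  exact (hg.aemeasurable (measurableSet_Ioi.prod measurableSet_Ioo)).ennreal_ofReal

section Energy

variable {β C r s K A ε D τ : ℝ} {N M W : ℝ → ℝ} {p : ℕ}

lemma aemeasurable_sample_pow (hW : ContinuousOn W (Ioi 0)) {g : ℝ → ℝ → ℝ}
    (hg : ContinuousOn (fun z : ℝ × ℝ => g z.1 z.2) (Ioi 0 ×ˢ Ioo 0 1)) (i k : Fin 4) :
    AEMeasurable (fun z : ℝ × ℝ => ENNReal.ofReal (g z.1 z.2 * |sample W z.1 z.2 i k| ^ p))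
      ((volume.restrict (Ioi 0)).prod (volume.restrict (Ioo 0 1))) :=
  aemeasurable_ofReal_of_continuousOn (g := fun ω u => g ω u * |sample W ω u i k| ^ p)
    (hg.mul ((continuousOn_sample hW continuousOn_snd (fun _ h => h.2) continuousOn_fst
      (fun _ h => h.1) i k).abs.pow p))

lemma ofReal_massS (hs : -1 < s) {c : ℝ} (hc : 0 ≤ c) :
    ∫⁻ u in Ioo (0 : ℝ) 1, ENNReal.ofReal (c * u ^ s) = ENNReal.ofReal (c * massS s) := by
  rw [massS, ← integral_const_mul, ofReal_integral_eq_lintegral_ofReal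
    ((integrableOn_rpow hs).const_mul c)]
  exact (ae_restrict_iff' measurableSet_Ioo).2 (Filter.Eventually.of_forall fun u hu =>
    mul_nonneg hc (Real.rpow_nonneg hu.1.le _))

/-- The exponent `r = 1/p` makes up for the Jacobian of the dilation. -/
lemma colWeight_pow_mul_inv_le (hrp : r * p = 1) {u : ℝ} (hu : u ∈ Ioo (0 : ℝ) 1)
    (i k : Fin 4) : colWeight r u k ^ p * (v i u / v k u)⁻¹ ≤ 3 := by
  have h := ratio_lower hu i k
  have h0 : 0 < v i u / v k u := div_pos (v_pos hu i) (v_pos hu k)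
  have hu0 := hu.1
  rw [← div_eq_mul_inv, div_le_iff₀ h0]
  unfold colWeight
  split_ifs at h ⊢ with hk
  · rw [← Real.rpow_natCast, ← Real.rpow_mul hu0.le, hrp, Real.rpow_one]
    linarith
  · rw [one_pow]; linarith

/-- The kernel terms, raised to the power `p`, are bounded in `L¹(dω)` by the energy of `W`. -/
lemma kernel_energy_le (hrp : r * p = 1) (hs : -1 < s)
    (hW : ContinuousOn W (Ioi 0)) (i k : Fin 4) :
    ∫⁻ ω in Ioi (0 : ℝ), ∫⁻ u in Ioo (0 : ℝ) 1,
      ENNReal.ofReal (u ^ s * colWeight r u k ^ p * |sample W ω u i k| ^ p) ≤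
        ENNReal.ofReal (3 * massS s) * energy p W := by
  rw [lintegral_lintegral_swap]
  swap
  · refine aemeasurable_sample_pow (g := fun _ u => u ^ s * colWeight r u k ^ p) hW ?_ i k
    refine ContinuousOn.comp (g := fun u => u ^ s * colWeight r u k ^ p) (t := Ioo 0 1)
      ((continuousOn_rpow_Ioo s).mul ((continuousOn_colWeight r k).pow p)) continuousOn_snd
      fun _ h => h.2
  rw [← ofReal_massS hs (by norm_num), ← lintegral_mul_const'' _ ?_]
  swap
  · exact ((continuousOn_rpow_Ioo s).const_mul 3).aemeasurable measurableSet_Ioo |>.ennreal_ofReal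
  refine setLIntegral_mono' measurableSet_Ioo fun u hu => ?_
  have h0 := Real.rpow_nonneg hu.1.le s
  have h1 := pow_nonneg (colWeight_nonneg r hu k) p
  have h2 : 0 < v i u / v k u := div_pos (v_pos hu i) (v_pos hu k)
  calc ∫⁻ ω in Ioi (0 : ℝ),
        ENNReal.ofReal (u ^ s * colWeight r u k ^ p * |sample W ω u i k| ^ p)
      = ∫⁻ ω in Ioi (0 : ℝ), ENNReal.ofReal (u ^ s * colWeight r u k ^ p) *
          ENNReal.ofReal (|W (ω * (v i u / v k u))| ^ p) := by
        refine lintegral_congr fun ω => ?_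
        rw [ENNReal.ofReal_mul (mul_nonneg h0 h1), sample, mul_div_assoc]
    _ = ENNReal.ofReal (u ^ s * colWeight r u k ^ p) *
          (ENNReal.ofReal (v i u / v k u)⁻¹ * energy p W) := by
        rw [lintegral_const_mul' _ _ ENNReal.ofReal_ne_top,
          lintegral_Ioi_comp_mul (fun x => ENNReal.ofReal (|W x| ^ p)) h2, energy]
    _ ≤ _ := by
        rw [← mul_assoc, ← ENNReal.ofReal_mul (mul_nonneg h0 h1)]
        gcongr ENNReal.ofReal ?_ * _
        have := mul_le_mul_of_nonneg_left (colWeight_pow_mul_inv_le hrp hu i k) h0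
        linarith

/-- The gain term of the jumps of type `i` is at most the loss term of the jumps of type `partner i`,
up to the defect of symmetry. In `step_energy_le` the latter cancels against a part of
`-τ totalRate`, so that the bound does not depend on `ε`. -/
lemma jump_energy_le (hWB : WeightBound β C) (hE : Exponents β r s) (hD : SymmConst β s D)
    (hN : GoodFn A N) (hpos : ∀ x : ℝ, 0 < x → 0 ≤ N x) (hε : 0 < ε)
    (hW : ContinuousOn W (Ioi 0)) (i : Fin 4) :
    ∫⁻ ω in Ioi (0 : ℝ), ∫⁻ u in Ioo (0 : ℝ) 1,
      ENNReal.ofReal (reg ε u * jumpRate β N ω u i * |sample W ω u i (partner i)| ^ p) ≤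
        (∫⁻ x in Ioi (0 : ℝ), ENNReal.ofReal
          ((∫ u in Ioo (0 : ℝ) 1, reg ε u * jumpRate β N x u (partner i)) * |W x| ^ p)) +
        ENNReal.ofReal (D * A ^ 2 * massS s) * energy p W := by
  have hDA : 0 ≤ D * A ^ 2 := mul_nonneg hD.1 (sq_nonneg A)
  have hJ : ∀ i, ContinuousOn (fun z : ℝ × ℝ => reg ε z.2 * jumpRate β N z.1 z.2 i)
      (Ioi 0 ×ˢ Ioo 0 1) := fun i =>
    ((continuousOn_reg hε.le).comp continuousOn_snd fun _ h => h.2).mul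
      (continuousOn_jumpRate β hN.continuousOn continuousOn_snd (fun _ h => h.2) continuousOn_fst
        (fun _ h => h.1) i)
  have hWm : ContinuousOn (fun z : ℝ × ℝ => |W z.1| ^ p) (Ioi 0 ×ˢ Ioo 0 1) :=
    (hW.comp continuousOn_fst fun _ h => h.1).abs.pow p
  have hus : ContinuousOn (fun z : ℝ × ℝ => D * A ^ 2 * z.2 ^ s) (Ioi 0 ×ˢ Ioo 0 1) :=
    ((continuousOn_rpow_Ioo s).comp continuousOn_snd fun _ h => h.2).const_mul _
  rw [lintegral_lintegral_swap (aemeasurable_sample_pow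
    (g := fun ω u => reg ε u * jumpRate β N ω u i) hW (hJ i) i _)]
  have key : ∀ u ∈ Ioo (0 : ℝ) 1, ∫⁻ ω in Ioi (0 : ℝ),
      ENNReal.ofReal (reg ε u * jumpRate β N ω u i * |sample W ω u i (partner i)| ^ p) ≤
      ∫⁻ x in Ioi (0 : ℝ), ENNReal.ofReal
        ((reg ε u * jumpRate β N x u (partner i) + D * A ^ 2 * u ^ s) * |W x| ^ p) := by
    intro u hu
    have h2 : 0 < v i u / v (partner i) u := div_pos (v_pos hu i) (v_pos hu _)
    set ρ := v i u / v (partner i) u with hρ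
    have e : ∀ ω, ENNReal.ofReal
        (reg ε u * jumpRate β N ω u i * |sample W ω u i (partner i)| ^ p) =
        (fun x => ENNReal.ofReal (reg ε u * jumpRate β N (x / ρ) u i * |W x| ^ p)) (ω * ρ) := by
      intro ω
      beta_reduce
      rw [mul_div_cancel_right₀ _ h2.ne', sample, mul_div_assoc]
    rw [lintegral_congr e, lintegral_Ioi_comp_mul
      (fun x => ENNReal.ofReal (reg ε u * jumpRate β N (x / ρ) u i * |W x| ^ p)) h2,
      ← lintegral_const_mul' _ _ ENNReal.ofReal_ne_top]
    refine setLIntegral_mono' measurableSet_Ioi fun x hx => ?_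
    rw [← ENNReal.ofReal_mul (inv_pos.2 h2).le]
    refine ENNReal.ofReal_le_ofReal ?_
    rw [← mul_assoc]
    refine mul_le_mul_of_nonneg_right ?_ (by positivity)
    have h3 := hD.2 A N hN hpos x hx u hu i
    rw [← hρ] at h3
    have g0 := reg_nonneg hε.le hu.1
    have g1 := reg_le_one hε.le hu.1
    have h4 := mul_le_mul_of_nonneg_left h3 g0
    have h5 : reg ε u * (D * A ^ 2 * u ^ s) ≤ D * A ^ 2 * u ^ s :=
      mul_le_of_le_one_left (mul_nonneg hDA (Real.rpow_nonneg hu.1.le _)) g1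
    linarith
  refine (setLIntegral_mono' measurableSet_Ioo key).trans ?_
  rw [← lintegral_lintegral_swap (f := fun x u => ENNReal.ofReal
    ((reg ε u * jumpRate β N x u (partner i) + D * A ^ 2 * u ^ s) * |W x| ^ p))]
  swap
  · exact aemeasurable_ofReal_of_continuousOn
      (g := fun x u => (reg ε u * jumpRate β N x u (partner i) + D * A ^ 2 * u ^ s) * |W x| ^ p)
      (((hJ _).add hus).mul hWm)
  rw [energy, ← lintegral_const_mul' _ _ ENNReal.ofReal_ne_top, ← lintegral_add_right']
  swap
  · exact (((hW.abs.pow p).aemeasurable measurableSet_Ioi).ennreal_ofReal).const_mul _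
  refine le_of_eq (setLIntegral_congr_fun measurableSet_Ioi fun x hx => ?_)
  have i1 := integrableOn_reg_mul_jumpRate hWB hE hN hpos hε hx (partner i)
  have i2 := (integrableOn_rpow hE.s_gt).const_mul (D * A ^ 2)
  have i12 : IntegrableOn (fun u => reg ε u * jumpRate β N x u (partner i) + D * A ^ 2 * u ^ s)
    (Ioo 0 1) := i1.add i2
  have hx0 : 0 ≤ |W x| ^ p := by positivity
  have n1 : ∀ u ∈ Ioo (0 : ℝ) 1, 0 ≤ reg ε u * jumpRate β N x u (partner i) := fun u hu =>
    mul_nonneg (reg_nonneg hε.le hu.1) (jumpRate_nonneg hWB hpos hx hu _)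
  have n2 : ∀ u ∈ Ioo (0 : ℝ) 1, 0 ≤ D * A ^ 2 * u ^ s := fun u hu =>
    mul_nonneg hDA (Real.rpow_nonneg hu.1.le _)
  rw [← ofReal_integral_eq_lintegral_ofReal (i12.mul_const _)
    ((ae_restrict_iff' measurableSet_Ioo).2 (Filter.Eventually.of_forall fun u hu =>
      mul_nonneg (add_nonneg (n1 u hu) (n2 u hu)) hx0)),
    ← ENNReal.ofReal_mul (mul_nonneg hDA (massS_nonneg s)), ← ENNReal.ofReal_add
      (mul_nonneg (setIntegral_nonneg measurableSet_Ioo n1) hx0)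
      (mul_nonneg (mul_nonneg hDA (massS_nonneg s)) hx0)]
  congr 1
  rw [integral_mul_const, integral_add i1 i2, integral_const_mul, massS]
  ring

/-- Jensen's inequality turns the pointwise estimate `abs_step_le` of a time step into one for `p`-th
powers. -/
lemma abs_step_pow_le (hWB : WeightBound β C) (hE : Exponents β r s) (hK : StepConst β r s K)
    (hp : 1 ≤ p) (hN : GoodFn A N) (hM : GoodFn A M) (hpos : ∀ x : ℝ, 0 < x → 0 ≤ N x)
    (hε : 0 < ε) {ω : ℝ} (hω : 0 < ω) (hτ : 0 ≤ τ) (hτΛ : τ * totalRate β ε N ω ≤ 1) :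
    |N ω - M ω + τ * (collisionReg β ε N ω - collisionReg β ε M ω)| ^ p ≤
      (1 + 16 * K * A ^ 2 * massS s * τ) ^ (p - 1) *
        ((1 - τ * totalRate β ε N ω) * |N ω - M ω| ^ p +
        τ * (∑ i, ∫ u in Ioo (0 : ℝ) 1, reg ε u * jumpRate β N ω u i *
          |sample (fun x => N x - M x) ω u i (partner i)| ^ p) +
        τ * (K * A ^ 2 * ∑ k, ∑ i, ∫ u in Ioo (0 : ℝ) 1,
          u ^ s * colWeight r u k ^ p * |sample (fun x => N x - M x) ω u i k| ^ p)) := by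
  have hstep := abs_step_le hWB hE hK hN hM hpos hε hω hτ hτΛ
  set W : ℝ → ℝ := fun x => N x - M x with hWdef
  have hWc : ContinuousOn W (Ioi 0) := hN.continuousOn.sub hM.continuousOn
  have hQ : ∀ x : ℝ, 0 < x → |W x| ≤ A + A := fun x hx =>
    (abs_sub _ _).trans (add_le_add (hN.bound x hx) (hM.bound x hx))
  have hA := hN.nonneg
  have hKA : 0 ≤ τ * (K * A ^ 2) := mul_nonneg hτ (mul_nonneg hK.1 (sq_nonneg A))
  have hS : ∀ i k, ContinuousOn (fun u => |sample W ω u i k|) (Ioo 0 1) := fun i k =>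
    (continuousOn_sample_u hWc hω i k).abs
  have hSQ : ∀ i k, ∀ u ∈ Ioo (0 : ℝ) 1, |sample W ω u i k| ≤ A + A := fun i k u hu =>
    hQ _ (mul_ratio_pos hω hu i k)
  -- the jump terms and the kernel terms together form one average
  let w : Fin 4 ⊕ (Fin 4 × Fin 4) → ℝ → ℝ := Sum.elim
    (fun i u => τ * (reg ε u * jumpRate β N ω u i)) (fun _ u => τ * (K * A ^ 2) * u ^ s)
  let X : Fin 4 ⊕ (Fin 4 × Fin 4) → ℝ → ℝ := Sum.elim
    (fun i u => |sample W ω u i (partner i)|)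
    (fun z u => colWeight r u z.1 * |sample W ω u z.2 z.1|)
  have iJ : ∀ i, ∀ q : ℕ, IntegrableOn
      (fun u => reg ε u * jumpRate β N ω u i * |sample W ω u i (partner i)| ^ q) (Ioo 0 1) :=
    fun i q => integrableOn_jumpRate_mul hWB hE hN hpos hε hω i (Q := (A + A) ^ q)
      ((hS i _).pow q) fun u hu => by
        rw [abs_of_nonneg (by positivity)]
        exact pow_le_pow_left₀ (abs_nonneg _) (hSQ i _ u hu) q
  have iK : ∀ i k, ∀ q : ℕ, IntegrableOn
      (fun u => u ^ s * (colWeight r u k * |sample W ω u i k|) ^ q) (Ioo 0 1) := by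
    intro i k q
    refine integrableOn_of_bound (g := fun u => u ^ s * (A + A) ^ q) ((continuousOn_rpow_Ioo s).mul
      (((continuousOn_colWeight r k).mul (hS i k)).pow q))
      ((integrableOn_rpow hE.s_gt).mul_const _) fun u hu => ?_
    have h0 := Real.rpow_nonneg hu.1.le s
    have h1 := colWeight_nonneg r hu k
    rw [abs_of_nonneg (by positivity)]
    gcongr
    exact (mul_le_of_le_one_left (abs_nonneg _) (colWeight_le_one hE.r_pos.le hu k)).trans
      (hSQ i k u hu)
  have hsumS : ∫ u in Ioo (0 : ℝ) 1, u ^ s * kernelSum r W ω u =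
      ∑ k, ∑ i, ∫ u in Ioo (0 : ℝ) 1, u ^ s * (colWeight r u k * |sample W ω u i k|) := by
    have i1 := fun i k => iK i k 1
    simp only [pow_one] at i1
    simp_rw [kernelSum, Finset.mul_sum]
    rw [integral_finsetSum _ fun k _ => (integrable_finsetSum _ fun i _ => i1 i k)]
    exact Finset.sum_congr rfl fun k _ => integral_finsetSum _ fun i _ => i1 i k
  have hall := pow_le_of_le_average hp (V := |N ω - M ω + τ * (collisionReg β ε N ω -
    collisionReg β ε M ω)|) (c := 1 - τ * totalRate β ε N ω) (x := |N ω - M ω|)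
    (Θ := 1 + 16 * K * A ^ 2 * massS s * τ) (w := w) (X := X) (abs_nonneg _) (by linarith)
    (abs_nonneg _) ?_ ?_ ?_ ?_ ?_ ?_ ?_ ?_
  · simp only [Fintype.sum_sum_type, Fintype.sum_prod_type, w, X, Sum.elim_inl, Sum.elim_inr,
      mul_assoc τ, integral_const_mul, ← Finset.mul_sum] at hall
    refine hall.trans (le_of_eq ?_)
    simp only [mul_pow, mul_assoc, integral_const_mul, ← Finset.mul_sum]
    ring
  · have h1 := hK.1
    have h2 := massS_nonneg s
    positivity
  · rintro (i | z) u hu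
    · exact mul_nonneg hτ (mul_nonneg (reg_nonneg hε.le hu.1) (jumpRate_nonneg hWB hpos hω hu i))
    · exact mul_nonneg hKA (Real.rpow_nonneg hu.1.le _)
  · rintro (i | z) u hu
    · exact abs_nonneg _
    · exact mul_nonneg (colWeight_nonneg r hu _) (abs_nonneg _)
  · rintro (i | z)
    · exact (integrableOn_reg_mul_jumpRate hWB hE hN hpos hε hω i).const_mul τ
    · exact (integrableOn_rpow hE.s_gt).const_mul _
  · rintro (i | z)
    · have := (iJ i 1).const_mul τ
      simpa only [IntegrableOn, pow_one, ← mul_assoc, w, X, Sum.elim_inl] using this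
    · have := (iK z.2 z.1 1).const_mul (τ * (K * A ^ 2))
      simpa only [IntegrableOn, pow_one, ← mul_assoc, w, X, Sum.elim_inr] using this
  · rintro (i | z)
    · have := (iJ i p).const_mul τ
      simpa only [IntegrableOn, ← mul_assoc, w, X, Sum.elim_inl] using this
    · have := (iK z.2 z.1 p).const_mul (τ * (K * A ^ 2))
      simpa only [IntegrableOn, ← mul_assoc, w, X, Sum.elim_inr] using this
  · rw [hsumS] at hstep
    refine hstep.trans (le_of_eq ?_)
    simp only [Fintype.sum_sum_type, Fintype.sum_prod_type, w, X, Sum.elim_inl, Sum.elim_inr,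
      mul_assoc, integral_const_mul, ← Finset.mul_sum]
    ring
  · rw [Fintype.sum_sum_type]
    simp only [w, Sum.elim_inl, Sum.elim_inr, integral_const_mul, ← Finset.mul_sum,
      Finset.sum_const, Finset.card_univ, Fintype.card_prod, Fintype.card_fin, nsmul_eq_mul,
      ← totalRate_eq_sum hWB hE hN hpos hε hω]
    rw [massS]
    push_cast
    linarith

/-- Stability of one time step in `L^p`, uniformly in `ε`. -/
lemma step_energy_le (hWB : WeightBound β C) (hE : Exponents β r s) (hK : StepConst β r s K)
    (hD : SymmConst β s D) (hp : 1 ≤ p) (hrp : r * p = 1)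
    (hN : GoodFn A N) (hM : GoodFn A M) (hpos : ∀ x : ℝ, 0 < x → 0 ≤ N x)
    (hε : 0 < ε) (hτ : 0 ≤ τ) (hτε : τ * (4 * (C ^ 3 * A ^ 2 * (ε ^ 3)⁻¹)) ≤ 1) :
    energy p (fun ω => N ω - M ω + τ * (collisionReg β ε N ω - collisionReg β ε M ω)) ≤
      ENNReal.ofReal ((1 + (4 * D + 48 * K) * A ^ 2 * massS s * τ) ^ p) *
        energy p (fun x => N x - M x) := by
  have hΛ : ∀ ω : ℝ, 0 < ω → τ * totalRate β ε N ω ≤ 1 := fun ω hω =>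
    mul_totalRate_le_one hWB hE hN hpos hε hω hτ hτε
  have hpt := fun ω hω => abs_step_pow_le hWB hE hK hp hN hM hpos hε hω hτ (hΛ ω hω)
  set W : ℝ → ℝ := fun x => N x - M x with hWdef
  have hWc : ContinuousOn W (Ioi 0) := hN.continuousOn.sub hM.continuousOn
  have hK0 := hK.1
  have hD0 := hD.1
  have hS0 := massS_nonneg s
  have hKA : 0 ≤ τ * (K * A ^ 2) := by positivity
  have hJ0 : ∀ i, ∀ ω : ℝ, 0 < ω → ∀ u ∈ Ioo (0 : ℝ) 1,
      0 ≤ reg ε u * jumpRate β N ω u i := fun i ω hω u hu =>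
    mul_nonneg (reg_nonneg hε.le hu.1) (jumpRate_nonneg hWB hpos hω hu i)
  have hS0' : ∀ k, ∀ u ∈ Ioo (0 : ℝ) 1, 0 ≤ u ^ s * colWeight r u k ^ p := fun k u hu =>
    mul_nonneg (Real.rpow_nonneg hu.1.le _) (pow_nonneg (colWeight_nonneg r hu k) p)
  let J : Fin 4 → ℝ → ℝ≥0∞ := fun i ω => ∫⁻ u in Ioo (0 : ℝ) 1,
    ENNReal.ofReal (reg ε u * jumpRate β N ω u i * |sample W ω u i (partner i)| ^ p)
  let S : Fin 4 → Fin 4 → ℝ → ℝ≥0∞ := fun k i ω => ∫⁻ u in Ioo (0 : ℝ) 1,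
    ENNReal.ofReal (u ^ s * colWeight r u k ^ p * |sample W ω u i k| ^ p)
  let R : Fin 4 → ℝ → ℝ := fun i ω => ∫ u in Ioo (0 : ℝ) 1, reg ε u * jumpRate β N ω u i
  let a : ℝ → ℝ≥0∞ := fun ω => ENNReal.ofReal ((1 - τ * totalRate β ε N ω) * |W ω| ^ p)
  have hJm : ∀ i, AEMeasurable (J i) (volume.restrict (Ioi 0)) := fun i =>
    (aemeasurable_sample_pow (g := fun ω u => reg ε u * jumpRate β N ω u i) hWc
      (((continuousOn_reg hε.le).comp continuousOn_snd fun _ h => h.2).mul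
        (continuousOn_jumpRate β hN.continuousOn continuousOn_snd (fun _ h => h.2)
          continuousOn_fst (fun _ h => h.1) i)) i (partner i)).lintegral_prod_right'
  have hSm : ∀ k i, AEMeasurable (S k i) (volume.restrict (Ioi 0)) := fun k i =>
    (aemeasurable_sample_pow (g := fun _ u => u ^ s * colWeight r u k ^ p) hWc
      (ContinuousOn.comp (g := fun u => u ^ s * colWeight r u k ^ p) (t := Ioo 0 1)
        ((continuousOn_rpow_Ioo s).mul ((continuousOn_colWeight r k).pow p)) continuousOn_snd
        fun _ h => h.2) i k).lintegral_prod_right'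
  have hle : ∀ {f : ℝ → ℝ}, (∀ u ∈ Ioo (0 : ℝ) 1, 0 ≤ f u) →
      ENNReal.ofReal (∫ u in Ioo (0 : ℝ) 1, f u) ≤
        ∫⁻ u in Ioo (0 : ℝ) 1, ENNReal.ofReal (f u) := by
    intro f hf
    rw [setIntegral_congr_fun measurableSet_Ioo
      (fun u hu => (Real.norm_of_nonneg (hf u hu)).symm)]
    refine (ENNReal.ofReal_le_ofReal (le_abs_self _)).trans ?_
    rw [← Real.enorm_eq_ofReal_abs]
    refine (enorm_integral_le_lintegral_enorm _).trans (le_of_eq ?_)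
    refine setLIntegral_congr_fun measurableSet_Ioo fun u hu => ?_
    rw [enorm_norm, Real.enorm_of_nonneg (hf u hu)]
  set Θ := 1 + 16 * K * A ^ 2 * massS s * τ with hΘ
  have hΘ1 : 1 ≤ Θ := by
    have : 0 ≤ 16 * K * A ^ 2 * massS s * τ := by positivity
    linarith
  have hF : ∀ ω ∈ Ioi (0 : ℝ), ENNReal.ofReal
      (|N ω - M ω + τ * (collisionReg β ε N ω - collisionReg β ε M ω)| ^ p) ≤
      ENNReal.ofReal (Θ ^ (p - 1)) * (a ω + (ENNReal.ofReal τ * ∑ i, J i ω +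
        ENNReal.ofReal (τ * (K * A ^ 2)) * ∑ k, ∑ i, S k i ω)) := by
    intro ω hω
    refine (ENNReal.ofReal_le_ofReal (hpt ω hω)).trans ?_
    rw [ENNReal.ofReal_mul (by positivity)]
    gcongr
    rw [add_assoc]
    refine ENNReal.ofReal_add_le.trans (add_le_add le_rfl
      (ENNReal.ofReal_add_le.trans (add_le_add ?_ ?_)))
    · rw [ENNReal.ofReal_mul hτ, ENNReal.ofReal_sum_of_nonneg fun i _ =>
        setIntegral_nonneg measurableSet_Ioo fun u hu =>
          mul_nonneg (hJ0 i ω hω u hu) (by positivity)]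
      gcongr with i
      exact hle fun u hu => mul_nonneg (hJ0 i ω hω u hu) (by positivity)
    · have hn : ∀ k i, 0 ≤ ∫ u in Ioo (0 : ℝ) 1,
          u ^ s * colWeight r u k ^ p * |sample W ω u i k| ^ p := fun k i =>
        setIntegral_nonneg measurableSet_Ioo fun u hu =>
          mul_nonneg (hS0' k u hu) (by positivity)
      rw [← mul_assoc, ENNReal.ofReal_mul hKA, ENNReal.ofReal_sum_of_nonneg fun k _ =>
        Finset.sum_nonneg fun i _ => hn k i]
      gcongr with k
      rw [ENNReal.ofReal_sum_of_nonneg fun i _ => hn k i]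
      gcongr with i
      exact hle fun u hu => mul_nonneg (hS0' k u hu) (by positivity)
  have hJi : ∀ i, ∫⁻ ω in Ioi (0 : ℝ), J i ω ≤
      (∫⁻ ω in Ioi (0 : ℝ), ENNReal.ofReal (R (partner i) ω * |W ω| ^ p)) +
        ENNReal.ofReal (D * A ^ 2 * massS s) * energy p W := fun i =>
    jump_energy_le hWB hE hD hN hpos hε hWc i
  have hSi : ∀ k i, ∫⁻ ω in Ioi (0 : ℝ), S k i ω ≤
      ENNReal.ofReal (3 * massS s) * energy p W := fun k i =>
    kernel_energy_le hrp hE.s_gt hWc i k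
  -- the rates of the reversed jumps add up to the total rate again
  have hsum : (∫⁻ ω in Ioi (0 : ℝ), a ω) + ENNReal.ofReal τ *
      ∑ i, ∫⁻ ω in Ioi (0 : ℝ), ENNReal.ofReal (R (partner i) ω * |W ω| ^ p) ≤ energy p W := by
    rw [Finset.mul_sum]
    simp_rw [← lintegral_const_mul' (ENNReal.ofReal τ) _ ENNReal.ofReal_ne_top]
    rw [Fin.sum_univ_four]
    refine (add_le_add le_rfl ((add_le_add_left ((add_le_add_left
      (le_lintegral_add _ _) _).trans (le_lintegral_add _ _)) _).trans
      (le_lintegral_add _ _))).trans ((le_lintegral_add _ _).trans ?_)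
    refine setLIntegral_mono' measurableSet_Ioi fun ω hω => ?_
    have hR : ∀ i, 0 ≤ R i ω := fun i => setIntegral_nonneg measurableSet_Ioo (hJ0 i ω hω)
    have hw : 0 ≤ |W ω| ^ p := by positivity
    have hRw : ∀ i, 0 ≤ τ * (R i ω * |W ω| ^ p) := fun i =>
      mul_nonneg hτ (mul_nonneg (hR i) hw)
    have e : totalRate β ε N ω = R 0 ω + R 1 ω + R 2 ω + R 3 ω := by
      rw [totalRate_eq_sum hWB hE hN hpos hε hω, Fin.sum_univ_four]
    simp only [← ENNReal.ofReal_mul hτ, a]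
    rw [← ENNReal.ofReal_add (hRw _) (hRw _), ← ENNReal.ofReal_add (add_nonneg (hRw _) (hRw _))
      (hRw _), ← ENNReal.ofReal_add (add_nonneg (add_nonneg (hRw _) (hRw _)) (hRw _)) (hRw _),
      ← ENNReal.ofReal_add (mul_nonneg (by linarith [hΛ ω hω]) hw)
        (add_nonneg (add_nonneg (add_nonneg (hRw _) (hRw _)) (hRw _)) (hRw _))]
    refine ENNReal.ofReal_le_ofReal (le_of_eq ?_)
    rw [e]
    simp only [partner, Fin.isValue, Matrix.cons_val]
    ring
  calc energy p (fun ω => N ω - M ω + τ * (collisionReg β ε N ω - collisionReg β ε M ω))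
      ≤ ∫⁻ ω in Ioi (0 : ℝ), ENNReal.ofReal (Θ ^ (p - 1)) * (a ω + (ENNReal.ofReal τ *
          ∑ i, J i ω + ENNReal.ofReal (τ * (K * A ^ 2)) * ∑ k, ∑ i, S k i ω)) :=
        setLIntegral_mono' measurableSet_Ioi hF
    _ = ENNReal.ofReal (Θ ^ (p - 1)) * ((∫⁻ ω in Ioi (0 : ℝ), a ω) + (ENNReal.ofReal τ *
          ∑ i, (∫⁻ ω in Ioi (0 : ℝ), J i ω) + ENNReal.ofReal (τ * (K * A ^ 2)) *
            ∑ k, ∑ i, ∫⁻ ω in Ioi (0 : ℝ), S k i ω)) := by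
        have m1 : AEMeasurable (fun ω => ∑ i, J i ω) (volume.restrict (Ioi 0)) :=
          Finset.aemeasurable_fun_sum _ fun i _ => hJm i
        have m2 : ∀ k, AEMeasurable (fun ω => ∑ i, S k i ω) (volume.restrict (Ioi 0)) :=
          fun k => Finset.aemeasurable_fun_sum _ fun i _ => hSm k i
        have m3 : AEMeasurable (fun ω => ∑ k, ∑ i, S k i ω) (volume.restrict (Ioi 0)) :=
          Finset.aemeasurable_fun_sum _ fun k _ => m2 k
        have m4 : AEMeasurable (fun ω => ENNReal.ofReal τ * ∑ i, J i ω +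
            ENNReal.ofReal (τ * (K * A ^ 2)) * ∑ k, ∑ i, S k i ω) (volume.restrict (Ioi 0)) :=
          (m1.const_mul _).add (m3.const_mul _)
        rw [lintegral_const_mul' _ _ ENNReal.ofReal_ne_top, lintegral_add_right' _ m4,
          lintegral_add_right' _ (m3.const_mul _),
          lintegral_const_mul' _ _ ENNReal.ofReal_ne_top,
          lintegral_const_mul' _ _ ENNReal.ofReal_ne_top,
          lintegral_finsetSum' _ fun i _ => hJm i, lintegral_finsetSum' _ fun k _ => m2 k]
        congr 4
        exact Finset.sum_congr rfl fun k _ => lintegral_finsetSum' _ fun i _ => hSm k i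
    _ ≤ ENNReal.ofReal (Θ ^ (p - 1)) * ((∫⁻ ω in Ioi (0 : ℝ), a ω) + (ENNReal.ofReal τ *
          ∑ i, ((∫⁻ ω in Ioi (0 : ℝ), ENNReal.ofReal (R (partner i) ω * |W ω| ^ p)) +
            ENNReal.ofReal (D * A ^ 2 * massS s) * energy p W) +
          ENNReal.ofReal (τ * (K * A ^ 2)) *
            ∑ _k : Fin 4, ∑ _i : Fin 4, ENNReal.ofReal (3 * massS s) * energy p W)) := by
        gcongr
        exacts [hJi _, hSi _ _]
    _ = ENNReal.ofReal (Θ ^ (p - 1)) * (((∫⁻ ω in Ioi (0 : ℝ), a ω) + ENNReal.ofReal τ *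
          ∑ i, ∫⁻ ω in Ioi (0 : ℝ), ENNReal.ofReal (R (partner i) ω * |W ω| ^ p)) +
          (ENNReal.ofReal τ * (4 * ENNReal.ofReal (D * A ^ 2 * massS s)) +
            ENNReal.ofReal (τ * (K * A ^ 2)) * (16 * ENNReal.ofReal (3 * massS s))) *
              energy p W) := by
        rw [Finset.sum_add_distrib]
        simp only [Finset.sum_const, Finset.card_univ, Fintype.card_fin, nsmul_eq_mul]
        push_cast
        ring
    _ ≤ ENNReal.ofReal (Θ ^ (p - 1)) * (energy p W +
          (ENNReal.ofReal τ * (4 * ENNReal.ofReal (D * A ^ 2 * massS s)) +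
            ENNReal.ofReal (τ * (K * A ^ 2)) * (16 * ENNReal.ofReal (3 * massS s))) *
              energy p W) := by
        gcongr
    _ = ENNReal.ofReal (Θ ^ (p - 1) * (1 + (4 * D + 48 * K) * A ^ 2 * massS s * τ)) *
          energy p W := by
        have e4 : (4 : ℝ≥0∞) = ENNReal.ofReal 4 := by simp
        have e16 : (16 : ℝ≥0∞) = ENNReal.ofReal 16 := by simp
        rw [e4, e16, ← ENNReal.ofReal_mul (show (0 : ℝ) ≤ 4 by norm_num),
          ← ENNReal.ofReal_mul (show (0 : ℝ) ≤ 16 by norm_num),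
          ← ENNReal.ofReal_mul hτ, ← ENNReal.ofReal_mul hKA, ← ENNReal.ofReal_add
          (by positivity) (by positivity), ENNReal.ofReal_mul (by positivity),
          mul_assoc (ENNReal.ofReal _)]
        congr 1
        rw [show 1 + (4 * D + 48 * K) * A ^ 2 * massS s * τ = 1 + (τ * (4 * (D * A ^ 2 * massS s))
          + τ * (K * A ^ 2) * (16 * (3 * massS s))) by ring,
          ENNReal.ofReal_add zero_le_one (by positivity), ENNReal.ofReal_one, add_mul, one_mul]
    _ ≤ _ := by
        gcongr
        obtain ⟨m, rfl⟩ : ∃ m, p = m + 1 := ⟨p - 1, by omega⟩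
        have h1 : Θ ≤ 1 + (4 * D + 48 * K) * A ^ 2 * massS s * τ := by
          have : 0 ≤ (4 * D + 32 * K) * A ^ 2 * massS s * τ := by positivity
          linarith
        rw [Nat.add_sub_cancel, pow_succ]
        exact mul_le_mul_of_nonneg_right (pow_le_pow_left₀ (by linarith) h1 m) (by linarith)

end Energy

/-! ### The explicit Euler scheme -/

/-- The constants of the estimates for one time step. -/
structure StepData (β C r s K D : ℝ) : Prop where
  weight : WeightBound β C
  exps : Exponents β r s
  step : StepConst β r s K
  symm : SymmConst β s D

/-- Bound for the collision operator on `GoodFn A`. -/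
noncomputable def supRate (C s A : ℝ) : ℝ := 20 * C ^ 3 * A ^ 3 * massS s

/-- Growth rate of the supremum norm of a difference. -/
noncomputable def supGrowth (K s A : ℝ) : ℝ := 16 * K * A ^ 2 * massS s

/-- Growth rate of the `L^p` norm of a difference. -/
noncomputable def energyGrowth (K D s A : ℝ) : ℝ := (4 * D + 48 * K) * A ^ 2 * massS s

/-- Lipschitz constant, in the supremum norm, of the collision operator with cutoff `ε`. -/
noncomputable def regLip (C A ε : ℝ) : ℝ := 48 * C ^ 3 * A ^ 2 * (ε ^ 3)⁻¹

/-- Bound for the effect of the cutoff `ε`. -/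
noncomputable def cutError (C s A ε : ℝ) : ℝ := 20 * C ^ 3 * A ^ 3 * cutMass s ε

/-- The explicit Euler scheme with step `τ` for the collision operator with cutoff `ε`. -/
noncomputable def euler (β ε τ : ℝ) (N₀ : ℝ → ℝ) : ℕ → ℝ → ℝ
  | 0 => N₀
  | k + 1 => fun ω => euler β ε τ N₀ k ω + τ * collisionReg β ε (euler β ε τ N₀ k) ω

/-- Smallness conditions on the existence time `T`: bounds at most double, and a lower bound `c` is
at most halved. -/
structure Horizon (C s K A₀ c T : ℝ) : Prop where
  c_pos : 0 < c
  T_pos : 0 < T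
  sup_le : T * supRate C s (2 * A₀) ≤ A₀
  low_le : T * supRate C s (2 * A₀) ≤ c / 2
  lip_le : Real.exp (supGrowth K s (2 * A₀) * T) ≤ 2

section

variable {β C r s K D A A₀ c T ε τ : ℝ} {N N₀ : ℝ → ℝ}

lemma StepData.supRate_nonneg (hd : StepData β C r s K D) (hA : 0 ≤ A) : 0 ≤ supRate C s A := by
  have := hd.weight.one_le
  have := massS_nonneg s
  unfold supRate; positivity

lemma StepData.supGrowth_nonneg (hd : StepData β C r s K D) : 0 ≤ supGrowth K s A := by
  have := hd.step.1
  have := massS_nonneg s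
  unfold supGrowth; positivity

lemma StepData.energyGrowth_nonneg (hd : StepData β C r s K D) : 0 ≤ energyGrowth K D s A := by
  have := hd.step.1
  have := hd.symm.1
  have := massS_nonneg s
  unfold energyGrowth; positivity

lemma StepData.regLip_nonneg (hd : StepData β C r s K D) (hε : 0 < ε) : 0 ≤ regLip C A ε := by
  have := hd.weight.one_le
  unfold regLip; positivity

lemma StepData.cutError_nonneg (hd : StepData β C r s K D) (hA : 0 ≤ A) (hε : 0 < ε) :
    0 ≤ cutError C s A ε := by
  have := hd.weight.one_le
  have := cutMass_nonneg (s := s) hε.le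
  unfold cutError; positivity

lemma exists_horizon (hd : StepData β C r s K D) (hA : 0 < A₀) (hc : 0 < c) :
    ∃ T, Horizon C s K A₀ c T := by
  have hS := hd.supRate_nonneg (A := 2 * A₀) (by linarith)
  have hG := hd.supGrowth_nonneg (A := 2 * A₀)
  set S := supRate C s (2 * A₀)
  set G := supGrowth K s (2 * A₀)
  have hl : 0 < Real.log 2 := Real.log_pos (by norm_num)
  set T := min (min (A₀ / (S + 1)) (c / 2 / (S + 1))) (Real.log 2 / (G + 1)) with hT
  have hTp : 0 < T := lt_min (lt_min (by positivity) (by positivity)) (by positivity)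
  have h : ∀ {x y : ℝ}, 0 ≤ x → T ≤ y / (x + 1) → T * x ≤ y := by
    intro x y hx hy
    rw [le_div_iff₀ (by linarith)] at hy
    nlinarith
  refine ⟨T, hc, hTp, h hS ((min_le_left _ _).trans (min_le_left _ _)),
    h hS ((min_le_left _ _).trans (min_le_right _ _)), ?_⟩
  have := h hG (min_le_right _ _)
  rw [mul_comm]
  exact (Real.exp_le_exp.2 this).trans_eq (Real.exp_log (by norm_num))

lemma GoodFn.dilate (h : GoodFn A N) {a : ℝ} (ha : 0 < a) : GoodFn A (fun x => N (x * a)) where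
  bound ω hω := h.bound _ (mul_pos hω ha)
  lip x hx y hy := by
    have := h.lip _ (mul_pos hx ha) _ (mul_pos hy ha)
    rwa [Real.log_mul hx.ne' ha.ne', Real.log_mul hy.ne' ha.ne', add_sub_add_right_eq_sub] at this

/-- Up to time `T`, the iterates of the Euler scheme stay bounded, Lipschitz in `log ω`, and bounded
from below. -/
lemma euler_bounds (hd : StepData β C r s K D) (hT : Horizon C s K A₀ c T) (hN : GoodFn A₀ N₀)
    (hc : ∀ ω : ℝ, 0 < ω → c ≤ N₀ ω) (hε : 0 < ε) (hτ : 0 ≤ τ)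
    (hτε : τ * (4 * (C ^ 3 * (2 * A₀) ^ 2 * (ε ^ 3)⁻¹)) ≤ 1) (k : ℕ) (hk : k * τ ≤ T) :
    GoodFn (2 * A₀) (euler β ε τ N₀ k) ∧ (∀ ω : ℝ, 0 < ω → c / 2 ≤ euler β ε τ N₀ k ω) := by
  have hA := hN.nonneg
  have hS := hd.supRate_nonneg (A := 2 * A₀) (by linarith)
  have hG := hd.supGrowth_nonneg (A := 2 * A₀)
  set S := supRate C s (2 * A₀) with hSdef
  set G := supGrowth K s (2 * A₀) with hGdef
  have hsub : ∀ k : ℕ, k * τ ≤ T → (∀ ω : ℝ, 0 < ω → |euler β ε τ N₀ k ω - N₀ ω| ≤ k * τ * S) →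
      (∀ x : ℝ, 0 < x → ∀ y : ℝ, 0 < y → |euler β ε τ N₀ k x - euler β ε τ N₀ k y| ≤
        (1 + G * τ) ^ k * A₀ * |Real.log x - Real.log y|) →
      GoodFn (2 * A₀) (euler β ε τ N₀ k) ∧ (∀ ω : ℝ, 0 < ω → c / 2 ≤ euler β ε τ N₀ k ω) := by
    intro k hk h1 h2
    have hkS : k * τ * S ≤ T * S := mul_le_mul_of_nonneg_right hk hS
    have hpow : (1 + G * τ) ^ k ≤ 2 := by
      have h3 : (1 + G * τ) ^ k ≤ Real.exp (G * τ) ^ k :=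
        pow_le_pow_left₀ (by positivity) (by linarith [Real.add_one_le_exp (G * τ)]) k
      rw [← Real.exp_nat_mul] at h3
      refine h3.trans (le_trans (Real.exp_le_exp.2 ?_) hT.lip_le)
      have := mul_le_mul_of_nonneg_left hk hG
      linarith
    refine ⟨⟨fun ω hω => ?_, fun x hx y hy => (h2 x hx y hy).trans ?_⟩, fun ω hω => ?_⟩
    · have h3 := abs_le.1 (h1 ω hω)
      have h4 := abs_le.1 (hN.bound ω hω)
      have h5 := hT.sup_le
      exact abs_le.2 ⟨by linarith [h3.1, h4.1], by linarith [h3.2, h4.2]⟩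
    · exact mul_le_mul_of_nonneg_right (mul_le_mul_of_nonneg_right hpow hA) (abs_nonneg _)
    · have h3 := abs_le.1 (h1 ω hω)
      have h5 := hT.low_le
      linarith [h3.1, hc ω hω]
  suffices h : ∀ k : ℕ, k * τ ≤ T →
      (∀ ω : ℝ, 0 < ω → |euler β ε τ N₀ k ω - N₀ ω| ≤ k * τ * S) ∧
      (∀ x : ℝ, 0 < x → ∀ y : ℝ, 0 < y → |euler β ε τ N₀ k x - euler β ε τ N₀ k y| ≤
        (1 + G * τ) ^ k * A₀ * |Real.log x - Real.log y|) from
    hsub k hk (h k hk).1 (h k hk).2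
  intro k
  induction k with
  | zero =>
    intro _
    refine ⟨fun ω _ => by simp [euler], fun x hx y hy => ?_⟩
    simpa [euler] using hN.lip x hx y hy
  | succ k ih =>
    intro hk
    push_cast at hk
    have hk' : k * τ ≤ T := by linarith
    obtain ⟨h1, h2⟩ := ih hk'
    obtain ⟨hg, hl⟩ := hsub k hk' h1 h2
    set x := euler β ε τ N₀ k with hx
    have hpos : ∀ ω : ℝ, 0 < ω → 0 ≤ x ω := fun ω hω =>
      (half_pos hT.c_pos).le.trans (hl ω hω)
    refine ⟨fun ω hω => ?_, fun y hy z hz => ?_⟩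
    · have h3 := abs_collisionReg_le hd.weight hd.exps hg hω hε.le
      have h4 : euler β ε τ N₀ (k + 1) ω - N₀ ω = (x ω - N₀ ω) + τ * collisionReg β ε x ω := by
        simp only [euler]; ring
      rw [h4]
      refine (abs_add_le _ _).trans ?_
      rw [abs_mul, abs_of_nonneg hτ]
      have := mul_le_mul_of_nonneg_left h3 hτ
      have := h1 ω hω
      push_cast
      rw [hSdef, supRate] at *
      linarith
    · -- the increment is the difference of the scheme and its dilation
      have ha : 0 < y / z := div_pos hy hz
      have hza : z * (y / z) = y := mul_div_cancel₀ _ hz.ne'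
      have h3 := step_sup_le hd.weight hd.exps hd.step (hg.dilate ha) hg
        (fun w hw => hpos _ (mul_pos hw ha)) hε hτ hτε
        (q := (1 + G * τ) ^ k * A₀ * |Real.log y - Real.log z|) (fun w hw => by
          have := h2 _ (mul_pos hw ha) w hw
          rwa [Real.log_mul hw.ne' ha.ne', Real.log_div hy.ne' hz.ne',
            add_sub_cancel_left] at this) hz
      rw [collisionReg_dilate, hza] at h3
      have h4 : euler β ε τ N₀ (k + 1) y - euler β ε τ N₀ (k + 1) z =
          x y - x z + τ * (collisionReg β ε x y - collisionReg β ε x z) := by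
        simp only [euler]; ring
      rw [h4, pow_succ]
      refine h3.trans (le_of_eq ?_)
      rw [hGdef, supGrowth]; ring

/-- The dilation of a scheme is the scheme for the dilated initial values, so the stability of one
step in `L^p` propagates bounds for dilation differences. -/
lemma euler_energy_le (hd : StepData β C r s K D) (hT : Horizon C s K A₀ c T) (hN : GoodFn A₀ N₀)
    (hc : ∀ ω : ℝ, 0 < ω → c ≤ N₀ ω) (hε : 0 < ε) (hτ : 0 ≤ τ)
    (hτε : τ * (4 * (C ^ 3 * (2 * A₀) ^ 2 * (ε ^ 3)⁻¹)) ≤ 1) {p : ℕ} (hp : 1 ≤ p)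
    (hrp : r * p = 1) {a : ℝ} (ha : 0 < a) (k : ℕ) (hk : k * τ ≤ T) :
    energy p (fun x => euler β ε τ N₀ k (x * a) - euler β ε τ N₀ k x) ≤
      ENNReal.ofReal (Real.exp (energyGrowth K D s (2 * A₀) * (p * T))) *
        energy p (fun x => N₀ (x * a) - N₀ x) := by
  have hG := hd.energyGrowth_nonneg (A := 2 * A₀)
  set G := energyGrowth K D s (2 * A₀) with hGdef
  have h : ∀ k : ℕ, k * τ ≤ T →
      energy p (fun x => euler β ε τ N₀ k (x * a) - euler β ε τ N₀ k x) ≤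
        ENNReal.ofReal (((1 + G * τ) ^ p) ^ k) * energy p (fun x => N₀ (x * a) - N₀ x) := by
    intro k
    induction k with
    | zero => intro _; simp [euler]
    | succ k ih =>
      intro hk
      push_cast at hk
      have hk' : k * τ ≤ T := by linarith
      obtain ⟨hg, hl⟩ := euler_bounds hd hT hN hc hε hτ hτε k hk'
      set x := euler β ε τ N₀ k with hx
      have h1 := step_energy_le hd.weight hd.exps hd.step hd.symm hp hrp (hg.dilate ha) hg
        (fun w hw => (half_pos hT.c_pos).le.trans (hl _ (mul_pos hw ha))) hε hτ hτε
      have h2 : (fun w => euler β ε τ N₀ (k + 1) (w * a) - euler β ε τ N₀ (k + 1) w) =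
          fun w => x (w * a) - x w +
            τ * (collisionReg β ε (fun y => x (y * a)) w - collisionReg β ε x w) := by
        funext w
        rw [collisionReg_dilate]
        simp only [euler]; ring
      rw [h2]
      refine h1.trans ?_
      rw [pow_succ ((1 + G * τ) ^ p), mul_comm (((1 + G * τ) ^ p) ^ k), ENNReal.ofReal_mul (by positivity),
        mul_assoc (ENNReal.ofReal _)]
      rw [show (4 * D + 48 * K) * (2 * A₀) ^ 2 * massS s = G by rw [hGdef, energyGrowth]]
      exact mul_le_mul_right (ih hk') _
  refine (h k hk).trans ?_
  gcongr
  rw [← pow_mul]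
  have h3 : (1 + G * τ) ^ (p * k) ≤ Real.exp (G * τ) ^ (p * k) :=
    pow_le_pow_left₀ (by positivity) (by linarith [Real.add_one_le_exp (G * τ)]) _
  rw [← Real.exp_nat_mul] at h3
  refine h3.trans (Real.exp_le_exp.2 ?_)
  have := mul_le_mul_of_nonneg_left hk (mul_nonneg hG (Nat.cast_nonneg p))
  push_cast
  linarith

end

/-! ### Approximate solutions and their stability -/

/-- Approximate solutions of the equation with cutoff `ε`: on `[a, b]` the increment agrees with
that of one Euler step up to the error rate `κ`, a quadratic error with constant `L`, and a fixed
error `θ`. -/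
def ApproxSol (β ε κ L θ T : ℝ) (N : ℝ → ℝ → ℝ) : Prop :=
  ∀ a b : ℝ, 0 ≤ a → a ≤ b → b ≤ T → ∀ ω : ℝ, 0 < ω →
    |N b ω - N a ω - (b - a) * collisionReg β ε (N a) ω| ≤ (b - a) * (κ + L * (b - a)) + θ

section

variable {β C r s K D A ε κ₁ κ₂ L₁ L₂ θ₁ θ₂ T q₀ : ℝ} {N M : ℝ → ℝ → ℝ}

/-- Two approximate solutions stay close: they are compared at `n` equidistant times, and between
two of these both are replaced by one Euler step, which `step_sup_le` controls. The number `n` is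
free, and each step adds the fixed errors `θ₁ + θ₂` once. -/
lemma ApproxSol.abs_sub_le (hd : StepData β C r s K D) (hN : ApproxSol β ε κ₁ L₁ θ₁ T N)
    (hM : ApproxSol β ε κ₂ L₂ θ₂ T M) (gN : ∀ t ∈ Icc 0 T, GoodFn A (N t))
    (gM : ∀ t ∈ Icc 0 T, GoodFn A (M t)) (hpos : ∀ t ∈ Icc 0 T, ∀ x : ℝ, 0 < x → 0 ≤ N t x)
    (hε : 0 < ε) (h0 : ∀ x : ℝ, 0 < x → |N 0 x - M 0 x| ≤ q₀) {t : ℝ} (ht : t ∈ Icc 0 T)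
    {n : ℕ} (hn : 0 < n) (hnε : t / n * (4 * (C ^ 3 * A ^ 2 * (ε ^ 3)⁻¹)) ≤ 1)
    {ω : ℝ} (hω : 0 < ω) :
    |N t ω - M t ω| ≤ Real.exp (supGrowth K s A * t) *
      (q₀ + (t * (κ₁ + κ₂ + (L₁ + L₂) * (t / n)) + n * (θ₁ + θ₂))) := by
  have hG := hd.supGrowth_nonneg (A := A)
  set G := supGrowth K s A with hGdef
  have hn' : (0 : ℝ) < n := by exact_mod_cast hn
  set τ := t / n with hτdef
  have hτ : 0 ≤ τ := div_nonneg ht.1 hn'.le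
  have hnτ : n * τ = t := mul_div_cancel₀ _ hn'.ne'
  set δ := τ * (κ₁ + κ₂ + (L₁ + L₂) * τ) + (θ₁ + θ₂) with hδ
  have hδ0 : 0 ≤ δ := by
    have h1 := (abs_nonneg _).trans (hN 0 τ le_rfl hτ (by
      have : τ ≤ t := div_le_self ht.1 (by exact_mod_cast hn)
      exact this.trans ht.2) 1 one_pos)
    have h2 := (abs_nonneg _).trans (hM 0 τ le_rfl hτ (by
      have : τ ≤ t := div_le_self ht.1 (by exact_mod_cast hn)
      exact this.trans ht.2) 1 one_pos)
    rw [sub_zero] at h1 h2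
    rw [hδ]; linarith
  have hq0 : 0 ≤ q₀ := (abs_nonneg _).trans (h0 1 one_pos)
  have h : ∀ k : ℕ, k ≤ n → ∀ x : ℝ, 0 < x →
      |N (k * τ) x - M (k * τ) x| ≤ (1 + G * τ) ^ k * (q₀ + k * δ) := by
    intro k
    induction k with
    | zero => intro _ x hx; simpa using h0 x hx
    | succ k ih =>
      intro hk x hx
      have hk' : (k + 1 : ℝ) * τ ≤ t := by
        rw [← hnτ]; exact mul_le_mul_of_nonneg_right (by exact_mod_cast hk) hτ
      have hkτ : 0 ≤ k * τ := by positivity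
      have hm : k * τ ∈ Icc 0 T := ⟨hkτ, by linarith [ht.2]⟩
      have e : (k + 1 : ℝ) * τ - k * τ = τ := by ring
      have h1 := hN (k * τ) ((k + 1) * τ) hkτ (by linarith) (hk'.trans ht.2) x hx
      have h2 := hM (k * τ) ((k + 1) * τ) hkτ (by linarith) (hk'.trans ht.2) x hx
      rw [e] at h1 h2
      have h3 := step_sup_le hd.weight hd.exps hd.step (gN _ hm) (gM _ hm) (hpos _ hm) hε hτ hnε
        (ih (by omega)) hx
      have h4 : 1 + 16 * K * A ^ 2 * massS s * τ = 1 + G * τ := by rw [hGdef, supGrowth]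
      rw [h4] at h3
      have h5 : N ((k + 1) * τ) x - M ((k + 1) * τ) x =
          (N (k * τ) x - M (k * τ) x +
            τ * (collisionReg β ε (N (k * τ)) x - collisionReg β ε (M (k * τ)) x)) +
          (N ((k + 1) * τ) x - N (k * τ) x - τ * collisionReg β ε (N (k * τ)) x) -
          (M ((k + 1) * τ) x - M (k * τ) x - τ * collisionReg β ε (M (k * τ)) x) := by ring
      push_cast
      rw [h5]
      refine (abs_sub _ _).trans ((add_le_add_left (abs_add_le _ _) _).trans ?_)
      have h6 : 1 ≤ (1 + G * τ) ^ (k + 1) := one_le_pow₀ (by nlinarith)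
      have h7 : δ ≤ (1 + G * τ) ^ (k + 1) * δ := le_mul_of_one_le_left hδ0 h6
      have h8 : (1 + G * τ) * ((1 + G * τ) ^ k * (q₀ + k * δ)) =
          (1 + G * τ) ^ (k + 1) * (q₀ + k * δ) := by rw [pow_succ]; ring
      rw [h8] at h3
      have h9 : δ = τ * (κ₁ + L₁ * τ) + θ₁ + (τ * (κ₂ + L₂ * τ) + θ₂) := by rw [hδ]; ring
      have h10 : (1 + G * τ) ^ (k + 1) * (q₀ + (k + 1) * δ) =
        (1 + G * τ) ^ (k + 1) * (q₀ + k * δ) + (1 + G * τ) ^ (k + 1) * δ := by ring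
      rw [h10]
      linarith
  have h1 := h n le_rfl ω hω
  rw [hnτ] at h1
  refine h1.trans ?_
  have h2 : q₀ + n * δ = q₀ + (t * (κ₁ + κ₂ + (L₁ + L₂) * τ) + n * (θ₁ + θ₂)) := by
    rw [hδ, ← hnτ]; ring
  rw [h2]
  refine mul_le_mul_of_nonneg_right ?_ (by rw [← h2]; positivity)
  have h3 : (1 + G * τ) ^ n ≤ Real.exp (G * τ) ^ n :=
    pow_le_pow_left₀ (by positivity) (by linarith [Real.add_one_le_exp (G * τ)]) n
  rw [← Real.exp_nat_mul] at h3
  refine h3.trans_eq ?_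
  rw [← hnτ]; congr 1; ring

/-- Functions that are approximate solutions for all cutoffs, without fixed errors, are determined by
their initial values: first the number of steps tends to infinity, then the cutoff to `0`. -/
lemma ApproxSol.eq_of_forall (hd : StepData β C r s K D) {κ L : ℝ → ℝ}
    (hκ : Filter.Tendsto κ (nhdsWithin 0 (Ioi 0)) (nhds 0))
    (hN : ∀ ε : ℝ, 0 < ε → ApproxSol β ε (κ ε) (L ε) 0 T N)
    (hM : ∀ ε : ℝ, 0 < ε → ApproxSol β ε (κ ε) (L ε) 0 T M)
    (gN : ∀ t ∈ Icc 0 T, GoodFn A (N t)) (gM : ∀ t ∈ Icc 0 T, GoodFn A (M t))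
    (hpos : ∀ t ∈ Icc 0 T, ∀ x : ℝ, 0 < x → 0 ≤ N t x)
    (h0 : ∀ x : ℝ, 0 < x → N 0 x = M 0 x) {t : ℝ} (ht : t ∈ Icc 0 T) {ω : ℝ} (hω : 0 < ω) :
    N t ω = M t ω := by
  have hdiv : ∀ c : ℝ, Filter.Tendsto (fun n : ℕ => t / n * c) Filter.atTop (nhds 0) := fun c => by
    simpa using (tendsto_const_div_atTop_nhds_zero_nat t).mul_const c
  have h1 : ∀ ε : ℝ, 0 < ε → |N t ω - M t ω| ≤
      Real.exp (supGrowth K s A * t) * (t * (κ ε + κ ε)) := by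
    intro ε hε
    have hlim : Filter.Tendsto (fun n : ℕ => Real.exp (supGrowth K s A * t) *
        (0 + (t * (κ ε + κ ε + (L ε + L ε) * (t / n)) + n * (0 + 0)))) Filter.atTop
        (nhds (Real.exp (supGrowth K s A * t) * (t * (κ ε + κ ε)))) := by
      have := ((((hdiv (L ε + L ε)).const_add (κ ε + κ ε)).const_mul t).const_mul
        (Real.exp (supGrowth K s A * t)))
      rw [add_zero] at this
      refine this.congr fun n => ?_
      ring
    refine ge_of_tendsto hlim ?_
    filter_upwards [Filter.eventually_gt_atTop 0, (hdiv _).eventually_le_const one_pos] with n hn h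
    exact (hN ε hε).abs_sub_le hd (hM ε hε) gN gM hpos hε (fun x hx => by rw [h0 x hx]; simp) ht hn
      h hω
  have h2 : Filter.Tendsto (fun ε => Real.exp (supGrowth K s A * t) * (t * (κ ε + κ ε)))
      (nhdsWithin 0 (Ioi 0)) (nhds 0) := by
    simpa using ((hκ.add hκ).const_mul t).const_mul (Real.exp (supGrowth K s A * t))
  have h3 := ge_of_tendsto h2 (b := |N t ω - M t ω|) (by
    filter_upwards [self_mem_nhdsWithin] with ε hε using h1 ε hε)
  exact sub_eq_zero.1 (abs_nonpos_iff.1 h3)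

end

/-! ### Convergence of the Euler scheme -/

/-- The Euler scheme as a piecewise constant function of time. -/
noncomputable def eulerInterp (β ε τ : ℝ) (N₀ : ℝ → ℝ) (t : ℝ) : ℝ → ℝ :=
  euler β ε τ N₀ ⌊t / τ⌋₊

section

variable {β C r s K D A A₀ c T ε ε' τ : ℝ} {N N₀ : ℝ → ℝ}

lemma floor_mul_le (hτ : 0 < τ) {t : ℝ} (ht : 0 ≤ t) : (⌊t / τ⌋₊ : ℝ) * τ ≤ t :=
  (le_div_iff₀ hτ).1 (Nat.floor_le (div_nonneg ht hτ.le))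

lemma lt_floor_add_one_mul (hτ : 0 < τ) (t : ℝ) : t < ((⌊t / τ⌋₊ : ℝ) + 1) * τ :=
  (div_lt_iff₀ hτ).1 (Nat.lt_floor_add_one _)

/-- The Euler scheme with cutoff `ε'` and step `τ` is an approximate solution for every other cutoff
`ε`. Its stability only requires `τ` to be small in terms of `ε'`; the fixed error, due to times
between the grid points, is `O(τ)`. -/
lemma approxSol_eulerInterp (hd : StepData β C r s K D) (hT : Horizon C s K A₀ c T)
    (hN : GoodFn A₀ N₀) (hc : ∀ ω : ℝ, 0 < ω → c ≤ N₀ ω) (hε' : 0 < ε') (hτ : 0 < τ)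
    (hτε : τ * (4 * (C ^ 3 * (2 * A₀) ^ 2 * (ε' ^ 3)⁻¹)) ≤ 1) (hε : 0 < ε) :
    ApproxSol β ε (cutError C s (2 * A₀) ε + cutError C s (2 * A₀) ε')
      (regLip C (2 * A₀) ε * supRate C s (2 * A₀))
      (τ * (cutError C s (2 * A₀) ε + cutError C s (2 * A₀) ε' +
        regLip C (2 * A₀) ε * supRate C s (2 * A₀) * T + supRate C s (2 * A₀))) T
      (eulerInterp β ε' τ N₀) := by
  intro a b ha hab hb ω hω
  have hA : 0 ≤ 2 * A₀ := by linarith [hN.nonneg]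
  have hS := hd.supRate_nonneg hA
  have hL := hd.regLip_nonneg (A := 2 * A₀) hε
  have hκ₁ := hd.cutError_nonneg hA hε
  have hκ₂ := hd.cutError_nonneg hA hε'
  have hbd := fun k hk => (euler_bounds hd hT hN hc hε' hτ.le hτε k hk).1
  unfold eulerInterp
  set i := ⌊a / τ⌋₊ with hi
  set j := ⌊b / τ⌋₊ with hj
  have hij : i ≤ j := Nat.floor_mono (div_le_div_of_nonneg_right hab hτ.le)
  have i1 : i * τ ≤ a := floor_mul_le hτ ha
  have i2 : a < (i + 1) * τ := lt_floor_add_one_mul hτ a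
  have j1 : j * τ ≤ b := floor_mul_le hτ (ha.trans hab)
  have j2 : b < (j + 1) * τ := lt_floor_add_one_mul hτ b
  set x := euler β ε' τ N₀ with hx
  set S := supRate C s (2 * A₀) with hSdef
  set L := regLip C (2 * A₀) ε with hLdef
  set κ := cutError C s (2 * A₀) ε + cutError C s (2 * A₀) ε' with hκdef
  have hgood : ∀ m : ℕ, i + m ≤ j → GoodFn (2 * A₀) (x (i + m)) := fun m hm => hbd _ (by
    have : ((i + m : ℕ) : ℝ) * τ ≤ j * τ :=
      mul_le_mul_of_nonneg_right (by exact_mod_cast hm) hτ.le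
    linarith)
  have hJ : ∀ m : ℕ, i + m ≤ j → ∀ y : ℝ, 0 < y → |collisionReg β ε' (x (i + m)) y| ≤ S :=
    fun m hm y hy => abs_collisionReg_le hd.weight hd.exps (hgood m hm) hy hε'.le
  have h1 : ∀ m : ℕ, i + m ≤ j → ∀ y : ℝ, 0 < y → |x (i + m) y - x i y| ≤ m * τ * S := by
    intro m
    induction m with
    | zero => intro _ y _; simp
    | succ m ih =>
      intro hm y hy
      have e : x (i + (m + 1)) y - x i y =
          (x (i + m) y - x i y) + τ * collisionReg β ε' (x (i + m)) y := by
        rw [← add_assoc, hx]; simp only [euler]; ring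
      rw [e]
      refine (abs_add_le _ _).trans ?_
      rw [abs_mul, abs_of_pos hτ]
      have := ih (by omega) y hy
      have := mul_le_mul_of_nonneg_left (hJ m (by omega) y hy) hτ.le
      push_cast
      linarith
  have h2 : ∀ m : ℕ, i + m ≤ j → |x (i + m) ω - x i ω - m * τ * collisionReg β ε (x i) ω| ≤
      m * τ * (κ + L * S * (b - a)) := by
    intro m
    induction m with
    | zero => intro _; simp
    | succ m ih =>
      intro hm
      have hm' : i + m ≤ j := by omega
      have hmτ : m * τ ≤ b - a := by
        have : ((i + (m + 1) : ℕ) : ℝ) * τ ≤ j * τ :=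
          mul_le_mul_of_nonneg_right (by exact_mod_cast hm) hτ.le
        push_cast at this
        linarith
      have e : x (i + (m + 1)) ω - x i ω - ((m + 1 : ℕ) : ℝ) * τ * collisionReg β ε (x i) ω =
          (x (i + m) ω - x i ω - m * τ * collisionReg β ε (x i) ω) +
          τ * ((collision β (x (i + m)) ω - collisionReg β ε (x (i + m)) ω) * (-1) * (-1) -
            (collision β (x (i + m)) ω - collisionReg β ε' (x (i + m)) ω) +
            (collisionReg β ε (x (i + m)) ω - collisionReg β ε (x i) ω)) := by
        have e0 : x (i + m + 1) ω = x (i + m) ω + τ * collisionReg β ε' (x (i + m)) ω := by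
          rw [hx]; simp only [euler]
        rw [← add_assoc, e0]; push_cast; ring
      have c1 := abs_collision_sub_collisionReg_le hd.weight hd.exps (hgood m hm') hω hε.le
      have c2 := abs_collision_sub_collisionReg_le hd.weight hd.exps (hgood m hm') hω hε'.le
      have c3 := abs_collisionReg_sub_le hd.weight hd.exps (hgood m hm')
        (by simpa using hgood 0 (by omega)) hε (h1 m hm') hω
      have c4 : 48 * C ^ 3 * (2 * A₀) ^ 2 * (ε ^ 3)⁻¹ * (m * τ * S) ≤ L * S * (b - a) := by
        have := mul_le_mul_of_nonneg_left hmτ (mul_nonneg hL hS)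
        rw [hLdef, regLip] at *
        linarith
      have c5 : |(collision β (x (i + m)) ω - collisionReg β ε (x (i + m)) ω) * (-1) * (-1) -
            (collision β (x (i + m)) ω - collisionReg β ε' (x (i + m)) ω) +
            (collisionReg β ε (x (i + m)) ω - collisionReg β ε (x i) ω)| ≤
            κ + L * S * (b - a) := by
        rw [hκdef, cutError, cutError]
        rw [abs_le] at *
        constructor <;> linarith [c1.1, c1.2, c2.1, c2.2, c3.1, c3.2]
      rw [e]
      refine (abs_add_le _ _).trans ?_
      rw [abs_mul τ, abs_of_pos hτ]
      have := mul_le_mul_of_nonneg_left c5 hτ.le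
      have := ih hm'
      push_cast
      linarith
  clear_value j
  obtain ⟨m, rfl⟩ : ∃ m, j = i + m := ⟨j - i, by omega⟩
  push_cast at j1 j2
  have h3 := h2 m le_rfl
  have h4 : |collisionReg β ε (x i) ω| ≤ S :=
    abs_collisionReg_le hd.weight hd.exps (by simpa using hgood 0 (by omega)) hω hε.le
  have h5 : |m * τ - (b - a)| ≤ τ := abs_le.2 ⟨by linarith, by linarith⟩
  have h6 : x (i + m) ω - x i ω - (b - a) * collisionReg β ε (x i) ω =
      (x (i + m) ω - x i ω - m * τ * collisionReg β ε (x i) ω) +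
      (m * τ - (b - a)) * collisionReg β ε (x i) ω := by ring
  rw [h6]
  refine (abs_add_le _ _).trans ?_
  rw [abs_mul]
  have h7 := mul_le_mul h5 h4 (abs_nonneg _) hτ.le
  have hκ0 : 0 ≤ κ := add_nonneg hκ₁ hκ₂
  have h8 : m * τ * (κ + L * S * (b - a)) ≤ (b - a + τ) * (κ + L * S * (b - a)) :=
    mul_le_mul_of_nonneg_right (by linarith)
      (add_nonneg hκ0 (mul_nonneg (mul_nonneg hL hS) (by linarith)))
  have h9 : τ * (κ + L * S * (b - a)) ≤ τ * (κ + L * S * T) := by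
    have : L * S * (b - a) ≤ L * S * T :=
      mul_le_mul_of_nonneg_left (by linarith) (mul_nonneg hL hS)
    exact mul_le_mul_of_nonneg_left (by linarith) hτ.le
  linarith

lemma StepData.tendsto_cutError (hd : StepData β C r s K D) :
    Filter.Tendsto (cutError C s A) (nhdsWithin 0 (Ioi 0)) (nhds 0) := by
  have := (tendsto_cutMass hd.exps.s_gt).const_mul (20 * C ^ 3 * A ^ 3)
  rwa [mul_zero] at this

/-- The limit of the Euler scheme as cutoff and step tend to `0`; it inherits all bounds that are
uniform in the two parameters. -/
theorem exists_limit (hd : StepData β C r s K D) (hT : Horizon C s K A₀ c T)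
    (hN : GoodFn A₀ N₀) (hc : ∀ ω : ℝ, 0 < ω → c ≤ N₀ ω) :
    ∃ N : ℝ → ℝ → ℝ, (∀ t ∈ Icc 0 T, GoodFn (2 * A₀) (N t)) ∧
      (∀ t ∈ Icc 0 T, ∀ ω : ℝ, 0 < ω → c / 2 ≤ N t ω) ∧ (∀ ω : ℝ, 0 < ω → N 0 ω = N₀ ω) ∧
      (∀ ε : ℝ, 0 < ε → ApproxSol β ε (cutError C s (2 * A₀) ε)
        (regLip C (2 * A₀) ε * supRate C s (2 * A₀)) 0 T N) ∧
      (∀ p : ℕ, 1 ≤ p → r * p = 1 → ∀ a : ℝ, 0 < a → ∀ t ∈ Icc 0 T,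
        energy p (fun x => N t (x * a) - N t x) ≤
          ENNReal.ofReal (Real.exp (energyGrowth K D s (2 * A₀) * (p * T))) *
            energy p (fun x => N₀ (x * a) - N₀ x)) := by
  have hA : 0 ≤ 2 * A₀ := by linarith [hN.nonneg]
  have hT0 := hT.T_pos
  have hC := hd.weight.one_le
  have hS := hd.supRate_nonneg hA
  -- cutoffs and time steps tending to `0`, the latter so fast that the scheme is stable
  let e : ℕ → ℝ := fun n => 1 / ((n : ℝ) + 1)
  let σ : ℕ → ℝ := fun n => e n / (1 + 4 * (C ^ 3 * (2 * A₀) ^ 2 * (e n ^ 3)⁻¹))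
  have he : ∀ n, 0 < e n := fun n => by positivity
  have hden : ∀ n, 0 ≤ 4 * (C ^ 3 * (2 * A₀) ^ 2 * (e n ^ 3)⁻¹) := fun n => by
    have := he n; positivity
  have hσ : ∀ n, 0 < σ n := fun n => div_pos (he n) (by linarith [hden n])
  have hσe : ∀ n, σ n ≤ e n := fun n => div_le_self (he n).le (by linarith [hden n])
  have he1 : ∀ n, e n ≤ 1 := fun n => by
    have : (0 : ℝ) ≤ n := Nat.cast_nonneg n
    exact div_le_one_of_le₀ (by linarith) (by linarith)
  have hστ : ∀ n, σ n * (4 * (C ^ 3 * (2 * A₀) ^ 2 * (e n ^ 3)⁻¹)) ≤ 1 := fun n => by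
    have h1 := hden n
    have h2 := he1 n
    rw [div_mul_eq_mul_div, div_le_one (by linarith)]
    nlinarith
  have he0 : Filter.Tendsto e Filter.atTop (nhds 0) := tendsto_one_div_add_atTop_nhds_zero_nat
  have hσ0 : Filter.Tendsto σ Filter.atTop (nhds 0) :=
    squeeze_zero (fun n => (hσ n).le) hσe he0
  let κ : ℕ → ℝ := fun n => cutError C s (2 * A₀) (e n)
  have hκ0 : Filter.Tendsto κ Filter.atTop (nhds 0) :=
    hd.tendsto_cutError.comp (tendsto_nhdsWithin_iff.2 ⟨he0, Filter.Eventually.of_forall he⟩)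
  let X : ℕ → ℝ → ℝ → ℝ := fun n => eulerInterp β (e n) (σ n) N₀
  have hXk : ∀ n, ∀ t ∈ Icc 0 T, (⌊t / σ n⌋₊ : ℝ) * σ n ≤ T := fun n t ht =>
    (floor_mul_le (hσ n) ht.1).trans ht.2
  have hXb : ∀ n, ∀ t ∈ Icc 0 T, GoodFn (2 * A₀) (X n t) ∧
      ∀ ω : ℝ, 0 < ω → c / 2 ≤ X n t ω := fun n t ht =>
    euler_bounds hd hT hN hc (he n) (hσ n).le (hστ n) _ (hXk n t ht)
  have hX0 : ∀ n, X n 0 = N₀ := fun n => by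
    simp [X, eulerInterp, euler]
  let θ : ℝ → ℕ → ℝ := fun ε n => σ n * (cutError C s (2 * A₀) ε + κ n +
    regLip C (2 * A₀) ε * supRate C s (2 * A₀) * T + supRate C s (2 * A₀))
  have hθ0 : ∀ ε, Filter.Tendsto (θ ε) Filter.atTop (nhds 0) := fun ε => by
    have := hσ0.mul (((hκ0.const_add (cutError C s (2 * A₀) ε)).add_const
      (regLip C (2 * A₀) ε * supRate C s (2 * A₀) * T)).add_const (supRate C s (2 * A₀)))
    rwa [zero_mul] at this
  have hXa : ∀ ε, 0 < ε → ∀ n, ApproxSol β ε (cutError C s (2 * A₀) ε + κ n)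
      (regLip C (2 * A₀) ε * supRate C s (2 * A₀)) (θ ε n) T (X n) := fun ε hε n =>
    approxSol_eulerInterp hd hT hN hc (he n) (hσ n) (hστ n) hε
  set E := Real.exp (supGrowth K s (2 * A₀) * T) with hE
  have hE0 : 0 < E := Real.exp_pos _
  have hκn : ∀ n, 0 ≤ κ n := fun n => hd.cutError_nonneg hA (he n)
  -- the scheme is uniformly Cauchy
  have hcauchy : ∀ η : ℝ, 0 < η → ∃ n₀, ∀ n ≥ n₀, ∀ m ≥ n₀, ∀ t ∈ Icc 0 T, ∀ ω : ℝ, 0 < ω →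
      |X n t ω - X m t ω| ≤ η := by
    intro η hη
    have hη' : 0 < η / (E * 8) := by positivity
    obtain ⟨ε, hε1, hε⟩ : ∃ ε, T * cutError C s (2 * A₀) ε < η / (E * 8) ∧ 0 < ε := by
      have h1 : Filter.Tendsto (fun ε => T * cutError C s (2 * A₀) ε) (nhdsWithin 0 (Ioi 0))
        (nhds 0) := by simpa using hd.tendsto_cutError.const_mul T
      exact ((h1.eventually_lt_const hη').and self_mem_nhdsWithin).exists
    set L := regLip C (2 * A₀) ε * supRate C s (2 * A₀) with hL
    have hL0 : 0 ≤ L := mul_nonneg (hd.regLip_nonneg hε) hS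
    have hdiv : ∀ c : ℝ, Filter.Tendsto (fun n : ℕ => T / n * c) Filter.atTop (nhds 0) :=
      fun c => by simpa using (tendsto_const_div_atTop_nhds_zero_nat T).mul_const c
    obtain ⟨j, ⟨hj1, hj2⟩, hj⟩ := (((hdiv (4 * (C ^ 3 * (2 * A₀) ^ 2 * (ε ^ 3)⁻¹))
      |>.eventually_le_const one_pos).and
      ((hdiv (T * L)).eventually_lt_const hη')).and (Filter.eventually_gt_atTop 0)).exists
    have hj' : (0 : ℝ) < j := by exact_mod_cast hj
    have hlim : Filter.Tendsto (fun n => T * κ n + j * θ ε n) Filter.atTop (nhds 0) := by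
      simpa using (hκ0.const_mul T).add ((hθ0 ε).const_mul (j : ℝ))
    obtain ⟨n₀, hn₀⟩ := Filter.eventually_atTop.1 (hlim.eventually_lt_const hη')
    refine ⟨n₀, fun n hn m hm t ht ω hω => ?_⟩
    have hjt : t / j ≤ T / j := div_le_div_of_nonneg_right ht.2 hj'.le
    have h4 : 0 ≤ 4 * (C ^ 3 * (2 * A₀) ^ 2 * (ε ^ 3)⁻¹) := by positivity
    have h1 := (hXa ε hε n).abs_sub_le hd (hXa ε hε m) (fun t ht => (hXb n t ht).1)
      (fun t ht => (hXb m t ht).1)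
      (fun t ht x hx => (half_pos hT.c_pos).le.trans ((hXb n t ht).2 x hx)) hε (q₀ := 0)
      (fun x _ => by rw [hX0, hX0]; simp) ht hj
      ((mul_le_mul_of_nonneg_right hjt h4).trans hj1) hω
    refine h1.trans ?_
    have h5 : 0 ≤ t / j := div_nonneg ht.1 hj'.le
    have hκε := hd.cutError_nonneg hA hε
    have h6 : t * (cutError C s (2 * A₀) ε + κ n + (cutError C s (2 * A₀) ε + κ m) +
        (L + L) * (t / j)) ≤ T * (cutError C s (2 * A₀) ε + κ n +
        (cutError C s (2 * A₀) ε + κ m) + (L + L) * (T / j)) := by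
      refine mul_le_mul ht.2 ?_ ?_ hT0.le
      · have := mul_le_mul_of_nonneg_left hjt (add_nonneg hL0 hL0)
        linarith
      · have := mul_nonneg (add_nonneg hL0 hL0) h5
        linarith [hκn n, hκn m]
    have h7 : 0 + (t * (cutError C s (2 * A₀) ε + κ n + (cutError C s (2 * A₀) ε + κ m) +
        (L + L) * (t / j)) + j * (θ ε n + θ ε m)) ≤ η / E := by
      have e1 : η / E = 8 * (η / (E * 8)) := by field_simp
      have := hn₀ n hn
      have := hn₀ m hm
      rw [e1]
      linarith
    have h8 : Real.exp (supGrowth K s (2 * A₀) * t) ≤ E :=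
      Real.exp_le_exp.2 (mul_le_mul_of_nonneg_left ht.2 hd.supGrowth_nonneg)
    calc _ ≤ Real.exp (supGrowth K s (2 * A₀) * t) * (η / E) :=
          mul_le_mul_of_nonneg_left h7 (Real.exp_pos _).le
      _ ≤ E * (η / E) := mul_le_mul_of_nonneg_right h8 (by positivity)
      _ = η := mul_div_cancel₀ _ hE0.ne'
  have hconv : ∀ t ∈ Icc 0 T, ∀ ω : ℝ, 0 < ω →
      ∃ y, Filter.Tendsto (fun n => X n t ω) Filter.atTop (nhds y) := by
    intro t ht ω hω
    refine cauchySeq_tendsto_of_complete (Metric.cauchySeq_iff.2 fun η hη => ?_)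
    obtain ⟨n₀, h⟩ := hcauchy (η / 2) (half_pos hη)
    exact ⟨n₀, fun m hm n hn => (h m hm n hn t ht ω hω).trans_lt (half_lt_self hη)⟩
  choose! N hlim using hconv
  have hunif : ∀ η : ℝ, 0 < η → ∃ n₀, ∀ n ≥ n₀, ∀ t ∈ Icc 0 T, ∀ ω : ℝ, 0 < ω →
      |X n t ω - N t ω| ≤ η := by
    intro η hη
    obtain ⟨n₀, h⟩ := hcauchy η hη
    refine ⟨n₀, fun n hn t ht ω hω => ?_⟩
    refine le_of_tendsto ((hlim t ht ω hω).const_sub (X n t ω)).abs ?_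
    filter_upwards [Filter.eventually_ge_atTop n₀] with m hm using h n hn m hm t ht ω hω
  have hgN : ∀ t ∈ Icc 0 T, GoodFn (2 * A₀) (N t) := fun t ht =>
    ⟨fun ω hω => le_of_tendsto (hlim t ht ω hω).abs
      (Filter.Eventually.of_forall fun n => (hXb n t ht).1.bound ω hω),
    fun x hx y hy => le_of_tendsto ((hlim t ht x hx).sub (hlim t ht y hy)).abs
      (Filter.Eventually.of_forall fun n => (hXb n t ht).1.lip x hx y hy)⟩
  have h0T : (0 : ℝ) ∈ Icc 0 T := ⟨le_rfl, hT0.le⟩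
  refine ⟨N, hgN, fun t ht ω hω => ge_of_tendsto (hlim t ht ω hω)
    (Filter.Eventually.of_forall fun n => (hXb n t ht).2 ω hω), fun ω hω => ?_, ?_, ?_⟩
  · refine tendsto_nhds_unique (hlim 0 h0T ω hω) ?_
    simp only [hX0]
    exact tendsto_const_nhds
  · intro ε hε a b ha hab hb ω hω
    have ha' : a ∈ Icc 0 T := ⟨ha, hab.trans hb⟩
    have hb' : b ∈ Icc 0 T := ⟨ha.trans hab, hb⟩
    have hJ : Filter.Tendsto (fun n => collisionReg β ε (X n a) ω) Filter.atTop
        (nhds (collisionReg β ε (N a) ω)) := by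
      rw [Metric.tendsto_atTop]
      intro η hη
      have hL := hd.regLip_nonneg (A := 2 * A₀) hε
      obtain ⟨n₀, h⟩ := hunif (η / (2 * (regLip C (2 * A₀) ε + 1))) (by positivity)
      refine ⟨n₀, fun n hn => ?_⟩
      have h1 := abs_collisionReg_sub_le hd.weight hd.exps (hXb n a ha').1 (hgN a ha') hε
        (h n hn a ha') hω
      rw [Real.dist_eq]
      refine h1.trans_lt ?_
      change regLip C (2 * A₀) ε * _ < η
      rw [mul_div_assoc', div_lt_iff₀ (by positivity)]
      nlinarith
    have h1 := (((hlim b hb' ω hω).sub (hlim a ha' ω hω)).sub (hJ.const_mul (b - a))).abs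
    have h2 : Filter.Tendsto (fun n => (b - a) * (cutError C s (2 * A₀) ε + κ n +
        regLip C (2 * A₀) ε * supRate C s (2 * A₀) * (b - a)) + θ ε n) Filter.atTop
        (nhds ((b - a) * (cutError C s (2 * A₀) ε +
          regLip C (2 * A₀) ε * supRate C s (2 * A₀) * (b - a)) + 0)) := by
      have := (((hκ0.const_add (cutError C s (2 * A₀) ε)).add_const
        (regLip C (2 * A₀) ε * supRate C s (2 * A₀) * (b - a))).const_mul (b - a)).add (hθ0 ε)
      rwa [add_zero (cutError C s (2 * A₀) ε)] at this
    exact le_of_tendsto_of_tendsto' h1 h2 fun n => hXa ε hε n a b ha hab hb ω hω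
  · intro p hp hrp a ha t ht
    have hc' : ∀ n, ContinuousOn (fun x => X n t (x * a) - X n t x) (Ioi 0) := fun n =>
      ((hXb n t ht).1.dilate ha).continuousOn.sub (hXb n t ht).1.continuousOn
    have h1 : energy p (fun x => N t (x * a) - N t x) ≤
        Filter.liminf (fun n => energy p (fun x => X n t (x * a) - X n t x)) Filter.atTop := by
      refine le_trans (le_of_eq ?_) (lintegral_liminf_le' (fun n =>
        (((hc' n).abs.pow p).aemeasurable measurableSet_Ioi).ennreal_ofReal))
      refine setLIntegral_congr_fun measurableSet_Ioi fun x hx => ?_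
      refine (Filter.Tendsto.liminf_eq ?_).symm
      exact (ENNReal.continuous_ofReal.tendsto _).comp
        ((((hlim t ht _ (mul_pos hx ha)).sub (hlim t ht x hx)).abs).pow p)
    refine h1.trans (Filter.liminf_le_of_le (by isBoundedDefault) fun b hb => ?_)
    obtain ⟨n, hn⟩ := hb.exists
    exact hn.trans (euler_energy_le hd hT hN hc (he n) (hσ n).le (hστ n) hp hrp ha _ (hXk n t ht))

end

/-! ### Weak derivatives -/

section WeakDerivative

variable {N G : ℝ → ℝ}

lemma contDiff_smoothTransition : ContDiff ℝ (⊤ : ℕ∞) Real.smoothTransition :=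
  Real.smoothTransition.contDiff

/-- A smooth version of the indicator function of `(c, ∞)`, at the scale `1 / n`. -/
noncomputable def smoothStep (c : ℝ) (n : ℕ) (x : ℝ) : ℝ := Real.smoothTransition (n * (x - c))

lemma contDiff_smoothStep (c : ℝ) (n : ℕ) : ContDiff ℝ (⊤ : ℕ∞) (smoothStep c n) :=
  contDiff_smoothTransition.comp (contDiff_const.mul (contDiff_id.sub contDiff_const))

lemma smoothStep_of_le {c x : ℝ} (n : ℕ) (h : x ≤ c) : smoothStep c n x = 0 :=
  Real.smoothTransition.zero_of_nonpos
    (mul_nonpos_of_nonneg_of_nonpos (Nat.cast_nonneg n) (by linarith))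

lemma smoothStep_of_ge {c x : ℝ} {n : ℕ} (h : 1 ≤ n * (x - c)) : smoothStep c n x = 1 :=
  Real.smoothTransition.one_of_one_le h

lemma monotone_smoothStep (c : ℝ) (n : ℕ) : Monotone (smoothStep c n) := fun x y h =>
  Real.smoothTransition.monotone (mul_le_mul_of_nonneg_left (by linarith) (Nat.cast_nonneg n))

lemma deriv_smoothStep_nonneg (c : ℝ) (n : ℕ) (x : ℝ) : 0 ≤ deriv (smoothStep c n) x :=
  (monotone_smoothStep c n).deriv_nonneg

lemma deriv_smoothStep_of_lt {c x : ℝ} (n : ℕ) (h : x < c) : deriv (smoothStep c n) x = 0 := by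
  have : smoothStep c n =ᶠ[nhds x] fun _ => 0 := by
    filter_upwards [Iio_mem_nhds h] with y hy using smoothStep_of_le n (le_of_lt hy)
  rw [this.deriv_eq, deriv_const]

lemma deriv_smoothStep_of_gt {c x : ℝ} {n : ℕ} (h : 1 < n * (x - c)) :
    deriv (smoothStep c n) x = 0 := by
  have : smoothStep c n =ᶠ[nhds x] fun _ => 1 := by
    have hc : ContinuousAt (fun y : ℝ => n * (y - c)) x := by fun_prop
    filter_upwards [hc.eventually_const_lt h] with y hy using smoothStep_of_ge hy.le
  rw [this.deriv_eq, deriv_const]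

/-- The derivatives of the smooth steps at `c` are an approximate identity at `c`. -/
lemma tendsto_integral_mul_deriv_smoothStep {y z c : ℝ} (hyc : y ≤ c) (hcz : c < z)
    (hN : ContinuousOn N (Icc y z)) :
    Filter.Tendsto (fun n : ℕ => ∫ x in Icc y z, N x * deriv (smoothStep c n) x) Filter.atTop
      (nhds (N c)) := by
  have hyz : y ≤ z := hyc.trans hcz.le
  have hc : c ∈ Icc y z := ⟨hyc, hcz.le⟩
  have h := tendsto_setIntegral_peak_smul_of_integrableOn_of_tendsto (μ := volume) (x₀ := c)
    (φ := fun (n : ℕ) x => deriv (smoothStep c n) x) (l := Filter.atTop) (g := N) (a := N c)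
    (measurableSet_Icc (a := y) (b := z)) measurableSet_Icc subset_rfl self_mem_nhdsWithin
    (by simp) (Filter.Eventually.of_forall fun n x _ => deriv_smoothStep_nonneg c n x) ?_ ?_ ?_
    hN.integrableOn_Icc (hN c hc)
  · simpa only [smul_eq_mul, mul_comm] using h
  · intro u hu hcu
    obtain ⟨δ, hδ, hδu⟩ := Metric.isOpen_iff.1 hu c hcu
    obtain ⟨n₀, hn₀⟩ := exists_nat_gt (1 / δ)
    rw [Metric.tendstoUniformlyOn_iff]
    intro η hη
    filter_upwards [Filter.eventually_ge_atTop n₀] with n hn x hx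
    have hxc : δ ≤ |x - c| := by
      by_contra hlt
      exact hx.2 (hδu (by rw [Metric.mem_ball, Real.dist_eq]; exact not_le.1 hlt))
    have hnδ : 1 < n * δ := by
      have : 1 / δ < n := hn₀.trans_le (by exact_mod_cast hn)
      rwa [div_lt_iff₀ hδ] at this
    have : deriv (smoothStep c n) x = 0 := by
      rcases le_total x c with hle | hle
      · rw [abs_of_nonpos (by linarith)] at hxc
        exact deriv_smoothStep_of_lt n (by linarith)
      · rw [abs_of_nonneg (by linarith)] at hxc
        exact deriv_smoothStep_of_gt
          (hnδ.trans_le (mul_le_mul_of_nonneg_left hxc (Nat.cast_nonneg n)))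
    rw [this]
    simpa using hη
  · obtain ⟨n₀, hn₀⟩ := exists_nat_gt (1 / (z - c))
    refine tendsto_const_nhds.congr' ?_
    filter_upwards [Filter.eventually_ge_atTop n₀] with n hn
    have h1 : 1 / (z - c) < n := hn₀.trans_le (by exact_mod_cast hn)
    rw [div_lt_iff₀ (by linarith)] at h1
    rw [integral_Icc_eq_integral_Ioc, ← intervalIntegral.integral_of_le hyz,
      intervalIntegral.integral_deriv_eq_sub
        (fun x _ => (contDiff_smoothStep c n).differentiable (by simp) x)
        (((contDiff_smoothStep c n).continuous_deriv (by simp)).intervalIntegrable _ _),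
      smoothStep_of_ge h1.le, smoothStep_of_le n hyc, sub_zero]
  · exact Filter.Eventually.of_forall fun n =>
      ((contDiff_smoothStep c n).continuous_deriv (by simp)).aestronglyMeasurable

/-- A continuous function with a weak derivative satisfies the fundamental theorem of calculus. -/
lemma IsWeakD.sub_eq_integral (h : IsWeakD N G) (hN : ContinuousOn N (Ioi 0)) {y z : ℝ}
    (hy : 0 < y) (hyz : y ≤ z) : N z - N y = ∫ ω in Ioc y z, G ω / ω := by
  obtain ⟨-, hG, hφ⟩ := h
  have hsub : Icc y (z + 1) ⊆ Ioi 0 := fun x hx => hy.trans_le hx.1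
  have hNc : ContinuousOn N (Icc y (z + 1)) := hN.mono hsub
  have hGi : IntegrableOn (fun ω => G ω / ω) (Icc y (z + 1)) := by
    simp only [div_eq_mul_inv]
    exact (hG.integrableOn_compact_subset hsub isCompact_Icc).mul_continuousOn
      (continuousOn_id.inv₀ fun x hx => (hsub hx).ne') isCompact_Icc
  -- smooth versions of the indicator function of `(y, z]`
  let φ : ℕ → ℝ → ℝ := fun n x => smoothStep y n x - smoothStep z n x
  have hφd : ∀ n, ContDiff ℝ (⊤ : ℕ∞) (φ n) := fun n =>
    (contDiff_smoothStep y n).sub (contDiff_smoothStep z n)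
  have hφ0 : ∀ n : ℕ, 1 ≤ n → ∀ x, x ∉ Icc y (z + 1) → φ n x = 0 := by
    intro n hn x hx
    have hn1 : (1 : ℝ) ≤ n := by exact_mod_cast hn
    simp only [φ]
    rcases lt_or_ge x y with hlt | hge
    · rw [smoothStep_of_le n hlt.le, smoothStep_of_le n (hlt.le.trans hyz), sub_zero]
    · have hxz : z + 1 < x := by
        by_contra hle
        exact hx ⟨hge, not_lt.1 hle⟩
      rw [smoothStep_of_ge (by nlinarith), smoothStep_of_ge (by nlinarith), sub_self]
  have hts : ∀ n : ℕ, 1 ≤ n → tsupport (φ n) ⊆ Icc y (z + 1) := fun n hn =>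
    closure_minimal (fun x hx => by
      by_contra hxn
      exact hx (hφ0 n hn x hxn)) isClosed_Icc
  have hderiv : ∀ n x, deriv (φ n) x = deriv (smoothStep y n) x - deriv (smoothStep z n) x :=
    fun n x => deriv_fun_sub ((contDiff_smoothStep y n).differentiable (by simp) x)
      ((contDiff_smoothStep z n).differentiable (by simp) x)
  have hint : ∀ c n, IntegrableOn (fun x => N x * deriv (smoothStep c n) x) (Icc y (z + 1)) :=
    fun c n => (hNc.mul
      ((contDiff_smoothStep c n).continuous_deriv (by simp)).continuousOn).integrableOn_Icc
  have hleft : Filter.Tendsto (fun n => ∫ ω in Ioi (0 : ℝ), N ω * deriv (φ n) ω) Filter.atTop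
      (nhds (N y - N z)) := by
    refine ((tendsto_integral_mul_deriv_smoothStep le_rfl (by linarith) hNc).sub
      (tendsto_integral_mul_deriv_smoothStep hyz (by linarith) hNc)).congr' ?_
    filter_upwards [Filter.eventually_ge_atTop 1] with n hn
    rw [← integral_sub (hint y n) (hint z n),
      setIntegral_eq_of_subset_of_forall_sdiff_eq_zero measurableSet_Ioi hsub]
    · refine setIntegral_congr_fun measurableSet_Icc fun x _ => ?_
      simp only [hderiv]; ring
    · intro x hx
      have : deriv (φ n) x = 0 := by
        by_contra hne
        exact hx.2 (hts n hn (support_deriv_subset hne))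
      rw [this, mul_zero]
  have hright : Filter.Tendsto (fun n => -∫ ω in Ioi (0 : ℝ), G ω / ω * φ n ω) Filter.atTop
      (nhds (-∫ ω in Ioc y z, G ω / ω)) := by
    have hind : ∫ ω in Ioc y z, G ω / ω =
        ∫ ω in Icc y (z + 1), (Ioc y z).indicator (fun ω => G ω / ω) ω := by
      rw [setIntegral_indicator measurableSet_Ioc]
      congr 2
      exact (inter_eq_right.2 (show Ioc y z ⊆ Icc y (z + 1) from
        fun x hx => ⟨hx.1.le, by linarith [hx.2]⟩)).symm
    rw [hind]
    have hD : Filter.Tendsto (fun n => ∫ ω in Icc y (z + 1), G ω / ω * φ n ω) Filter.atTop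
        (nhds (∫ ω in Icc y (z + 1), (Ioc y z).indicator (fun ω => G ω / ω) ω)) := by
      refine tendsto_integral_of_dominated_convergence (fun ω => |G ω / ω|)
        (fun n => hGi.aestronglyMeasurable.mul (hφd n).continuous.aestronglyMeasurable)
        hGi.abs (fun n => Filter.Eventually.of_forall fun x => ?_)
        (Filter.Eventually.of_forall fun x => ?_)
      · rw [Real.norm_eq_abs, abs_mul]
        refine mul_le_of_le_one_right (abs_nonneg _) ?_
        have := Real.smoothTransition.le_one (n * (x - y))
        have := Real.smoothTransition.le_one (n * (x - z))
        have := Real.smoothTransition.nonneg (n * (x - y))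
        have := Real.smoothTransition.nonneg (n * (x - z))
        simp only [φ, smoothStep]
        exact abs_le.2 ⟨by linarith, by linarith⟩
      · have hstep : ∀ c, c < x → ∀ᶠ n : ℕ in Filter.atTop, smoothStep c n x = 1 := by
          intro c hcx
          obtain ⟨n₀, hn₀⟩ := exists_nat_gt (1 / (x - c))
          filter_upwards [Filter.eventually_ge_atTop n₀] with n hn
          have h1 : 1 / (x - c) < n := hn₀.trans_le (by exact_mod_cast hn)
          rw [div_lt_iff₀ (by linarith)] at h1
          exact smoothStep_of_ge h1.le
        refine tendsto_const_nhds.congr' ?_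
        by_cases hx : x ∈ Ioc y z
        · filter_upwards [hstep y hx.1] with n hn
          simp only [φ]
          rw [indicator_of_mem hx, hn, smoothStep_of_le n hx.2, sub_zero, mul_one]
        · rcases le_or_gt x y with hle | hgt
          · filter_upwards with n
            simp only [φ]
            rw [indicator_of_notMem hx, smoothStep_of_le n hle, smoothStep_of_le n (hle.trans hyz),
              sub_zero, mul_zero]
          · have hzx : z < x := by
              by_contra hle
              exact hx ⟨hgt, not_lt.1 hle⟩
            filter_upwards [hstep y hgt, hstep z hzx] with n h1 h2
            simp only [φ]
            rw [indicator_of_notMem hx, h1, h2, sub_self, mul_zero]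
    refine hD.neg.congr' ?_
    filter_upwards [Filter.eventually_ge_atTop 1] with n hn
    rw [setIntegral_eq_of_subset_of_forall_sdiff_eq_zero measurableSet_Ioi hsub]
    intro x hx
    rw [hφ0 n hn x hx.2, mul_zero]
  have heq := tendsto_nhds_unique (hleft.congr' (by
    filter_upwards [Filter.eventually_ge_atTop 1] with n hn
    exact hφ (φ n) (hφd n) (HasCompactSupport.intro isCompact_Icc (hφ0 n hn))
      ((hts n hn).trans hsub))) hright
  linarith

end WeakDerivative

/-! ### The space `X` and dilation differences -/

lemma exists_isWeakD_of_normX_lt {p₀ : ℕ} {N : ℝ → ℝ} {B : ℝ≥0∞} (h : normX p₀ N < B) :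
    ∃ G : ℝ → ℝ, IsWeakD N G ∧ eLpNorm N ∞ halfLine ≤ B ∧ eLpNorm G ∞ halfLine ≤ B ∧
      eLpNorm G (2 * (p₀ : ℝ≥0∞)) halfLine ≤ B := by
  unfold normX at h
  have h1 := (le_self_add).trans_lt h
  have h2 := (le_add_self).trans_lt h
  simp only [iInf_lt_iff] at h2
  obtain ⟨G, hG, h3⟩ := h2
  exact ⟨G, hG, h1.le, le_add_self.trans h3.le, le_self_add.trans h3.le⟩

lemma ae_abs_le_of_eLpNorm_top_le {f : ℝ → ℝ} {B : ℝ≥0} (h : eLpNorm f ∞ halfLine ≤ B) :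
    ∀ᵐ x ∂halfLine, |f x| ≤ B := by
  rw [eLpNorm_exponent_top] at h
  filter_upwards [ae_le_eLpNormEssSup (f := f) (μ := halfLine)] with x hx
  have : ‖f x‖ₑ ≤ B := hx.trans h
  rw [enorm_le_coe] at this
  exact_mod_cast this

/-- Jensen's inequality for the power function. -/
lemma pow_lintegral_le {α : Type*} [MeasurableSpace α] {μ : Measure α}
    {f : α → ℝ≥0∞} (hf : AEMeasurable f μ) {p : ℕ} (hp : 1 ≤ p) :
    (∫⁻ a, f a ∂μ) ^ p ≤ μ univ ^ (p - 1) * ∫⁻ a, f a ^ p ∂μ := by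
  have hp0 : (0 : ℝ) < p := by exact_mod_cast hp
  have h := eLpNorm'_le_eLpNorm'_mul_rpow_measure_univ (p := 1) (q := p) one_pos
    (by exact_mod_cast hp) (μ := μ) hf.aestronglyMeasurable
  simp only [eLpNorm'_eq_lintegral_enorm, enorm_eq_self, ENNReal.rpow_one,
    ENNReal.rpow_natCast, div_one] at h
  calc (∫⁻ a, f a ∂μ) ^ p
      ≤ ((∫⁻ a, f a ^ p ∂μ) ^ (1 / (p : ℝ)) * μ univ ^ (1 - 1 / (p : ℝ))) ^ p := by gcongr
    _ = _ := by
      rw [mul_pow, ← ENNReal.rpow_natCast, ← ENNReal.rpow_mul, one_div_mul_cancel hp0.ne',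
        ENNReal.rpow_one, mul_comm, ← ENNReal.rpow_natCast, ← ENNReal.rpow_mul,
        ← ENNReal.rpow_natCast, Nat.cast_sub hp, Nat.cast_one, sub_mul, one_mul,
        one_div_mul_cancel hp0.ne']

section

variable {N G : ℝ → ℝ}

/-- A continuous function in `L^∞` with `D N ∈ L^∞` is bounded and Lipschitz in `log ω`, everywhere. -/
lemma goodFn_of_weakD {B : ℝ≥0} (hN : ContinuousOn N (Ioi 0)) (h : IsWeakD N G)
    (hB : eLpNorm N ∞ halfLine ≤ B) (hG : eLpNorm G ∞ halfLine ≤ B) : GoodFn B N where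
  bound := by
    have h1 := ae_abs_le_of_eLpNorm_top_le hB
    by_contra! hex
    obtain ⟨ω, hω, hlt⟩ := hex
    have h2 : {x | x ∈ Ioi (0 : ℝ) ∧ (B : ℝ) < |N x|} ∈ nhds ω := by
      have := (hN.continuousAt (Ioi_mem_nhds hω)).abs.eventually_const_lt hlt
      filter_upwards [this, Ioi_mem_nhds hω] with x h1 h2 using ⟨h2, h1⟩
    have h3 : volume {x | x ∈ Ioi (0 : ℝ) ∧ (B : ℝ) < |N x|} = 0 := by
      rw [halfLine, ae_restrict_iff' measurableSet_Ioi] at h1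
      refine measure_mono_null (fun x hx => ?_) h1
      simp only [mem_compl_iff, mem_ofPred_eq, not_forall, not_le]
      exact ⟨hx.1, hx.2⟩
    exact (Measure.measure_pos_of_mem_nhds volume h2).ne' h3
  lip := by
    have h1 := ae_abs_le_of_eLpNorm_top_le hG
    have key : ∀ x : ℝ, 0 < x → ∀ y : ℝ, x ≤ y →
        |N y - N x| ≤ B * |Real.log y - Real.log x| := by
      intro x hx y hxy
      have hy := hx.trans_le hxy
      rw [h.sub_eq_integral hN hx hxy, ← Real.norm_eq_abs, ← Real.log_div hy.ne' hx.ne',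
        abs_of_nonneg (Real.log_nonneg ((one_le_div hx).2 hxy)), ← integral_inv_of_pos hx hy,
        intervalIntegral.integral_of_le hxy, ← integral_const_mul]
      refine norm_integral_le_of_norm_le ?_ ?_
      · have hc : ContinuousOn (fun ω : ℝ => (B : ℝ) * ω⁻¹) (Icc x y) :=
          continuousOn_const.mul (continuousOn_id.inv₀ fun z hz => (hx.trans_le hz.1).ne')
        exact hc.integrableOn_Icc.mono_set Ioc_subset_Icc_self
      · have h2 := ae_restrict_of_ae_restrict_of_subset
          (show Ioc x y ⊆ Ioi 0 from fun z hz => hx.trans hz.1) h1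
        filter_upwards [h2, ae_restrict_mem measurableSet_Ioc] with z hz hzm
        have hz0 : 0 < z := hx.trans hzm.1
        rw [Real.norm_eq_abs, abs_div, abs_of_pos hz0, div_eq_mul_inv]
        exact mul_le_mul_of_nonneg_right hz (inv_pos.2 hz0).le
    intro x hx y hy
    rcases le_total x y with hle | hle
    · rw [abs_sub_comm, abs_sub_comm (Real.log x)]
      exact key x hx y hle
    · exact key y hy x hle

/-- Dilation differences are controlled by the weak derivative:
`N(ax) - N(x) = ∫_1^a G(σx) / σ dσ`. -/
lemma energy_dilate_sub_le (hN : ContinuousOn N (Ioi 0)) (h : IsWeakD N G) {p : ℕ} (hp : 1 ≤ p)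
    {a : ℝ} (ha : 1 < a) : energy p (fun x => N (x * a) - N x) ≤
      ENNReal.ofReal ((a - 1) ^ p) * energy p G := by
  have hGm : AEStronglyMeasurable G (volume.restrict (Ioi 0)) := h.2.1.aestronglyMeasurable
  set g := hGm.mk G with hg
  have hgm : Measurable g := hGm.stronglyMeasurable_mk.measurable
  have hGg : G =ᵐ[volume.restrict (Ioi 0)] g := hGm.ae_eq_mk
  have hE : energy p G = energy p g := lintegral_congr_ae (by
    filter_upwards [hGg] with x hx using by rw [hx])
  have hF : Measurable fun z : ℝ × ℝ => ENNReal.ofReal |g (z.1 * z.2)| :=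
    (hgm.comp (measurable_fst.mul measurable_snd)).norm.ennreal_ofReal
  have hpt : ∀ x ∈ Ioi (0 : ℝ), ENNReal.ofReal |N (x * a) - N x| ≤
      ∫⁻ σ in Ioc 1 a, ENNReal.ofReal |g (x * σ)| := by
    intro x hx
    have hx0 : (0 : ℝ) < x := hx
    rw [h.sub_eq_integral hN hx (le_mul_of_one_le_right hx0.le ha.le)]
    rw [← Real.enorm_eq_ofReal_abs]
    refine (enorm_integral_le_lintegral_enorm _).trans ?_
    have hsub : Ioc x (x * a) ⊆ Ioi 0 := fun z hz => hx0.trans hz.1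
    calc ∫⁻ ω in Ioc x (x * a), ‖G ω / ω‖ₑ
        = ∫⁻ ω in Ioc x (x * a), ENNReal.ofReal |g ω / ω| := by
          refine lintegral_congr_ae ?_
          filter_upwards [ae_restrict_of_ae_restrict_of_subset hsub hGg] with z hz
          rw [hz, Real.enorm_eq_ofReal_abs]
      _ = ∫⁻ ω in Ioi (0 : ℝ), (Ioc x (x * a)).indicator
            (fun ω => ENNReal.ofReal |g ω / ω|) ω := by
          rw [setLIntegral_indicator measurableSet_Ioc, inter_eq_left.2 hsub]
      _ = ENNReal.ofReal x * ∫⁻ σ in Ioi (0 : ℝ), (Ioc x (x * a)).indicator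
            (fun ω => ENNReal.ofReal |g ω / ω|) (σ * x) := by
          rw [lintegral_Ioi_comp_mul _ hx0, ← mul_assoc, ← ENNReal.ofReal_mul hx0.le,
            mul_inv_cancel₀ hx0.ne', ENNReal.ofReal_one, one_mul]
      _ = ENNReal.ofReal x * ∫⁻ σ in Ioi (0 : ℝ), (Ioc 1 a).indicator
            (fun σ => ENNReal.ofReal |g (σ * x) / (σ * x)|) σ := by
          congr 2
          funext σ
          have : σ * x ∈ Ioc x (x * a) ↔ σ ∈ Ioc 1 a := by
            rw [mul_comm x a]
            simp only [mem_Ioc, lt_mul_iff_one_lt_left hx0, mul_le_mul_iff_left₀ hx0]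
          by_cases hσ : σ ∈ Ioc 1 a
          · rw [indicator_of_mem hσ, indicator_of_mem (this.2 hσ)]
          · rw [indicator_of_notMem hσ, indicator_of_notMem (fun hc => hσ (this.1 hc))]
      _ = ∫⁻ σ in Ioc 1 a, ENNReal.ofReal x * ENNReal.ofReal |g (σ * x) / (σ * x)| := by
          rw [setLIntegral_indicator measurableSet_Ioc, inter_eq_left.2
            (show Ioc 1 a ⊆ Ioi 0 from fun z hz => one_pos.trans hz.1), lintegral_const_mul' _ _ ENNReal.ofReal_ne_top]
      _ ≤ _ := by
          refine setLIntegral_mono' measurableSet_Ioc fun σ hσ => ?_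
          have hσ0 : 0 < σ := one_pos.trans hσ.1
          rw [← ENNReal.ofReal_mul hx0.le, abs_div, abs_of_pos (mul_pos hσ0 hx0), mul_comm σ x]
          refine ENNReal.ofReal_le_ofReal ?_
          rw [mul_div_assoc', mul_div_mul_left _ _ hx0.ne']
          exact div_le_self (abs_nonneg _) hσ.1.le
  calc energy p (fun x => N (x * a) - N x)
      ≤ ∫⁻ x in Ioi (0 : ℝ), ENNReal.ofReal (a - 1) ^ (p - 1) *
          ∫⁻ σ in Ioc 1 a, ENNReal.ofReal |g (x * σ)| ^ p := by
        refine setLIntegral_mono' measurableSet_Ioi fun x hx => ?_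
        rw [ENNReal.ofReal_pow (abs_nonneg _)]
        refine (pow_le_pow_left' (hpt x hx) p).trans ?_
        refine (pow_lintegral_le ?_ hp).trans_eq ?_
        · exact (hF.comp (measurable_const.prodMk measurable_id)).aemeasurable
        · simp
    _ = ENNReal.ofReal (a - 1) ^ (p - 1) *
          ∫⁻ σ in Ioc 1 a, ∫⁻ x in Ioi (0 : ℝ), ENNReal.ofReal |g (x * σ)| ^ p := by
        rw [lintegral_const_mul' _ _ (by finiteness), lintegral_lintegral_swap]
        exact (hF.pow_const p).aemeasurable
    _ ≤ ENNReal.ofReal (a - 1) ^ (p - 1) * ∫⁻ σ in Ioc 1 a, energy p g := by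
        refine mul_le_mul_right (?_ : _ ≤ _) _
        refine setLIntegral_mono' measurableSet_Ioc fun σ hσ => ?_
        have hσ0 : 0 < σ := one_pos.trans hσ.1
        rw [lintegral_Ioi_comp_mul (fun x => ENNReal.ofReal |g x| ^ p) hσ0]
        have h1 : ENNReal.ofReal σ⁻¹ ≤ 1 :=
          ENNReal.ofReal_le_one.2 (inv_le_one_of_one_le₀ hσ.1.le)
        refine (mul_le_of_le_one_left' h1).trans_eq ?_
        simp only [energy, ENNReal.ofReal_pow (abs_nonneg _)]
    _ = ENNReal.ofReal ((a - 1) ^ p) * energy p G := by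
        rw [hE, setLIntegral_const, Real.volume_Ioc, mul_comm (energy p g), ← mul_assoc,
          ← pow_succ, Nat.sub_add_cancel hp, ENNReal.ofReal_pow (by linarith)]

end

section

variable {N : ℝ → ℝ} {A : ℝ}

lemma GoodFn.lipschitzWith_exp (h : GoodFn A N) :
    LipschitzWith A.toNNReal (fun t => N (Real.exp t)) :=
  LipschitzWith.of_dist_le_mul fun x y => by
    have := h.lip _ (Real.exp_pos x) _ (Real.exp_pos y)
    rwa [Real.log_exp, Real.log_exp, ← Real.dist_eq, ← Real.dist_eq,
      ← Real.coe_toNNReal A h.nonneg] at this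

/-- Where `N` is not differentiable, `deriv N` is `0` and the bound holds as well. -/
lemma GoodFn.abs_mul_deriv_le (h : GoodFn A N) {ω : ℝ} (hω : 0 < ω) : |ω * deriv N ω| ≤ A := by
  by_cases hd : DifferentiableAt ℝ N ω
  · have h1 := norm_deriv_le_of_lipschitz h.lipschitzWith_exp (x₀ := Real.log ω)
    have h2 : HasDerivAt N (deriv N ω) (Real.exp (Real.log ω)) := by
      rw [Real.exp_log hω]; exact hd.hasDerivAt
    have h3 := (h2.comp (Real.log ω) (Real.hasDerivAt_exp _)).deriv
    change deriv (fun t => N (Real.exp t)) _ = _ at h3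
    rw [h3, Real.exp_log hω, Real.coe_toNNReal A h.nonneg, Real.norm_eq_abs] at h1
    rwa [mul_comm]
  · rw [deriv_zero_of_not_differentiableAt hd, mul_zero, abs_zero]
    exact h.nonneg

lemma GoodFn.lipschitzOnWith_Ici (h : GoodFn A N) {δ : ℝ} (hδ : 0 < δ) :
    LipschitzOnWith (A / δ).toNNReal N (Ici δ) := by
  refine LipschitzOnWith.of_dist_le_mul fun x hx y hy => ?_
  have hA := h.nonneg
  have hlog : ∀ {x y : ℝ}, δ ≤ x → x ≤ y → |Real.log x - Real.log y| ≤ |x - y| / δ := by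
    intro x y hx hxy
    have hx0 := hδ.trans_le hx
    have hy0 := hx0.trans_le hxy
    have h1 := Real.log_le_log hx0 hxy
    rw [abs_of_nonpos (by linarith), abs_of_nonpos (by linarith), neg_sub, neg_sub,
      ← Real.log_div hy0.ne' hx0.ne']
    refine (Real.log_le_sub_one_of_pos (div_pos hy0 hx0)).trans ?_
    rw [div_sub_one hx0.ne']
    exact div_le_div_of_nonneg_left (by linarith) hδ hx
  have hlog' : |Real.log x - Real.log y| ≤ |x - y| / δ := by
    rcases le_total x y with hxy | hxy
    · exact hlog hx hxy
    · rw [abs_sub_comm, abs_sub_comm x]; exact hlog hy hxy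
  rw [Real.dist_eq, Real.dist_eq, Real.coe_toNNReal _ (by positivity)]
  calc |N x - N y| ≤ A * |Real.log x - Real.log y| :=
        h.lip x (hδ.trans_le hx) y (hδ.trans_le hy)
    _ ≤ A * (|x - y| / δ) := mul_le_mul_of_nonneg_left hlog' hA
    _ = _ := by ring

lemma GoodFn.absolutelyContinuousOnInterval (h : GoodFn A N) {a b : ℝ} (ha : 0 < a)
    (hab : a ≤ b) : AbsolutelyContinuousOnInterval N a b :=
  ((h.lipschitzOnWith_Ici ha).mono (by
    rw [uIcc_of_le hab]; exact Icc_subset_Ici_self)).absolutelyContinuousOnInterval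

lemma GoodFn.ae_differentiableAt (h : GoodFn A N) :
    ∀ᵐ ω ∂(volume.restrict (Ioi (0 : ℝ))), DifferentiableAt ℝ N ω := by
  rw [ae_restrict_iff' measurableSet_Ioi]
  have : ∀ n : ℕ, ∀ᵐ ω : ℝ, ω ∈ uIcc (1 / ((n : ℝ) + 1)) (n + 2) → DifferentiableAt ℝ N ω :=
    fun n => (h.absolutelyContinuousOnInterval (by positivity) (by
      have : (0 : ℝ) ≤ n := Nat.cast_nonneg n
      rw [div_le_iff₀ (by positivity)]; nlinarith)).ae_differentiableAt
  rw [← ae_all_iff] at this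
  filter_upwards [this] with ω hω hpos
  obtain ⟨n, hn⟩ := exists_nat_gt (max ω (1 / ω))
  have h1 : ω < n := (le_max_left _ _).trans_lt hn
  have h2 : 1 / ω < n := (le_max_right _ _).trans_lt hn
  refine hω n ?_
  rw [div_lt_iff₀ hpos] at h2
  refine Icc_subset_uIcc ⟨?_, by linarith⟩
  have hp : (0 : ℝ) < ω := hpos
  rw [div_le_iff₀ (by positivity)]
  nlinarith

/-- The weak derivative is the pointwise one, which exists almost everywhere: `N` is absolutely
continuous on compact intervals and may be integrated by parts. -/
lemma GoodFn.isWeakD (h : GoodFn A N) : IsWeakD N (fun ω => ω * deriv N ω) := by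
  have hA := h.nonneg
  refine ⟨h.continuousOn.locallyIntegrableOn measurableSet_Ioi, ?_, ?_⟩
  · refine (locallyIntegrableOn_iff isOpen_Ioi.isLocallyClosed).2 fun k hk hkc => ?_
    refine Measure.integrableOn_of_bounded (M := A) hkc.measure_lt_top.ne
      (measurable_id.mul (measurable_deriv N)).aestronglyMeasurable ?_
    filter_upwards [ae_restrict_mem hkc.measurableSet] with ω hω
    exact h.abs_mul_deriv_le (hk hω)
  · intro φ hφ hcs hts
    obtain ⟨a, b, ha, hab, hsub⟩ : ∃ a b : ℝ, 0 < a ∧ a ≤ b ∧ tsupport φ ⊆ Ioo a b := by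
      have hc : IsCompact (tsupport φ) := hcs
      rcases (tsupport φ).eq_empty_or_nonempty with he | hne
      · exact ⟨1, 1, one_pos, le_rfl, by rw [he]; exact empty_subset _⟩
      · have h1 : (0 : ℝ) < sInf (tsupport φ) := hts (hc.sInf_mem hne)
        obtain ⟨x, hx⟩ := hne
        have h2 := csInf_le hc.bddBelow hx
        have h3 := le_csSup hc.bddAbove hx
        refine ⟨sInf (tsupport φ) / 2, sSup (tsupport φ) + 1, by linarith, by linarith,
          fun y hy => ⟨?_, ?_⟩⟩
        · have := csInf_le hc.bddBelow hy
          linarith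
        · have := le_csSup hc.bddAbove hy
          linarith
    have hzero : ∀ x, x ∉ Ioo a b → φ x = 0 := fun x hx =>
      image_eq_zero_of_notMem_tsupport fun hc => hx (hsub hc)
    have hdzero : ∀ x, x ∉ Ioo a b → deriv φ x = 0 := fun x hx => by
      by_contra hne
      exact hx (hsub (support_deriv_subset hne))
    have hsubI : Ioc a b ⊆ Ioi 0 := fun x hx => ha.trans hx.1
    have hac : AbsolutelyContinuousOnInterval φ a b :=
      (hφ.of_le (by simp)).contDiffOn.absolutelyContinuousOnInterval
    have hparts := (h.absolutelyContinuousOnInterval ha hab).integral_mul_deriv_eq_deriv_mul hac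
    rw [hzero a (by simp), hzero b (by simp), mul_zero, mul_zero, sub_zero, zero_sub,
      intervalIntegral.integral_of_le hab, intervalIntegral.integral_of_le hab] at hparts
    rw [setIntegral_eq_of_subset_of_forall_sdiff_eq_zero measurableSet_Ioi hsubI fun x hx => by
        rw [hdzero x fun hc => hx.2 (Ioo_subset_Ioc_self hc), mul_zero],
      setIntegral_eq_of_subset_of_forall_sdiff_eq_zero measurableSet_Ioi hsubI fun x hx => by
        rw [hzero x fun hc => hx.2 (Ioo_subset_Ioc_self hc), mul_zero], hparts]
    congr 1
    refine setIntegral_congr_fun measurableSet_Ioc fun x hx => ?_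
    have : x ≠ 0 := (hsubI hx).ne'
    simp only
    rw [mul_div_cancel_left₀ _ this]

/-- Conversely, bounds for the dilation differences bound `D N` in `L^p`, by Fatou's lemma for the
difference quotients. -/
lemma GoodFn.energy_mul_deriv_le (h : GoodFn A N) {p : ℕ} {B : ℝ≥0∞}
    (hB : ∀ a : ℝ, 1 < a → energy p (fun x => N (x * a) - N x) ≤ ENNReal.ofReal ((a - 1) ^ p) * B) :
    energy p (fun ω => ω * deriv N ω) ≤ B := by
  let a : ℕ → ℝ := fun n => 1 + 1 / ((n : ℝ) + 1)
  have ha : ∀ n, 1 < a n := fun n => by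
    have : 0 < 1 / ((n : ℝ) + 1) := by positivity
    simp only [a]; linarith
  let Q : ℕ → ℝ → ℝ≥0∞ := fun n x => ENNReal.ofReal (|(N (x * a n) - N x) / (a n - 1)| ^ p)
  have hQ : ∀ n, ∫⁻ x in Ioi (0 : ℝ), Q n x ≤ B := by
    intro n
    have hn : 0 < (a n - 1) ^ p := pow_pos (by linarith [ha n]) p
    have e : ∀ x, Q n x = ENNReal.ofReal ((a n - 1) ^ p)⁻¹ *
        ENNReal.ofReal (|N (x * a n) - N x| ^ p) := by
      intro x
      simp only [Q]
      rw [← ENNReal.ofReal_mul (by positivity), abs_div, div_pow, div_eq_inv_mul,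
        abs_of_pos (show 0 < a n - 1 by linarith [ha n])]
    rw [lintegral_congr e, lintegral_const_mul' _ _ ENNReal.ofReal_ne_top]
    calc _ ≤ ENNReal.ofReal ((a n - 1) ^ p)⁻¹ * (ENNReal.ofReal ((a n - 1) ^ p) * B) :=
          mul_le_mul_right (hB _ (ha n)) _
      _ = B := by
          rw [← mul_assoc, ← ENNReal.ofReal_mul (by positivity), inv_mul_cancel₀ hn.ne',
            ENNReal.ofReal_one, one_mul]
  have hm : ∀ n, AEMeasurable (Q n) (volume.restrict (Ioi 0)) := fun n =>
    ((((h.dilate (one_pos.trans (ha n))).continuousOn.sub h.continuousOn).div_const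
      _).abs.pow p).aemeasurable measurableSet_Ioi |>.ennreal_ofReal
  have hlim : ∀ᵐ x ∂(volume.restrict (Ioi (0 : ℝ))),
      ENNReal.ofReal (|x * deriv N x| ^ p) = Filter.liminf (fun n => Q n x) Filter.atTop := by
    filter_upwards [h.ae_differentiableAt, ae_restrict_mem measurableSet_Ioi] with x hx hx0
    have hx0 : (0 : ℝ) < x := hx0
    refine (Filter.Tendsto.liminf_eq ?_).symm
    refine (ENNReal.continuous_ofReal.tendsto _).comp (Filter.Tendsto.pow (Filter.Tendsto.abs ?_) p)
    have h1 : Filter.Tendsto (fun n => x * a n) Filter.atTop (nhdsWithin x {x}ᶜ) := by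
      refine tendsto_nhdsWithin_iff.2 ⟨?_, Filter.Eventually.of_forall fun n => ?_⟩
      · have := (tendsto_one_div_add_atTop_nhds_zero_nat (𝕜 := ℝ)).const_add 1
        simpa [a] using this.const_mul x
      · have := ha n
        simp only [mem_compl_iff, mem_singleton_iff]
        nlinarith
    have h2 := ((hasDerivAt_iff_tendsto_slope.1 hx.hasDerivAt).comp h1).const_mul x
    refine h2.congr fun n => ?_
    have h3 : a n - 1 ≠ 0 := by linarith [ha n]
    simp only [Function.comp_apply, slope_def_field]
    have h4 : x * a n - x = x * (a n - 1) := by ring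
    rw [h4]
    field_simp
  rw [energy, lintegral_congr_ae hlim]
  refine (lintegral_liminf_le' hm).trans ?_
  exact Filter.liminf_le_of_le (by isBoundedDefault) fun b hb => by
    obtain ⟨n, hn⟩ := hb.exists
    exact hn.trans (hQ n)

lemma eLpNorm_two_mul_eq {f : ℝ → ℝ} {p₀ : ℕ} (hp : 1 ≤ p₀) :
    eLpNorm f (2 * (p₀ : ℝ≥0∞)) halfLine = energy (2 * p₀) f ^ (1 / ((2 * p₀ : ℕ) : ℝ)) := by
  have h0 : ((2 * p₀ : ℕ) : ℝ≥0∞) = 2 * (p₀ : ℝ≥0∞) := by push_cast; rfl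
  have h1 : ((2 * p₀ : ℕ) : ℝ≥0∞) ≠ 0 := by
    rw [Nat.cast_ne_zero]; omega
  rw [← h0, eLpNorm_eq_lintegral_rpow_enorm_toReal h1 (ENNReal.natCast_ne_top _),
    ENNReal.toReal_natCast, energy, halfLine]
  congr 2
  funext x
  rw [ENNReal.rpow_natCast, Real.enorm_eq_ofReal_abs, ENNReal.ofReal_pow (abs_nonneg _)]

/-- The norm of `X` in terms of a Lipschitz constant and of dilation differences. -/
lemma GoodFn.normX_le (h : GoodFn A N) {p₀ : ℕ} (hp : 1 ≤ p₀) {B : ℝ≥0∞}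
    (hB : ∀ a : ℝ, 1 < a →
      energy (2 * p₀) (fun x => N (x * a) - N x) ≤ ENNReal.ofReal ((a - 1) ^ (2 * p₀)) * B) :
    normX p₀ N ≤ ENNReal.ofReal A +
      (B ^ (1 / ((2 * p₀ : ℕ) : ℝ)) + ENNReal.ofReal A) := by
  have htop : ∀ {f : ℝ → ℝ}, (∀ x : ℝ, 0 < x → |f x| ≤ A) →
      eLpNorm f ∞ halfLine ≤ ENNReal.ofReal A := fun {f} hf => by
    rw [eLpNorm_exponent_top]
    refine eLpNormEssSup_le_of_ae_bound ?_
    filter_upwards [ae_restrict_mem measurableSet_Ioi] with x hx using hf x hx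
  refine add_le_add (htop h.bound) ((iInf₂_le _ h.isWeakD).trans (add_le_add ?_
    (htop fun x hx => h.abs_mul_deriv_le hx)))
  rw [eLpNorm_two_mul_eq hp]
  exact ENNReal.rpow_le_rpow (h.energy_mul_deriv_le hB) (by positivity)

end

/-! ### The integral equation -/

/-- Solutions of the time-integrated equation, without reference to the initial values. -/
structure IntegralSol (β T : ℝ) (N : ℝ → ℝ → ℝ) : Prop where
  integrable : ∀ ω : ℝ, 0 < ω → IntegrableOn (fun t => collision β (N t) ω) (Ioc 0 T)
  eqn : ∀ ω : ℝ, 0 < ω → ∀ t ∈ Icc 0 T, N t ω = N 0 ω + ∫ s in (0 : ℝ)..t, collision β (N s) ω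

section

variable {β C r s K D A T Λ : ℝ} {N : ℝ → ℝ → ℝ}

lemma StepData.abs_collision_le (hd : StepData β C r s K D) {N : ℝ → ℝ} (hN : GoodFn A N) {ω : ℝ}
    (hω : 0 < ω) : |collision β N ω| ≤ supRate C s A := by
  rw [← collisionReg_zero]
  exact abs_collisionReg_le hd.weight hd.exps hN hω le_rfl

lemma IntegralSol.intervalIntegrable (h : IntegralSol β T N) {a b ω : ℝ} (hω : 0 < ω)
    (ha : 0 ≤ a) (hab : a ≤ b) (hb : b ≤ T) :
    IntervalIntegrable (fun t => collision β (N t) ω) volume a b :=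
  (intervalIntegrable_iff_integrableOn_Ioc_of_le hab).2
    ((h.integrable ω hω).mono_set (Ioc_subset_Ioc ha hb))

lemma IntegralSol.sub_eq (h : IntegralSol β T N) {a b ω : ℝ} (hω : 0 < ω)
    (ha : 0 ≤ a) (hab : a ≤ b) (hb : b ≤ T) :
    N b ω - N a ω = ∫ t in a..b, collision β (N t) ω := by
  rw [h.eqn ω hω b ⟨ha.trans hab, hb⟩, h.eqn ω hω a ⟨ha, hab.trans hb⟩, add_sub_add_left_eq_sub,
    intervalIntegral.integral_interval_sub_left
      (h.intervalIntegrable hω le_rfl (ha.trans hab) hb)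
      (h.intervalIntegrable hω le_rfl ha (hab.trans hb))]

lemma IntegralSol.abs_sub_le (h : IntegralSol β T N) (hd : StepData β C r s K D)
    (hN : ∀ t ∈ Icc 0 T, GoodFn A (N t)) {a b ω : ℝ} (hω : 0 < ω)
    (ha : 0 ≤ a) (hab : a ≤ b) (hb : b ≤ T) : |N b ω - N a ω| ≤ supRate C s A * (b - a) := by
  rw [h.sub_eq hω ha hab hb, ← Real.norm_eq_abs]
  refine (intervalIntegral.norm_integral_le_of_norm_le_const fun t ht => ?_).trans_eq
    (by rw [abs_of_nonneg (by linarith : (0 : ℝ) ≤ b - a)])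
  rw [uIoc_of_le hab] at ht
  exact hd.abs_collision_le (hN t ⟨ha.trans ht.1.le, ht.2.trans hb⟩) hω

/-- Exact solutions are approximate solutions for every cutoff, without a fixed error. -/
lemma IntegralSol.approxSol (h : IntegralSol β T N) (hd : StepData β C r s K D)
    (hN : ∀ t ∈ Icc 0 T, GoodFn A (N t)) {ε : ℝ} (hε : 0 < ε) :
    ApproxSol β ε (cutError C s A ε) (regLip C A ε * supRate C s A) 0 T N := by
  intro a b ha hab hb ω hω
  have hgA := hN a ⟨ha, hab.trans hb⟩
  have hA := hgA.nonneg
  have hS := hd.supRate_nonneg hA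
  have hL := hd.regLip_nonneg (A := A) hε
  have hint := h.intervalIntegrable hω ha hab hb
  have e : N b ω - N a ω - (b - a) * collisionReg β ε (N a) ω =
      ∫ t in a..b, (collision β (N t) ω - collisionReg β ε (N a) ω) := by
    rw [intervalIntegral.integral_sub hint (by simp), h.sub_eq hω ha hab hb,
      intervalIntegral.integral_const, smul_eq_mul]
  rw [e, ← Real.norm_eq_abs, add_zero]
  refine (intervalIntegral.norm_integral_le_of_norm_le_const (C := cutError C s A ε +
    regLip C A ε * supRate C s A * (b - a)) fun t ht => ?_).trans_eq
    (by rw [abs_of_nonneg (by linarith : (0 : ℝ) ≤ b - a), mul_comm])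
  rw [uIoc_of_le hab] at ht
  have hg := hN t ⟨ha.trans ht.1.le, ht.2.trans hb⟩
  have h1 := abs_collision_sub_collisionReg_le hd.weight hd.exps hg hω hε.le
  have h2 := abs_collisionReg_sub_le hd.weight hd.exps hg hgA hε
    (fun x hx => h.abs_sub_le hd hN hx ha ht.1.le (ht.2.trans hb)) hω
  have h3 : regLip C A ε * (supRate C s A * (t - a)) ≤
      regLip C A ε * supRate C s A * (b - a) := by
    rw [← mul_assoc]
    exact mul_le_mul_of_nonneg_left (by linarith [ht.2]) (mul_nonneg hL hS)
  rw [Real.norm_eq_abs]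
  have e2 : collision β (N t) ω - collisionReg β ε (N a) ω =
    (collision β (N t) ω - collisionReg β ε (N t) ω) +
      (collisionReg β ε (N t) ω - collisionReg β ε (N a) ω) := by ring
  rw [e2]
  refine (abs_add_le _ _).trans (add_le_add h1 (h2.trans ?_))
  exact h3

/-- The collision integral is a uniform limit, as `ε → 0`, of integrals with cutoff, which are
continuous in time. -/
lemma continuousOn_collision (hd : StepData β C r s K D)
    (hN : ∀ t ∈ Icc 0 T, GoodFn A (N t)) (hΛ0 : 0 ≤ Λ)
    (hΛ : ∀ a ∈ Icc 0 T, ∀ b ∈ Icc 0 T, ∀ ω : ℝ, 0 < ω → |N b ω - N a ω| ≤ Λ * |b - a|)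
    {ω : ℝ} (hω : 0 < ω) : ContinuousOn (fun t => collision β (N t) ω) (Icc 0 T) := by
  intro a ha
  rw [ContinuousWithinAt, Metric.tendsto_nhdsWithin_nhds]
  intro η hη
  obtain ⟨ε, hε1, hε⟩ : ∃ ε, cutError C s A ε < η / 4 ∧ 0 < ε :=
    ((hd.tendsto_cutError.eventually_lt_const (by positivity : 0 < η / 4)).and
      self_mem_nhdsWithin).exists
  have hL := hd.regLip_nonneg (A := A) hε
  refine ⟨η / (2 * (regLip C A ε * Λ + 1)), by positivity, fun t ht hta => ?_⟩
  have h1 := abs_collision_sub_collisionReg_le hd.weight hd.exps (hN t ht) hω hε.le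
  have h2 := abs_collision_sub_collisionReg_le hd.weight hd.exps (hN a ha) hω hε.le
  have h3 := abs_collisionReg_sub_le hd.weight hd.exps (hN t ht) (hN a ha) hε
    (fun x hx => hΛ a ha t ht x hx) hω
  change _ ≤ cutError C s A ε at h1 h2
  change _ ≤ regLip C A ε * (Λ * |t - a|) at h3
  rw [Real.dist_eq, lt_div_iff₀ (by positivity)] at hta
  have h4 : regLip C A ε * (Λ * |t - a|) ≤ η / 2 := by
    have := abs_nonneg (t - a)
    nlinarith
  rw [Real.dist_eq]
  rw [abs_le] at h1 h2 h3
  rw [abs_lt]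
  constructor <;> linarith [h1.1, h1.2, h2.1, h2.2, h3.1, h3.2]

/-- A function that is an approximate solution for every cutoff, without a fixed error, solves the
integral equation: its right derivative is `collision β (N t) ω`, which is continuous in time. -/
lemma integralSol_of_approxSol (hd : StepData β C r s K D)
    (hN : ∀ t ∈ Icc 0 T, GoodFn A (N t)) {L : ℝ → ℝ} (hL : ∀ ε, 0 < ε → 0 ≤ L ε)
    (h : ∀ ε : ℝ, 0 < ε → ApproxSol β ε (cutError C s A ε) (L ε) 0 T N) (hT : 0 ≤ T) :
    IntegralSol β T N ∧ ∀ ω : ℝ, 0 < ω →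
      ContinuousOn (fun t => collision β (N t) ω) (Icc 0 T) := by
  have hA := (hN 0 ⟨le_rfl, hT⟩).nonneg
  have hS := hd.supRate_nonneg hA
  have hκ := hd.cutError_nonneg hA one_pos
  have hL1 := hL 1 one_pos
  set Λ := supRate C s A + cutError C s A 1 + L 1 * T with hΛdef
  have hΛ0 : 0 ≤ Λ := by positivity
  have hΛ' : ∀ a b : ℝ, 0 ≤ a → a ≤ b → b ≤ T → ∀ ω : ℝ, 0 < ω →
      |N b ω - N a ω| ≤ Λ * (b - a) := by
    intro a b ha hab hb ω hω
    have h1 := h 1 one_pos a b ha hab hb ω hω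
    have h2 := abs_collisionReg_le (ε := 1) hd.weight hd.exps (hN a ⟨ha, hab.trans hb⟩) hω
      zero_le_one
    change _ ≤ supRate C s A at h2
    have h3 : |(b - a) * collisionReg β 1 (N a) ω| ≤ (b - a) * supRate C s A := by
      rw [abs_mul, abs_of_nonneg (by linarith : 0 ≤ b - a)]
      exact mul_le_mul_of_nonneg_left h2 (by linarith)
    have h4 : (b - a) * (L 1 * (b - a)) ≤ (b - a) * (L 1 * T) :=
      mul_le_mul_of_nonneg_left (mul_le_mul_of_nonneg_left (by linarith) hL1) (by linarith)
    rw [abs_le] at *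
    rw [hΛdef]
    constructor <;> linarith [h1.1, h1.2, h3.1, h3.2]
  have hΛ : ∀ a ∈ Icc 0 T, ∀ b ∈ Icc 0 T, ∀ ω : ℝ, 0 < ω → |N b ω - N a ω| ≤ Λ * |b - a| := by
    intro a ha b hb ω hω
    rcases le_total a b with hab | hab
    · rw [abs_of_nonneg (by linarith : 0 ≤ b - a)]
      exact hΛ' a b ha.1 hab hb.2 ω hω
    · rw [abs_sub_comm, abs_sub_comm b, abs_of_nonneg (by linarith : 0 ≤ a - b)]
      exact hΛ' b a hb.1 hab ha.2 ω hω
  have hc := fun ω hω => continuousOn_collision hd hN hΛ0 hΛ (ω := ω) hω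
  have hcN : ∀ ω : ℝ, 0 < ω → ContinuousOn (fun t => N t ω) (Icc 0 T) := fun ω hω =>
    (LipschitzOnWith.of_dist_le_mul (K := Λ.toNNReal) fun b hb a ha => by
      rw [Real.dist_eq, Real.dist_eq, Real.coe_toNNReal _ hΛ0]
      exact hΛ a ha b hb ω hω).continuousOn
  refine ⟨⟨fun ω hω => (hc ω hω).integrableOn_Icc.mono_set Ioc_subset_Icc_self,
    fun ω hω t ht => ?_⟩, hc⟩
  have hsub : Icc 0 t ⊆ Icc 0 T := Icc_subset_Icc_right ht.2
  have := intervalIntegral.integral_eq_sub_of_hasDeriv_right_of_le ht.1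
    ((hcN ω hω).mono hsub) (f' := fun t => collision β (N t) ω) (fun a ha => ?_)
    ((hc ω hω).mono hsub |>.intervalIntegrable_of_Icc ht.1)
  · rw [this]; ring
  -- the right derivative at `a`
  rw [hasDerivWithinAt_iff_isLittleO, Asymptotics.isLittleO_iff]
  intro η hη
  obtain ⟨ε, hε1, hε⟩ : ∃ ε, cutError C s A ε < η / 4 ∧ 0 < ε :=
    ((hd.tendsto_cutError.eventually_lt_const (by positivity : 0 < η / 4)).and
      self_mem_nhdsWithin).exists
  have hLε := hL ε hε
  have haT : a < T := ha.2.trans_le ht.2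
  have hev : ∀ᶠ b in nhdsWithin a (Ioi a), b < min T (a + η / (2 * (L ε + 1))) :=
    nhdsWithin_le_nhds (Iio_mem_nhds (lt_min haT (by
      have : 0 < η / (2 * (L ε + 1)) := by positivity
      linarith)))
  filter_upwards [hev, self_mem_nhdsWithin] with b hb hab
  have hab : a < b := hab
  obtain ⟨hb1, hb2⟩ := lt_min_iff.1 hb
  have h1 := h ε hε a b ha.1.le hab.le hb1.le ω hω
  have h2 := abs_collision_sub_collisionReg_le hd.weight hd.exps (hN a ⟨ha.1.le, haT.le⟩) hω hε.le
  change _ ≤ cutError C s A ε at h2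
  have h3 : L ε * (b - a) ≤ η / 2 := by
    have h5 : b - a < η / (2 * (L ε + 1)) := by linarith
    rw [lt_div_iff₀ (by positivity)] at h5
    nlinarith
  have h6 : |(b - a) * (collision β (N a) ω - collisionReg β ε (N a) ω)| ≤
      (b - a) * cutError C s A ε := by
    rw [abs_mul, abs_of_pos (by linarith : 0 < b - a)]
    exact mul_le_mul_of_nonneg_left h2 (by linarith)
  rw [Real.norm_eq_abs, Real.norm_eq_abs, smul_eq_mul, abs_of_pos (by linarith : 0 < b - a)]
  have e : N b ω - N a ω - (b - a) * collision β (N a) ω =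
      (N b ω - N a ω - (b - a) * collisionReg β ε (N a) ω) -
      (b - a) * (collision β (N a) ω - collisionReg β ε (N a) ω) := by ring
  rw [e]
  refine (abs_sub _ _).trans ((add_le_add h1 h6).trans ?_)
  have h7 : (b - a) * (2 * cutError C s A ε + L ε * (b - a)) ≤ (b - a) * η :=
    mul_le_mul_of_nonneg_left (by linarith) (by linarith)
  linarith

lemma IntegralSol.hasDerivAt (h : IntegralSol β T N) {ω : ℝ} (hω : 0 < ω)
    (hc : ContinuousOn (fun t => collision β (N t) ω) (Icc 0 T)) {t : ℝ} (ht : t ∈ Ioo 0 T) :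
    HasDerivAt (fun s => N s ω) (collision β (N t) ω) t := by
  have hn : Icc 0 T ∈ nhds t := Icc_mem_nhds ht.1 ht.2
  have h1 := (intervalIntegral.integral_hasDerivAt_right
    (h.intervalIntegrable hω le_rfl ht.1.le ht.2.le)
    (hc.stronglyMeasurableAtFilter_nhdsWithin measurableSet_Icc t |>.filter_mono (by
      rw [nhdsWithin_eq_nhds.2 hn])) (hc.continuousAt hn)).const_add (N 0 ω)
  refine h1.congr_of_eventuallyEq ?_
  filter_upwards [hn] with x hx using h.eqn ω hω x hx

end

/-! ### Regularity in both variables -/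

section

variable {β C r s K D A T : ℝ} {N : ℝ → ℝ → ℝ}

lemma IntegralSol.lipschitzOnWith (h : IntegralSol β T N) (hd : StepData β C r s K D)
    (hN : ∀ t ∈ Icc 0 T, GoodFn A (N t)) {ω : ℝ} (hω : 0 < ω) :
    LipschitzOnWith (supRate C s A).toNNReal (fun t => N t ω) (Icc 0 T) := by
  refine LipschitzOnWith.of_dist_le_mul fun b hb a ha => ?_
  have hS := hd.supRate_nonneg (hN a ha).nonneg
  rw [Real.dist_eq, Real.dist_eq, Real.coe_toNNReal _ hS]
  rcases le_total a b with hab | hab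
  · rw [abs_of_nonneg (by linarith : 0 ≤ b - a)]
    exact h.abs_sub_le hd hN hω ha.1 hab hb.2
  · rw [abs_sub_comm, abs_sub_comm b, abs_of_nonneg (by linarith : 0 ≤ a - b)]
    exact h.abs_sub_le hd hN hω hb.1 hab ha.2

lemma IntegralSol.lipschitzOnWith_prod (h : IntegralSol β T N) (hd : StepData β C r s K D)
    (hN : ∀ t ∈ Icc 0 T, GoodFn A (N t)) {δ : ℝ} (hδ : 0 < δ) :
    LipschitzOnWith ((supRate C s A).toNNReal + (A / δ).toNNReal)
      (fun z : ℝ × ℝ => N z.1 z.2) (Icc 0 T ×ˢ Ici δ) := by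
  refine LipschitzOnWith.of_dist_le_mul ?_
  rintro ⟨t, x⟩ ⟨ht, hx⟩ ⟨t', x'⟩ ⟨ht', hx'⟩
  have h1 := (h.lipschitzOnWith hd hN (hδ.trans_le hx)).dist_le_mul t ht t' ht'
  have h2 := ((hN t' ht').lipschitzOnWith_Ici hδ).dist_le_mul x hx x' hx'
  refine (dist_triangle _ (N t' x) _).trans ?_
  rw [Prod.dist_eq, NNReal.coe_add, add_mul]
  refine add_le_add (h1.trans ?_) (h2.trans ?_)
  · exact mul_le_mul_of_nonneg_left (le_max_left _ _) (NNReal.coe_nonneg _)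
  · exact mul_le_mul_of_nonneg_left (le_max_right _ _) (NNReal.coe_nonneg _)

lemma IntegralSol.continuousOn_prod (h : IntegralSol β T N) (hd : StepData β C r s K D)
    (hN : ∀ t ∈ Icc 0 T, GoodFn A (N t)) :
    ContinuousOn (fun z : ℝ × ℝ => N z.1 z.2) (Icc 0 T ×ˢ Ioi 0) := by
  rintro ⟨t, x⟩ ⟨ht, hx⟩
  have hx0 : (0 : ℝ) < x := hx
  have h1 := (h.lipschitzOnWith_prod hd hN (half_pos hx0)).continuousOn (t, x)
    ⟨ht, (half_lt_self hx0).le⟩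
  refine h1.mono_of_mem_nhdsWithin ?_
  have h2 : (univ : Set ℝ) ×ˢ Ioi (x / 2) ∈ nhds (t, x) :=
    prod_mem_nhds Filter.univ_mem (Ioi_mem_nhds (half_lt_self hx0))
  filter_upwards [self_mem_nhdsWithin, mem_nhdsWithin_of_mem_nhds h2] with z hz hz2
  exact ⟨hz.1, Ioi_subset_Ici_self hz2.2⟩

/-- Rademacher's theorem on the sets `ω > 1 / (n + 1)`. -/
lemma IntegralSol.ae_differentiableAt (h : IntegralSol β T N) (hd : StepData β C r s K D)
    (hN : ∀ t ∈ Icc 0 T, GoodFn A (N t)) :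
    ∀ᵐ z ∂(volume.restrict (Ioo (0 : ℝ) T ×ˢ Ioi (0 : ℝ))),
      DifferentiableAt ℝ (fun y : ℝ × ℝ => N y.1 y.2) z := by
  rw [ae_restrict_iff' (measurableSet_Ioo.prod measurableSet_Ioi)]
  have h1 : ∀ n : ℕ, ∀ᵐ z : ℝ × ℝ, z ∈ Ioo 0 T ×ˢ Ioi (1 / ((n : ℝ) + 1)) →
      DifferentiableWithinAt ℝ (fun y : ℝ × ℝ => N y.1 y.2)
        (Ioo 0 T ×ˢ Ioi (1 / ((n : ℝ) + 1))) z := fun n =>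
    ((h.lipschitzOnWith_prod hd hN (δ := 1 / ((n : ℝ) + 1)) (by positivity)).mono
      (prod_mono Ioo_subset_Icc_self Ioi_subset_Ici_self)).ae_differentiableWithinAt_of_mem
  filter_upwards [ae_all_iff.2 h1] with z hz hmem
  obtain ⟨n, hn⟩ := exists_nat_one_div_lt (show (0 : ℝ) < z.2 from hmem.2)
  exact (hz n ⟨hmem.1, hn⟩).differentiableAt
    ((isOpen_Ioo.prod isOpen_Ioi).mem_nhds ⟨hmem.1, hn⟩)

lemma integrableOn_collisionIntegrand_prod (hd : StepData β C r s K D)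
    (hN : ∀ t ∈ Icc 0 T, GoodFn A (N t))
    (hc : ContinuousOn (fun z : ℝ × ℝ => N z.1 z.2) (Icc 0 T ×ˢ Ioi 0)) {ω : ℝ} (hω : 0 < ω) :
    IntegrableOn (fun z : ℝ × ℝ => collisionIntegrand β (N z.1) ω z.2)
      (Ioo 0 T ×ˢ Ioo 0 1) := by
  have hcont : ContinuousOn (fun z : ℝ × ℝ => collisionIntegrand β (N z.1) ω z.2)
      (Ioo 0 T ×ˢ Ioo 0 1) := by
    refine (continuousOn_core (f := Prod.snd) (n := fun z => sample (N z.1) ω z.2) β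
      continuousOn_snd (fun _ h => h.2) fun i k => ?_).congr
      fun z hz => collisionIntegrand_eq_core β (N z.1) ω hz.2
    refine continuousOn_sample_param (N := fun z : ℝ × ℝ => N z.1) (g := fun _ => ω) ?_
      continuousOn_snd (fun _ h => h.2) continuousOn_const (fun _ _ => hω) i k
    refine hc.comp ((continuous_fst.comp continuous_fst).prodMk continuous_snd).continuousOn ?_
    exact fun z hz => ⟨Ioo_subset_Icc_self hz.1.1, hz.2⟩
  have hmeas := measurableSet_Ioo (a := (0 : ℝ)) (b := T) |>.prod
    (measurableSet_Ioo (a := (0 : ℝ)) (b := 1))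
  have hg : IntegrableOn (fun z : ℝ × ℝ => 20 * C ^ 3 * A ^ 3 * z.2 ^ s)
      (Ioo 0 T ×ˢ Ioo 0 1) := by
    have h1 : Integrable (fun _ : ℝ => (1 : ℝ)) (volume.restrict (Ioo 0 T)) :=
      integrableOn_const (by simp)
    have := h1.mul_prod ((integrableOn_rpow hd.exps.s_gt).const_mul (20 * C ^ 3 * A ^ 3))
    rw [Measure.prod_restrict] at this
    simpa only [one_mul, IntegrableOn, Measure.volume_eq_prod] using this
  refine Integrable.mono' hg (hcont.aestronglyMeasurable hmeas) ?_
  filter_upwards [ae_restrict_mem hmeas] with z hz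
  exact abs_collisionIntegrand_le hd.weight hd.exps (hN z.1 (Ioo_subset_Icc_self hz.1)) hω hz.2

end

/-! ### Solutions in `L^∞(0, T; X)` -/

section

variable {β C r s K D T : ℝ} {p₀ : ℕ} {N₀ : ℝ → ℝ} {M : ℝ → ℝ → ℝ}

lemma MemX.goodFn {N : ℝ → ℝ} (h : MemX p₀ N) {B : ℝ≥0} (hB : normX p₀ N < B) : GoodFn B N := by
  obtain ⟨G, hG, h1, h2, -⟩ := exists_isWeakD_of_normX_lt hB
  exact goodFn_of_weakD h.1 hG h1 h2

/-- A property of almost all times holds at times arbitrarily close to any given one. -/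
lemma frequently_of_ae {P : ℝ → Prop} (h : ∀ᵐ t ∂(volume.restrict (Ioo 0 T)), P t) (hT : 0 < T)
    {t : ℝ} (ht : t ∈ Icc 0 T) : ∃ᶠ s in nhdsWithin t (Icc 0 T), P s := by
  intro hcon
  rw [ae_restrict_iff' measurableSet_Ioo] at h
  obtain ⟨U, hU, htU, hsub⟩ := mem_nhdsWithin.1 hcon
  have hne : (U ∩ Ioo 0 T).Nonempty := by
    rw [← closure_Ioo hT.ne, mem_closure_iff] at ht
    exact ht U hU htU
  have hpos := (hU.inter isOpen_Ioo).measure_pos volume hne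
  refine hpos.ne' (measure_mono_null (fun x hx => ?_) h)
  simp only [mem_compl_iff, mem_ofPred_eq, not_forall]
  exact ⟨hx.2, hsub ⟨hx.1, Ioo_subset_Icc_self hx.2⟩⟩

/-- Bounds in `X` that hold for almost every time hold at all times if the function is continuous
in time. -/
lemma MemLinftyX.exists_goodFn (h : MemLinftyX p₀ T M) (hT : 0 < T)
    (hc : ∀ ω : ℝ, 0 < ω → ContinuousOn (fun t => M t ω) (Icc 0 T)) :
    ∃ A : ℝ, ∀ t ∈ Icc 0 T, GoodFn A (M t) := by
  obtain ⟨-, B, hB⟩ := h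
  have hae : ∀ᵐ t ∂(volume.restrict (Ioo 0 T)), GoodFn ((B + 1 : ℝ≥0) : ℝ) (M t) := by
    filter_upwards [hB] with t ht
    exact ht.1.goodFn (ht.2.trans_lt (by exact_mod_cast lt_add_one B))
  refine ⟨((B + 1 : ℝ≥0) : ℝ), fun t ht => ⟨fun ω hω => ?_, fun x hx y hy => ?_⟩⟩
  · exact le_of_tendsto_of_frequently (hc ω hω t ht).abs
      ((frequently_of_ae hae hT ht).mono fun s hs => hs.bound ω hω)
  · exact le_of_tendsto_of_frequently ((hc x hx t ht).sub (hc y hy t ht)).abs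
      ((frequently_of_ae hae hT ht).mono fun s hs => hs.lip x hx y hy)

/-- Mild solutions are continuous in time because the right-hand side is integrable. -/
lemma IsMildSolution.integralSol (h : IsMildSolution β p₀ T N₀ M) (hT : 0 < T) :
    IntegralSol β T M ∧ (∀ ω : ℝ, 0 < ω → M 0 ω = N₀ ω) ∧
      ∀ ω : ℝ, 0 < ω → ContinuousOn (fun t => M t ω) (Icc 0 T) := by
  have h0 : ∀ ω : ℝ, 0 < ω → M 0 ω = N₀ ω := fun ω hω => by
    simpa using h.eqn ω hω 0 ⟨le_rfl, hT.le⟩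
  have hint : ∀ ω : ℝ, 0 < ω → IntegrableOn (fun t => collision β (M t) ω) (Ioc 0 T) := by
    intro ω hω
    have h1 := h.integrable ω hω
    rw [IntegrableOn, Measure.volume_eq_prod, ← Measure.prod_restrict] at h1
    rw [integrableOn_Ioc_iff_integrableOn_Ioo]
    exact h1.integral_prod_left
  refine ⟨⟨hint, fun ω hω t ht => ?_⟩, h0, fun ω hω => ?_⟩
  · rw [h0 ω hω]; exact h.eqn ω hω t ht
  · have h1 := intervalIntegral.continuousOn_primitive_interval (μ := volume) (a := 0) (b := T)
      (f := fun t => collision β (M t) ω) (by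
        rw [uIcc_of_le hT.le, integrableOn_Icc_iff_integrableOn_Ioc]; exact hint ω hω)
    rw [uIcc_of_le hT.le] at h1
    exact (h1.const_add (N₀ ω)).congr fun t ht => h.eqn ω hω t ht

/-- Strong solutions are Lipschitz, hence absolutely continuous in time, and are the integrals of their
derivatives. -/
lemma IsStrongSolution.integralSol (h : IsStrongSolution β p₀ T N₀ M) (hT : 0 < T) :
    IntegralSol β T M ∧ ∀ ω : ℝ, 0 < ω → ContinuousOn (fun t => M t ω) (Icc 0 T) := by
  obtain ⟨L, hL⟩ := h.lipschitz
  have hac : ∀ ω : ℝ, 0 < ω → ∀ t ∈ Icc 0 T,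
      AbsolutelyContinuousOnInterval (fun t => M t ω) 0 t := fun ω hω t ht =>
    ((hL ω hω).mono (by
      rw [uIcc_of_le ht.1]; exact Icc_subset_Icc_right ht.2)).absolutelyContinuousOnInterval
  have hae : ∀ ω : ℝ, 0 < ω → ∀ᵐ t ∂(volume.restrict (Ioc 0 T)),
      deriv (fun s => M s ω) t = collision β (M t) ω := fun ω hω => by
    rw [← restrict_Ioo_eq_restrict_Ioc]
    filter_upwards [h.eqn ω hω] with t ht using ht.deriv
  refine ⟨⟨fun ω hω => ?_, fun ω hω t ht => ?_⟩, fun ω hω => (hL ω hω).continuousOn⟩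
  · have h1 := (hac ω hω T ⟨hT.le, le_rfl⟩).intervalIntegrable_deriv
    rw [intervalIntegrable_iff_integrableOn_Ioc_of_le hT.le] at h1
    exact h1.congr (hae ω hω)
  · have h1 := (hac ω hω t ht).integral_deriv_eq_sub
    rw [intervalIntegral.integral_of_le ht.1] at h1 ⊢
    rw [← integral_congr_ae (ae_restrict_of_ae_restrict_of_subset
      (Ioc_subset_Ioc_right ht.2) (hae ω hω)), h1]
    ring

lemma IntegralSol.mono {T' : ℝ} (h : IntegralSol β T M) (hT : T' ≤ T) : IntegralSol β T' M :=
  ⟨fun ω hω => (h.integrable ω hω).mono_set (Ioc_subset_Ioc_right hT),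
    fun ω hω t ht => h.eqn ω hω t ⟨ht.1, ht.2.trans hT⟩⟩

/-- Uniqueness, in the class of solutions of the integral equation. -/
lemma IntegralSol.unique (hd : StepData β C r s K D) {A A' : ℝ} {N : ℝ → ℝ → ℝ}
    (hN : IntegralSol β T N) (hM : IntegralSol β T M)
    (gN : ∀ t ∈ Icc 0 T, GoodFn A (N t)) (gM : ∀ t ∈ Icc 0 T, GoodFn A' (M t))
    (hpos : ∀ t ∈ Icc 0 T, ∀ x : ℝ, 0 < x → 0 ≤ N t x)
    (h0 : ∀ x : ℝ, 0 < x → N 0 x = M 0 x) {t : ℝ} (ht : t ∈ Icc 0 T) {ω : ℝ} (hω : 0 < ω) :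
    N t ω = M t ω := by
  have gN' : ∀ t ∈ Icc 0 T, GoodFn (max A A') (N t) := fun t ht =>
    (gN t ht).mono (le_max_left _ _)
  have gM' : ∀ t ∈ Icc 0 T, GoodFn (max A A') (M t) := fun t ht =>
    (gM t ht).mono (le_max_right _ _)
  exact ApproxSol.eq_of_forall hd hd.tendsto_cutError
    (fun ε hε => hN.approxSol hd gN' hε) (fun ε hε => hM.approxSol hd gM' hε) gN' gM' hpos h0 ht hω

end

/-! ### Existence and uniqueness -/

section

variable {β : ℝ} {p₀ : ℕ}

lemma one_le_of_lt (hβ : β ∈ Ioo (-1 : ℝ) 1)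
    (hp₀ : max (1 / (4 * (1 - β))) (1 / (4 * (1 + β))) < (p₀ : ℝ)) : 1 ≤ p₀ := by
  have h1 : 0 < 1 / (4 * (1 - β)) := by
    have : 0 < 1 - β := by linarith [hβ.2]
    positivity
  have h2 : (0 : ℝ) < p₀ := h1.trans ((le_max_left _ _).trans_lt hp₀)
  exact_mod_cast h2

/-- The lower bound for `p₀` gives an integrable kernel `u^s`. -/
lemma exists_exponents (hβ : β ∈ Ioo (-1 : ℝ) 1)
    (hp₀ : max (1 / (4 * (1 - β))) (1 / (4 * (1 + β))) < (p₀ : ℝ)) :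
    ∃ s : ℝ, Exponents β (1 / ((2 * p₀ : ℕ) : ℝ)) s := by
  have hp1 : (1 : ℝ) ≤ p₀ := by exact_mod_cast one_le_of_lt hβ hp₀
  have h1 := (le_max_left _ _).trans_lt hp₀
  rw [div_lt_iff₀ (by linarith [hβ.2])] at h1
  have hr : 1 / ((2 * p₀ : ℕ) : ℝ) < 2 - 2 * β := by
    push_cast
    rw [div_lt_iff₀ (by positivity)]
    linarith
  set r := 1 / ((2 * p₀ : ℕ) : ℝ) with hrdef
  refine ⟨min (min (1 - 2 * β - r) (2 * β + 1)) 0, ⟨by rw [hrdef]; push_cast; positivity, ?_,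
    lt_min (lt_min (by linarith) (by linarith [hβ.1])) (by norm_num), min_le_right _ _,
    (min_le_left _ _).trans (min_le_left _ _), (min_le_left _ _).trans (min_le_right _ _)⟩⟩
  rw [hrdef]
  push_cast
  exact one_div_le_one_div_of_le (by norm_num) (by linarith)

lemma exists_stepData {r s : ℝ} (hE : Exponents β r s) : ∃ C K D : ℝ, StepData β C r s K D := by
  obtain ⟨C, hC⟩ := exists_weightBound β
  obtain ⟨K, hK⟩ := exists_stepConst hC hE
  obtain ⟨D, hD⟩ := exists_jumpRate_symm hC hE
  exact ⟨C, K, D, hC, hE, hK, hD⟩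

end

section

variable {β C r s K D T A : ℝ} {p₀ : ℕ} {N₀ : ℝ → ℝ} {N : ℝ → ℝ → ℝ}

/-- Solutions of the integral equation are mild and strong solutions. -/
lemma IntegralSol.isMildSolution (h : IntegralSol β T N) (hd : StepData β C r s K D)
    (hN : ∀ t ∈ Icc 0 T, GoodFn A (N t)) (h0 : ∀ ω : ℝ, 0 < ω → N 0 ω = N₀ ω)
    (hmem : MemLinftyX p₀ T N) : IsMildSolution β p₀ T N₀ N where
  mem := hmem
  integrable _ hω := integrableOn_collisionIntegrand_prod hd hN (h.continuousOn_prod hd hN) hω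
  eqn ω hω t ht := by rw [← h0 ω hω]; exact h.eqn ω hω t ht

lemma IntegralSol.isStrongSolution (h : IntegralSol β T N) (hd : StepData β C r s K D)
    (hN : ∀ t ∈ Icc 0 T, GoodFn A (N t)) (h0 : ∀ ω : ℝ, 0 < ω → N 0 ω = N₀ ω)
    (hc : ∀ ω : ℝ, 0 < ω → ContinuousOn (fun t => collision β (N t) ω) (Icc 0 T))
    (hmem : MemLinftyX p₀ T N) : IsStrongSolution β p₀ T N₀ N where
  mem := hmem
  init := h0
  lipschitz := ⟨_, fun _ hω => h.lipschitzOnWith hd hN hω⟩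
  eqn ω hω := by
    filter_upwards [ae_restrict_mem measurableSet_Ioo] with t ht
    exact h.hasDerivAt hω (hc ω hω) ht

/-- Bounds for dilation differences that are uniform in time give a function in `L^∞(0, T; X)`. -/
lemma memLinftyX_of_goodFn (hp : 1 ≤ p₀)
    (hc : ContinuousOn (fun z : ℝ × ℝ => N z.1 z.2) (Icc 0 T ×ˢ Ioi 0))
    (hN : ∀ t ∈ Icc 0 T, GoodFn A (N t)) {B : ℝ≥0∞} (hB : B ≠ ∞)
    (hE : ∀ a : ℝ, 1 < a → ∀ t ∈ Icc 0 T, energy (2 * p₀) (fun x => N t (x * a) - N t x) ≤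
      ENNReal.ofReal ((a - 1) ^ (2 * p₀)) * B) : MemLinftyX p₀ T N := by
  refine ⟨(hc.mono (prod_mono Ioo_subset_Icc_self subset_rfl)).aestronglyMeasurable
    (measurableSet_Ioo.prod measurableSet_Ioi), ?_⟩
  set Q := ENNReal.ofReal A + (B ^ (1 / ((2 * p₀ : ℕ) : ℝ)) + ENNReal.ofReal A) with hQ
  have hQt : Q < ∞ := by
    have := ENNReal.rpow_lt_top_of_nonneg (y := 1 / ((2 * p₀ : ℕ) : ℝ)) (by positivity) hB
    rw [hQ]
    finiteness
  refine ⟨Q.toNNReal, ?_⟩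
  filter_upwards [ae_restrict_mem measurableSet_Ioo] with t ht
  have ht' := Ioo_subset_Icc_self ht
  have h1 := (hN t ht').normX_le hp fun a ha => hE a ha t ht'
  exact ⟨⟨(hN t ht').continuousOn, h1.trans_lt hQt⟩, h1.trans_eq (ENNReal.coe_toNNReal hQt.ne).symm⟩

/-- A function in `X` is bounded and Lipschitz in `log ω`, and its dilation differences are bounded
in `L^{2p₀}`. -/
lemma MemX.exists_bounds (h : MemX p₀ N₀) (hp : 1 ≤ p₀) :
    ∃ (A : ℝ) (B : ℝ≥0∞), GoodFn A N₀ ∧ B ≠ ∞ ∧ ∀ a : ℝ, 1 < a →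
      energy (2 * p₀) (fun x => N₀ (x * a) - N₀ x) ≤ ENNReal.ofReal ((a - 1) ^ (2 * p₀)) * B := by
  obtain ⟨A, hA, -⟩ := ENNReal.lt_iff_exists_nnreal_btwn.1 h.2
  obtain ⟨G, hG, h1, h2, h3⟩ := exists_isWeakD_of_normX_lt hA
  refine ⟨A, energy (2 * p₀) G, goodFn_of_weakD h.1 hG h1 h2, fun htop => ?_, fun a ha =>
    energy_dilate_sub_le h.1 hG (by omega) ha⟩
  rw [eLpNorm_two_mul_eq hp, htop, ENNReal.top_rpow_of_pos (by positivity)] at h3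
  exact absurd h3 (by simp)

end

end MMT

theorem mainTheorem4 (β : ℝ) (p₀ : ℕ) (hβ : β ∈ Ioo (-1 : ℝ) 1)
    (hp₀ : max (1 / (4 * (1 - β))) (1 / (4 * (1 + β))) < (p₀ : ℝ))
    (N₀ : ℝ → ℝ) (hN₀ : MMT.MemX p₀ N₀) (hpos : ∃ c : ℝ, 0 < c ∧ ∀ ω : ℝ, 0 < ω → c ≤ N₀ ω) :
    ∃ T : ℝ, 0 < T ∧ ∃ N : ℝ → ℝ → ℝ,
      -- existence, in the mild and in the strong sense
      MMT.IsMildSolution β p₀ T N₀ N ∧ MMT.IsStrongSolution β p₀ T N₀ N ∧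
      -- uniqueness, in either sense
      (∀ T' ∈ Ioc 0 T, ∀ M : ℝ → ℝ → ℝ,
        MMT.IsMildSolution β p₀ T' N₀ M ∨ MMT.IsStrongSolution β p₀ T' N₀ M →
          ∀ t ∈ Icc 0 T', ∀ ω : ℝ, 0 < ω → M t ω = N t ω) ∧
      -- positive lower bound
      (∃ c : ℝ, 0 < c ∧ ∀ t ∈ Icc 0 T, ∀ ω : ℝ, 0 < ω → c ≤ N t ω) ∧
      -- continuity and differentiability almost everywhere
      ContinuousOn (fun z : ℝ × ℝ => N z.1 z.2) (Icc 0 T ×ˢ Ioi 0) ∧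
      (∀ᵐ z ∂(volume.restrict (Ioo (0 : ℝ) T ×ˢ Ioi (0 : ℝ))),
        DifferentiableAt ℝ (fun y : ℝ × ℝ => N y.1 y.2) z) := by
  obtain ⟨c, hc, hcN⟩ := hpos
  have hp := MMT.one_le_of_lt hβ hp₀
  obtain ⟨s, hE⟩ := MMT.exists_exponents hβ hp₀
  obtain ⟨C, K, D, hd⟩ := MMT.exists_stepData hE
  obtain ⟨A, B, hA, hB, hAB⟩ := hN₀.exists_bounds hp
  have hA0 : 0 < A :=
    hc.trans_le ((hcN 1 one_pos).trans ((le_abs_self _).trans (hA.bound 1 one_pos)))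
  obtain ⟨T, hT⟩ := MMT.exists_horizon hd hA0 hc
  obtain ⟨N, gN, lN, iN, aN, eN⟩ := MMT.exists_limit hd hT hA hcN
  have hT0 := hT.T_pos
  obtain ⟨sN, cN⟩ := MMT.integralSol_of_approxSol hd gN
    (fun ε hε => mul_nonneg (hd.regLip_nonneg hε) (hd.supRate_nonneg (by linarith))) aN hT0.le
  have hcont := sN.continuousOn_prod hd gN
  have hmem : MMT.MemLinftyX p₀ T N := by
    refine MMT.memLinftyX_of_goodFn hp hcont gN (B := ENNReal.ofReal (Real.exp
      (MMT.energyGrowth K D s (2 * A) * ((2 * p₀ : ℕ) * T))) * B) (by finiteness)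
      fun a ha t ht => ?_
    have hr : 1 / ((2 * p₀ : ℕ) : ℝ) * (2 * p₀ : ℕ) = 1 :=
      one_div_mul_cancel (by rw [Nat.cast_ne_zero]; omega)
    refine (eN (2 * p₀) (by omega) hr a (one_pos.trans ha) t ht).trans ?_
    rw [mul_left_comm (ENNReal.ofReal ((a - 1) ^ (2 * p₀)))]
    exact mul_le_mul_right (hAB a ha) _
  refine ⟨T, hT0, N, sN.isMildSolution hd gN iN hmem, sN.isStrongSolution hd gN iN cN hmem, ?_,
    ⟨c / 2, half_pos hc, lN⟩, hcont, sN.ae_differentiableAt hd gN⟩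
  intro T' hT' M hM t ht ω hω
  have hsub : Icc 0 T' ⊆ Icc 0 T := Icc_subset_Icc_right hT'.2
  obtain ⟨hMem, hM0, sM, cM⟩ : MMT.MemLinftyX p₀ T' M ∧ (∀ x : ℝ, 0 < x → M 0 x = N₀ x) ∧
      MMT.IntegralSol β T' M ∧
        ∀ x : ℝ, 0 < x → ContinuousOn (fun t => M t x) (Icc 0 T') := by
    rcases hM with hM | hM
    · obtain ⟨h1, h2, h3⟩ := hM.integralSol hT'.1
      exact ⟨hM.mem, h2, h1, h3⟩
    · obtain ⟨h1, h2⟩ := hM.integralSol hT'.1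
      exact ⟨hM.mem, hM.init, h1, h2⟩
  obtain ⟨A', gM⟩ := hMem.exists_goodFn hT'.1 cM
  exact ((sN.mono hT'.2).unique hd sM (fun t ht => gN t (hsub ht)) gM
    (fun t ht x hx => (half_pos hc).le.trans (lN t (hsub ht) x hx))
    (fun x hx => by rw [iN x hx, hM0 x hx]) ht hω).symm
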